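/- Let $K$ be a field of characteristic zero, $n\ge 0$, $N=\mathrm{UT}(n,K)$ the group of lower triangular $n\times n$ matrices with units on the diagonal, and ${\mathfrak n}$ its Lie algebra of strictly lower triangular matrices with basis the matrix units $y_{ij}$, $(i,j)\in A=\{(i,j): n\ge i>j\ge 1\}$. Let $M\subseteq A$ be such that ${\mathfrak m}=\mathrm{span}\{y_{ij}:(i,j)\in M\}$ is an ideal of ${\mathfrak n}$; put ${\cal L}={\mathfrak n}/{\mathfrak m}$ and $L=N/\exp({\mathfrak m})$. The group $L$ acts on ${\cal L}^*$ by the coadjoint representation, hence on $K[{\cal L}^*]=S({\cal L})$ and on its fraction field $K({\cal L}^*)$; the index of ${\cal L}$ is the minimal dimension of the stabilizer $\{x\in{\cal L}: f([x,y])=0\ \forall y\in{\cal L}\}$ over $f\in{\cal L}^*$. Order $A$ by $(n,1)\succ(n-1,1)\succ\dots\succ(2,1)\succ(n,2)\succ\dots\succ(3,2)\succ\dots\succ(n,n-1)$. The diagram ${\cal D}_{\cal L}$ is a filling of the places of $A$ built as follows. First put $\bullet$ on all places of $M$. Then, as long as there are empty places, perform a step: put $\otimes$ on the greatest empty place $(k,t)$,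 and for each $a$ with $k>a>t$ such that both places $(k,a)$ and $(a,t)$ are empty put "$-$" on $(k,a)$ and "$+$" on $(a,t)$. Let $s$ be the number of symbols $\otimes$ and $\xi_i$ the place that gets $\otimes$ during the $i$-th step. Call $z_1,\dots,z_s\in K[{\cal L}^*]^L$ *adapted* if (a) for every $i$, $z_i=y_{\xi_i}Q+P_{>i}$, where $Q$ is a product of (nonnegative) powers of $z_1,\dots,z_{i-1}$ and $P_{>i}$ is a polynomial in the $y_\eta$ with $\eta\succ\xi_i$; and (b) for some $m$ the localization of $K[{\cal L}^*]$ at the multiplicative set generated by $z_1,\dots,z_s$ is isomorphic, as a Poisson algebra and by an isomorphism that maps $z_i$ to $z_i\otimes 1$, to $K[z_1^{\pm1},\dots,z_s^{\pm1}]\otimes{\Bbb A}_m$, where the first factor has zero bracket and ${\Bbb A}_m=K[p_1,\dots,p_m;q_1,\dots,q_m]$ with $\{p_i,q_j\}=\delta_{ij}$, $\{p_i,p_j\}=\{q_i,q_j\}=0$. Then: (1) adapted systems $z_1,\dots,z_s$ exist, and for every adapted system the field of invariants $K({\cal L}^*)^L$ coincides with $K(z_1,\dots,z_s)$; (2) the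 maximal dimension of the coadjoint orbits in ${\cal L}^*$ equals the number of symbols "$+$" and "$-$" in ${\cal D}_{\cal L}$; (3) the index of ${\cal L}$ equals the number of symbols $\otimes$ in ${\cal D}_{\cal L}$. -/

import Mathlib

open scoped TensorProduct

noncomputable section

namespace UTFactor

attribute [local instance 100] LieRing.ofAssociativeRing

/-! ### Roots, the order on them, and the diagram -/

/-- The set `A` of pairs `(i, j)` with `n ≥ i > j ≥ 1` (indexed from `0`): the places strictly
below the diagonal of an `n × n` table. -/
@[ext]
structure Root (n : ℕ) where
  row : Fin n
  col : Fin n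
  lt : col < row

namespace Root

variable {n : ℕ}

def equivSubtype : Root n ≃ {p : Fin n × Fin n // p.2 < p.1} where
  toFun ξ := ⟨(ξ.row, ξ.col), ξ.lt⟩
  invFun p := ⟨p.1.1, p.1.2, p.2⟩
  left_inv _ := rfl
  right_inv _ := rfl

instance : Fintype (Root n) := Fintype.ofEquiv _ equivSubtype.symm

/-- The key of the order `≻`: columns from left to right, and inside a column rows from bottom to
top, in decreasing order. -/
def key (ξ : Root n) : Lex ((Fin n)ᵒᵈ × Fin n) := toLex (OrderDual.toDual ξ.col, ξ.row)

theorem key_injective : Function.Injective (key (n := n)) := by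
  intro ξ η h
  have h' : (OrderDual.toDual ξ.col, ξ.row) = (OrderDual.toDual η.col, η.row) := h
  simp only [Prod.mk.injEq] at h'
  exact Root.ext h'.2 (OrderDual.toDual.injective h'.1)

/-- The linear order on `A` in which
`(n,1) ≻ (n-1,1) ≻ … ≻ (2,1) ≻ (n,2) ≻ … ≻ (3,2) ≻ … ≻ (n,n-1)`; `ξ ≻ η` is written `η < ξ`. -/
instance : LinearOrder (Root n) := LinearOrder.lift' key key_injective

theorem lt_iff (η ξ : Root n) :
    η < ξ ↔ ξ.col < η.col ∨ (ξ.col = η.col ∧ η.row < ξ.row) := by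
  change key η < key ξ ↔ _
  rw [key, key, Prod.Lex.toLex_lt_toLex]
  simp [eq_comm]

end Root

/-- The symbols of the diagram: `•`, `⊗`, `+`, `−`. -/
inductive Mark
  | bullet
  | cross
  | plus
  | minus
  deriving DecidableEq

/-- A partially filled diagram; `none` marks an empty place. -/
abbrev Diagram (n : ℕ) := Root n → Option Mark

namespace Diagram

variable {n : ℕ}

/-- The zero step: the places of `M` are filled by `•`. -/
def zeroStep (M : Finset (Root n)) : Diagram n :=
  fun ξ => if ξ ∈ M then some Mark.bullet else none

/-- The set of empty places. -/
def empties (D : Diagram n) : Finset (Root n) := Finset.univ.filter fun ξ => D ξ = none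

/-- The greatest empty place with respect to `≻`, if there is an empty place. -/
def next (D : Diagram n) : Option (Root n) :=
  if h : D.empties.Nonempty then some (D.empties.max' h) else none

/-- One step with `⊗` put on the place `ξ = (k, t)`: whenever `k > a > t` and both places `(k, a)`
and `(a, t)` are empty, `−` is put on `(k, a)` and `+` is put on `(a, t)`. -/
def fill (D : Diagram n) (ξ : Root n) : Diagram n := fun η =>
  if η = ξ then some Mark.cross
  else if D η = none ∧ η.row = ξ.row ∧ ∃ ζ : Root n, ζ.row = η.col ∧ ζ.col = ξ.col ∧ D ζ = none then
    some Mark.minus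
  else if D η = none ∧ η.col = ξ.col ∧ ∃ ζ : Root n, ζ.row = ξ.row ∧ ζ.col = η.row ∧ D ζ = none then
    some Mark.plus
  else D η

/-- The diagram after the `i`-th step (unchanged once all places are filled). -/
def after (M : Finset (Root n)) : ℕ → Diagram n
  | 0 => zeroStep M
  | i + 1 =>
    match (after M i).next with
    | none => after M i
    | some ξ => (after M i).fill ξ

/-- The place that gets the symbol `⊗` during the step number `i + 1`. -/
def crossPlace (M : Finset (Root n)) (i : ℕ) : Option (Root n) := (after M i).next

/-- The complete diagram; each step fills at least one place, so that `|A|` steps suffice. -/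
def final (M : Finset (Root n)) : Diagram n := after M (Fintype.card (Root n))

/-- The number of occurrences of a symbol. -/
def count (D : Diagram n) (m : Mark) : ℕ := (Finset.univ.filter fun ξ => D ξ = some m).card

end Diagram

/-! ### The Lie algebra of strictly lower triangular matrices and its root ideals -/

/-- The Lie algebra `𝔫 = 𝔲𝔱(n, K)` of lower triangular matrices with zeros on the diagonal. -/
def ut (K : Type*) [Field K] (n : ℕ) : LieSubalgebra K (Matrix (Fin n) (Fin n) K) where
  carrier := {x | ∀ i j, i ≤ j → x i j = 0}
  add_mem' {x y} hx hy i j h := by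
    rw [Matrix.add_apply, hx i j h, hy i j h, add_zero]
  zero_mem' _ _ _ := rfl
  smul_mem' c x hx i j h := by
    rw [Matrix.smul_apply, hx i j h, smul_zero]
  lie_mem' {x y} hx hy i j h := by
    have key : ∀ a b : Matrix (Fin n) (Fin n) K, (∀ i j, i ≤ j → a i j = 0) →
        (∀ i j, i ≤ j → b i j = 0) → (a * b) i j = 0 := by
      intro a b ha hb
      rw [Matrix.mul_apply]
      refine Finset.sum_eq_zero fun k _ => ?_
      rcases le_total i k with hk | hk
      · rw [ha i k hk, zero_mul]
      · rw [hb k j (hk.trans h), mul_zero]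
    rw [Ring.lie_def, Matrix.sub_apply, key x y hx hy, key y x hy hx, sub_zero]

variable {K : Type*} [Field K] {n : ℕ}

theorem mem_ut {x : Matrix (Fin n) (Fin n) K} : x ∈ ut K n ↔ ∀ i j, i ≤ j → x i j = 0 := Iff.rfl

theorem mul_mem_ut {a b : Matrix (Fin n) (Fin n) K} (ha : ∀ i j, i < j → a i j = 0)
    (hb : b ∈ ut K n) : a * b ∈ ut K n := by
  intro i j h
  rw [Matrix.mul_apply]
  refine Finset.sum_eq_zero fun k _ => ?_
  rcases lt_or_ge i k with hk | hk
  · rw [ha i k hk, zero_mul]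
  · rw [hb k j (hk.trans h), mul_zero]

theorem lower_of_mem_ut {a : Matrix (Fin n) (Fin n) K} (ha : a ∈ ut K n) :
    ∀ i j, i < j → a i j = 0 := fun i j h => ha i j h.le

/-- The root vector `y_ξ`: the matrix unit with `1` in the place `ξ`. -/
def rootVec (K : Type*) [Field K] {n : ℕ} (ξ : Root n) : ut K n :=
  ⟨Matrix.single ξ.row ξ.col 1, by
    intro i j h
    rw [Matrix.single_apply]
    refine if_neg ?_
    rintro ⟨rfl, rfl⟩
    exact absurd ξ.lt (not_lt.mpr h)⟩

theorem mem_span_rootVec {x : Matrix (Fin n) (Fin n) K} (hx : x ∈ ut K n) :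
    x ∈ Submodule.span K (Set.range fun ξ : Root n => (rootVec K ξ : Matrix (Fin n) (Fin n) K)) := by
  rw [Matrix.matrix_eq_sum_single x]
  refine Submodule.sum_mem _ fun i _ => Submodule.sum_mem _ fun j _ => ?_
  rcases le_or_gt i j with h | h
  · rw [hx i j h, Matrix.single_zero]; exact Submodule.zero_mem _
  · have : Matrix.single i j (x i j) =
        x i j • (rootVec K (⟨i, j, h⟩ : Root n) : Matrix (Fin n) (Fin n) K) := by
      simp [rootVec, Matrix.smul_single]
    rw [this]
    exact Submodule.smul_mem _ _ (Submodule.subset_span ⟨_, rfl⟩)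

/-- An ideal `𝔪` of `𝔫` that is spanned, as a linear subspace, by the root vectors `y_ξ`, `ξ ∈ M`,
of a subset `M ⊆ A`. -/
structure RootIdeal (K : Type*) [Field K] (n : ℕ) where
  ideal : LieIdeal K (ut K n)
  M : Finset (Root n)
  span_eq : ideal.toSubmodule = Submodule.span K (rootVec K '' (M : Set (Root n)))

namespace RootIdeal

variable (𝔪 : RootIdeal K n)

/-- The underlying space of matrices of the ideal. -/
def mat : Submodule K (Matrix (Fin n) (Fin n) K) :=
  𝔪.ideal.toSubmodule.map (ut K n).toSubmodule.subtype

variable {𝔪}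

theorem mem_mat {x : ut K n} : (x : Matrix (Fin n) (Fin n) K) ∈ 𝔪.mat ↔ x ∈ 𝔪.ideal := by
  constructor
  · rintro ⟨y, hy, hxy⟩
    have : y = x := Subtype.ext hxy
    exact this ▸ hy
  · intro h
    exact ⟨x, h, rfl⟩

theorem mat_le {x : Matrix (Fin n) (Fin n) K} (hx : x ∈ 𝔪.mat) : x ∈ ut K n := by
  obtain ⟨y, _, rfl⟩ := hx
  exact y.2

theorem mat_eq : 𝔪.mat = Submodule.span K
    ((fun ξ => (rootVec K ξ : Matrix (Fin n) (Fin n) K)) '' (𝔪.M : Set (Root n))) := by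
  rw [mat, 𝔪.span_eq, Submodule.map_span, ← Set.image_comp]
  rfl

theorem root_mul {ξ η : Root n} (hη : η ∈ 𝔪.M) :
    (rootVec K ξ : Matrix (Fin n) (Fin n) K) * rootVec K η ∈ 𝔪.mat ∧
    (rootVec K η : Matrix (Fin n) (Fin n) K) * rootVec K ξ ∈ 𝔪.mat := by
  have hη' : rootVec K η ∈ 𝔪.ideal := by
    have : rootVec K η ∈ 𝔪.ideal.toSubmodule := by
      rw [𝔪.span_eq]
      exact Submodule.subset_span ⟨η, hη, rfl⟩
    exact this
  have hl : ((⁅rootVec K ξ, rootVec K η⁆ : ut K n) : Matrix (Fin n) (Fin n) K) ∈ 𝔪.mat :=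
    mem_mat.mpr (lie_mem_right K (ut K n) 𝔪.ideal _ _ hη')
  rw [LieSubalgebra.coe_bracket, Ring.lie_def] at hl
  by_cases h1 : ξ.col = η.row
  · have h2 : η.col ≠ ξ.row := by
      have := ξ.lt; have := η.lt; intro h
      simp only [h1, ← h] at *; omega
    have h0 : (rootVec K η : Matrix (Fin n) (Fin n) K) * rootVec K ξ = 0 :=
      Matrix.single_mul_single_of_ne _ _ _ _ h2 _
    rw [h0, sub_zero] at hl
    exact ⟨hl, h0 ▸ Submodule.zero_mem _⟩
  · have h0 : (rootVec K ξ : Matrix (Fin n) (Fin n) K) * rootVec K η = 0 :=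
      Matrix.single_mul_single_of_ne _ _ _ _ h1 _
    rw [h0, zero_sub] at hl
    exact ⟨h0 ▸ Submodule.zero_mem _, (Submodule.neg_mem_iff _).mp hl⟩

theorem mul_mem_mat {x m : Matrix (Fin n) (Fin n) K} (hx : x ∈ ut K n) (hm : m ∈ 𝔪.mat) :
    x * m ∈ 𝔪.mat ∧ m * x ∈ 𝔪.mat := by
  rw [mat_eq] at hm
  replace hx := mem_span_rootVec hx
  induction hm using Submodule.span_induction with
  | zero => simp
  | add a b _ _ ha hb =>
    rw [mul_add, add_mul]
    exact ⟨add_mem ha.1 hb.1, add_mem ha.2 hb.2⟩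
  | smul c a _ ha =>
    rw [mul_smul_comm, smul_mul_assoc]
    exact ⟨Submodule.smul_mem _ _ ha.1, Submodule.smul_mem _ _ ha.2⟩
  | mem a ha =>
    obtain ⟨η, hη, rfl⟩ := ha
    induction hx using Submodule.span_induction with
    | zero => simp
    | add a b _ _ ha hb =>
      rw [mul_add, add_mul]
      exact ⟨add_mem ha.1 hb.1, add_mem ha.2 hb.2⟩
    | smul c a _ ha =>
      rw [mul_smul_comm, smul_mul_assoc]
      exact ⟨Submodule.smul_mem _ _ ha.1, Submodule.smul_mem _ _ ha.2⟩
    | mem a ha =>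
      obtain ⟨ξ, rfl⟩ := ha
      exact root_mul hη

variable (𝔪)

/-- The Lie algebra `ℒ = 𝔫 / 𝔪`. -/
abbrev factor : Type _ := ut K n ⧸ 𝔪.ideal

/-- The image of the root vector `y_ξ` in `ℒ`. -/
def y (ξ : Root n) : 𝔪.factor := LieSubmodule.Quotient.mk (rootVec K ξ)

end RootIdeal

/-! ### The unitriangular group, the factor group `L` and the coadjoint representation -/

/-- The group `N = UT(n, K)` of lower triangular matrices with units on the diagonal. -/
def UT (K : Type*) [Field K] (n : ℕ) : Subgroup (GL (Fin n) K) where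
  carrier := {g | (g : Matrix (Fin n) (Fin n) K) - 1 ∈ ut K n}
  one_mem' := by simp
  mul_mem' {g h} hg hh := by
    have e : ((g * h : GL (Fin n) K) : Matrix (Fin n) (Fin n) K) - 1 =
        ((g : Matrix (Fin n) (Fin n) K) - 1) * ((h : Matrix (Fin n) (Fin n) K) - 1)
          + ((g : Matrix (Fin n) (Fin n) K) - 1) + ((h : Matrix (Fin n) (Fin n) K) - 1) := by
      rw [Units.val_mul]; noncomm_ring
    change _ ∈ ut K n
    rw [e]
    exact add_mem (add_mem (mul_mem_ut (lower_of_mem_ut hg) hh) hg) hh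
  inv_mem' {g} hg := by
    have hlow : (g : Matrix (Fin n) (Fin n) K).BlockTriangular OrderDual.toDual := by
      intro i j (hij : i < j)
      have := hg i j hij.le
      rwa [Matrix.sub_apply, Matrix.one_apply_ne hij.ne, sub_zero] at this
    let _ : Invertible (g : Matrix (Fin n) (Fin n) K) := g.invertible
    have hinv := Matrix.blockTriangular_inv_of_blockTriangular hlow
    rw [← Matrix.coe_units_inv] at hinv
    have e : ((g⁻¹ : GL (Fin n) K) : Matrix (Fin n) (Fin n) K) - 1 =
        -(((g⁻¹ : GL (Fin n) K) : Matrix (Fin n) (Fin n) K) *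
          ((g : Matrix (Fin n) (Fin n) K) - 1)) := by
      rw [mul_sub, Units.inv_mul, mul_one, neg_sub]
    change _ ∈ ut K n
    rw [e]
    exact neg_mem (mul_mem_ut (fun i j h => hinv (i := i) (j := j) h) hg)

/-- The matrix of an element of `N`. -/
abbrev UT.mat (g : UT K n) : Matrix (Fin n) (Fin n) K := ((g : GL (Fin n) K) : Matrix _ _ K)

theorem UT.mat_mul (g h : UT K n) : UT.mat (g * h) = UT.mat g * UT.mat h := rfl

theorem UT.mat_one : UT.mat (1 : UT K n) = 1 := rfl

theorem UT.mat_inv_mul (g : UT K n) : UT.mat g⁻¹ * UT.mat g = 1 :=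
  Units.inv_mul (g : GL (Fin n) K)

theorem UT.mat_mul_inv (g : UT K n) : UT.mat g * UT.mat g⁻¹ = 1 :=
  Units.mul_inv (g : GL (Fin n) K)

theorem UT.sub_one_mem (g : UT K n) : UT.mat g - 1 ∈ ut K n := g.2

theorem UT.conj_eq (g : UT K n) (x : Matrix (Fin n) (Fin n) K) :
    UT.mat g * x * UT.mat g⁻¹ = x + (UT.mat g - 1) * x + x * (UT.mat g⁻¹ - 1)
      + (UT.mat g - 1) * x * (UT.mat g⁻¹ - 1) := by
  noncomm_ring

/-- The adjoint action of `N` on `𝔫`: `Ad_g x = g x g⁻¹`. -/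
def adN (g : UT K n) : ut K n →ₗ[K] ut K n where
  toFun x := ⟨UT.mat g * x * UT.mat g⁻¹, by
    have hg := lower_of_mem_ut (UT.sub_one_mem g)
    rw [UT.conj_eq]
    exact add_mem (add_mem (add_mem x.2 (mul_mem_ut hg x.2))
      (mul_mem_ut (lower_of_mem_ut x.2) (UT.sub_one_mem g⁻¹)))
      (mul_mem_ut (lower_of_mem_ut (mul_mem_ut hg x.2)) (UT.sub_one_mem g⁻¹))⟩
  map_add' x y := by
    apply Subtype.ext
    simp [mul_add, add_mul]
  map_smul' c x := by
    apply Subtype.ext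
    simp

theorem coe_adN (g : UT K n) (x : ut K n) :
    (adN g x : Matrix (Fin n) (Fin n) K) = UT.mat g * x * UT.mat g⁻¹ := rfl

namespace RootIdeal

variable (𝔪 : RootIdeal K n)

theorem adN_mem (g : UT K n) (x : ut K n) (hx : x ∈ 𝔪.ideal) : adN g x ∈ 𝔪.ideal := by
  rw [← mem_mat] at hx ⊢
  rw [coe_adN, UT.conj_eq]
  have h1 := (mul_mem_mat (UT.sub_one_mem g) hx).1
  exact add_mem (add_mem (add_mem hx h1) (mul_mem_mat (UT.sub_one_mem g⁻¹) hx).2)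
    (mul_mem_mat (UT.sub_one_mem g⁻¹) h1).2

/-- The action of `N` on `ℒ = 𝔫 / 𝔪` induced by the adjoint action. -/
def adFactor : Representation K (UT K n) 𝔪.factor where
  toFun g := Submodule.mapQ 𝔪.ideal.toSubmodule 𝔪.ideal.toSubmodule (adN g)
    (fun x hx => 𝔪.adN_mem g x hx)
  map_one' := by
    apply LinearMap.ext
    rintro ⟨x⟩
    change Submodule.Quotient.mk (adN 1 x) = Submodule.Quotient.mk x
    congr 1
    apply Subtype.ext
    rw [coe_adN, inv_one, UT.mat_one, one_mul, mul_one]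
  map_mul' g h := by
    apply LinearMap.ext
    rintro ⟨x⟩
    change Submodule.Quotient.mk (adN (g * h) x) = Submodule.Quotient.mk (adN g (adN h x))
    congr 1
    apply Subtype.ext
    simp only [coe_adN, mul_inv_rev, UT.mat_mul, mul_assoc]

theorem pow_mem_mat {x : Matrix (Fin n) (Fin n) K} (hx : x ∈ 𝔪.mat) :
    ∀ i : ℕ, x ^ (i + 1) ∈ 𝔪.mat
  | 0 => by simpa using hx
  | i + 1 => by
    rw [pow_succ]
    exact (mul_mem_mat (mat_le (pow_mem_mat hx i)) hx).1

theorem isNilpotent_of_mem_ut {x : Matrix (Fin n) (Fin n) K} (hx : x ∈ ut K n) :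
    IsNilpotent x := by
  refine ⟨n, ?_⟩
  have h : ∀ (k : ℕ) (i j : Fin n), (i : ℕ) < j + k → (x ^ k) i j = 0 := by
    intro k
    induction k with
    | zero =>
      intro i j hij
      rw [pow_zero, Matrix.one_apply_ne]
      rintro rfl
      omega
    | succ k ih =>
      intro i j hij
      rw [pow_succ, Matrix.mul_apply]
      refine Finset.sum_eq_zero fun l _ => ?_
      rcases le_or_gt l j with hl | hl
      · rw [hx l j hl, mul_zero]
      · rw [ih i l (by omega), zero_mul]
  ext i j
  exact h n i j (by omega)

variable [CharZero K]

/-- The normal subgroup `exp(𝔪)` of `N`. -/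
def expSubgroup : Subgroup (UT K n) :=
  Subgroup.normalClosure {g | ∃ x ∈ 𝔪.ideal, UT.mat g = IsNilpotent.exp (x : Matrix _ _ K)}

instance : 𝔪.expSubgroup.Normal := Subgroup.normalClosure_normal

/-- The factor group `L = N / exp(𝔪)`. -/
abbrev group : Type _ := UT K n ⧸ 𝔪.expSubgroup

theorem exp_sub_one_mem {x : Matrix (Fin n) (Fin n) K} (hx : x ∈ 𝔪.mat)
    (hn : IsNilpotent x) : IsNilpotent.exp x - 1 ∈ 𝔪.mat := by
  obtain ⟨k, hk⟩ := hn
  rw [IsNilpotent.exp_eq_sum (k := k + 1) (by rw [pow_succ, hk, zero_mul]),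
    Finset.sum_range_succ', pow_zero, Nat.factorial_zero, Nat.cast_one, inv_one, one_smul,
    add_sub_cancel_right]
  refine Submodule.sum_mem _ fun i _ => ?_
  have : (((i + 1).factorial : ℚ)⁻¹ • x ^ (i + 1)) =
      (((((i + 1).factorial : ℚ)⁻¹ : ℚ) : K)) • x ^ (i + 1) := by
    ext a b
    simp [Matrix.smul_apply, Rat.smul_def]
  rw [this]
  exact Submodule.smul_mem _ _ (𝔪.pow_mem_mat hx i)

theorem expSubgroup_le : 𝔪.expSubgroup ≤ MonoidHom.ker 𝔪.adFactor := by
  refine Subgroup.normalClosure_le_normal ?_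
  rintro g ⟨m, hm, hg⟩
  have hu : UT.mat g - 1 ∈ 𝔪.mat := by
    rw [hg]
    exact 𝔪.exp_sub_one_mem (mem_mat.mpr hm) (isNilpotent_of_mem_ut m.2)
  have hv : UT.mat g⁻¹ - 1 ∈ 𝔪.mat := by
    have e : UT.mat g⁻¹ - 1 =
        -((UT.mat g⁻¹ - 1) * (UT.mat g - 1) + (UT.mat g - 1)) := by
      have := UT.mat_inv_mul g
      rw [← sub_eq_zero] at this ⊢
      calc _ = UT.mat g⁻¹ * UT.mat g - 1 := by noncomm_ring
        _ = 0 := this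
    rw [e]
    exact neg_mem (add_mem (mul_mem_mat (UT.sub_one_mem g⁻¹) hu).1 hu)
  change 𝔪.adFactor g = 1
  apply LinearMap.ext
  rintro ⟨x⟩
  refine (Submodule.Quotient.eq _).mpr ?_
  change adN g x - x ∈ 𝔪.ideal
  rw [← mem_mat]
  have h1 := (mul_mem_mat x.2 hu).2
  have e : ((adN g x - x : ut K n) : Matrix (Fin n) (Fin n) K) =
      (UT.mat g - 1) * x + x * (UT.mat g⁻¹ - 1) + (UT.mat g - 1) * x * (UT.mat g⁻¹ - 1) := by
    change UT.mat g * x * UT.mat g⁻¹ - x = _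
    rw [UT.conj_eq]
    noncomm_ring
  rw [e]
  exact add_mem (add_mem h1 (mul_mem_mat x.2 hv).1) (mul_mem_mat (mat_le h1) hv).1

/-- The adjoint representation of `L` on `ℒ`. -/
def ad : Representation K 𝔪.group 𝔪.factor :=
  QuotientGroup.lift 𝔪.expSubgroup 𝔪.adFactor 𝔪.expSubgroup_le

/-- The coadjoint representation of `L` on `ℒ*`: `(Ad*_g f)(x) = f(Ad_g⁻¹ x)`. -/
def coad : Representation K 𝔪.group (Module.Dual K 𝔪.factor) := 𝔪.ad.dual

end RootIdeal

/-! ### Regular and rational functions on `ℒ*`, invariants -/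

namespace RootIdeal

variable (𝔪 : RootIdeal K n)

/-- The algebra `K[ℒ*]` of regular functions on `ℒ*`, identified with the symmetric algebra
`S(ℒ)`. -/
abbrev Reg : Type _ := SymmetricAlgebra K 𝔪.factor

/-- The element `y_ξ` of `K[ℒ*]`. -/
def coord (ξ : Root n) : 𝔪.Reg := SymmetricAlgebra.ι K 𝔪.factor (𝔪.y ξ)

/-- The value of regular functions at the point `f ∈ ℒ*`. -/
def eval (f : Module.Dual K 𝔪.factor) : 𝔪.Reg →ₐ[K] K := SymmetricAlgebra.lift f

/-- The field `K(ℒ*)` of rational functions on `ℒ*`. -/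
abbrev RatFun : Type _ := FractionRing 𝔪.Reg

variable [CharZero K]

/-- The action of `L` on `K[ℒ*]`, `(g F)(f) = F(Ad*_g⁻¹ f)`; on linear functions, that is on `ℒ`,
it is the adjoint action. -/
def actReg (g : 𝔪.group) : 𝔪.Reg ≃ₐ[K] 𝔪.Reg :=
  AlgEquiv.ofAlgHom
    (SymmetricAlgebra.lift (SymmetricAlgebra.ι K 𝔪.factor ∘ₗ 𝔪.ad g))
    (SymmetricAlgebra.lift (SymmetricAlgebra.ι K 𝔪.factor ∘ₗ 𝔪.ad g⁻¹))
    (by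
      apply SymmetricAlgebra.algHom_ext
      apply LinearMap.ext
      intro x
      simp [← Module.End.mul_apply, ← map_mul])
    (by
      apply SymmetricAlgebra.algHom_ext
      apply LinearMap.ext
      intro x
      simp [← Module.End.mul_apply, ← map_mul])

theorem eval_actReg (g : 𝔪.group) (F : 𝔪.Reg) (f : Module.Dual K 𝔪.factor) :
    𝔪.eval f (𝔪.actReg g F) = 𝔪.eval (𝔪.coad g⁻¹ f) F := by
  have h : (𝔪.eval f).comp (𝔪.actReg g : 𝔪.Reg →ₐ[K] 𝔪.Reg) = 𝔪.eval (𝔪.coad g⁻¹ f) := by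
    apply SymmetricAlgebra.algHom_ext
    apply LinearMap.ext
    intro x
    simp [eval, actReg, coad, Representation.dual_apply, Module.Dual.transpose_apply]
  exact DFunLike.congr_fun h F

/-- The algebra of invariants `K[ℒ*]^L`. -/
def invReg : Subalgebra K 𝔪.Reg where
  carrier := {F | ∀ g, 𝔪.actReg g F = F}
  mul_mem' ha hb g := by rw [map_mul, ha g, hb g]
  add_mem' ha hb g := by rw [map_add, ha g, hb g]
  algebraMap_mem' c g := AlgEquiv.commutes _ c

/-- The action of `L` on `K(ℒ*)`. -/
def actRat (g : 𝔪.group) : 𝔪.RatFun ≃ₐ[K] 𝔪.RatFun :=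
  IsFractionRing.algEquivOfAlgEquiv (𝔪.actReg g)

/-- The field of invariants `K(ℒ*)^L`. -/
def invRat : IntermediateField K 𝔪.RatFun where
  carrier := {F | ∀ g, 𝔪.actRat g F = F}
  mul_mem' ha hb g := by rw [map_mul, ha g, hb g]
  add_mem' ha hb g := by rw [map_add, ha g, hb g]
  algebraMap_mem' c g := AlgEquiv.commutes _ c
  inv_mem' a ha g := by rw [map_inv₀, ha g]

/-! ### Coadjoint orbits and their dimension -/

/-- The coadjoint orbit of `f ∈ ℒ*`. -/
def orbit (f : Module.Dual K 𝔪.factor) : Set (Module.Dual K 𝔪.factor) :=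
  Set.range fun g => 𝔪.coad g f

end RootIdeal

namespace RootIdeal

variable (𝔪 : RootIdeal K n)

/-- The ideal of the regular functions that vanish on a set of points of `ℒ*`. -/
def vanishing (Ω : Set (Module.Dual K 𝔪.factor)) : Ideal 𝔪.Reg where
  carrier := {F | ∀ f ∈ Ω, 𝔪.eval f F = 0}
  add_mem' ha hb f hf := by rw [map_add, ha f hf, hb f hf, add_zero]
  zero_mem' f _ := map_zero _
  smul_mem' c F hF f hf := by rw [smul_eq_mul, map_mul, hF f hf, mul_zero]

/-- The dimension of a (Zariski closed, irreducible) subset `Ω ⊆ ℒ*` such as a coadjoint orbit: the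
transcendence degree over `K` of its algebra of regular functions `K[Ω] = K[ℒ*] / I(Ω)`. -/
def dim (Ω : Set (Module.Dual K 𝔪.factor)) : Cardinal := Algebra.trdeg K (𝔪.Reg ⧸ 𝔪.vanishing Ω)

end RootIdeal

/-! ### The index of a Lie algebra -/

section Index

variable {𝔤 : Type*} [LieRing 𝔤] [LieAlgebra K 𝔤]

/-- The stabilizer `{x | f([x, y]) = 0 for all y}` of a linear form `f`. -/
def stabilizer (f : Module.Dual K 𝔤) : Submodule K 𝔤 where
  carrier := {x | ∀ y, f ⁅x, y⁆ = 0}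
  add_mem' ha hb y := by rw [add_lie, map_add, ha y, hb y, add_zero]
  zero_mem' y := by rw [zero_lie, map_zero]
  smul_mem' c x hx y := by rw [smul_lie, map_smul, hx y, smul_zero]

variable (K 𝔤) in
/-- The index of a finite dimensional Lie algebra: the minimal dimension of a stabilizer of a
linear form. -/
def lieIndex : ℕ := sInf (Set.range fun f : Module.Dual K 𝔤 => Module.finrank K (stabilizer f))

end Index

/-! ### Poisson algebras -/

section Derivation

variable {V : Type*} [AddCommGroup V] [Module K V]
variable {B : Type*} [CommRing B] [Algebra K B] [Algebra (SymmetricAlgebra K V) B]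
  [IsScalarTower K (SymmetricAlgebra K V) B]
variable {P : Type*} [AddCommGroup P] [Module K P] [Module B P]

theorem derivation_ext (Z : Submonoid (SymmetricAlgebra K V)) [IsLocalization Z B]
    {D D' : Derivation K B P}
    (h : ∀ v, D (algebraMap _ B (SymmetricAlgebra.ι K V v)) =
      D' (algebraMap _ B (SymmetricAlgebra.ι K V v))) : D = D' := by
  have hS : ∀ F : SymmetricAlgebra K V,
      D (algebraMap _ B F) = D' (algebraMap _ B F) := by
    intro F
    induction F using SymmetricAlgebra.induction with
    | algebraMap c =>
      rw [← IsScalarTower.algebraMap_apply, Derivation.map_algebraMap, Derivation.map_algebraMap]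
    | ι v => exact h v
    | mul a b ha hb => rw [map_mul, Derivation.leibniz, Derivation.leibniz, ha, hb]
    | add a b ha hb => rw [map_add, map_add, map_add, ha, hb]
  ext b
  obtain ⟨F, t, hb⟩ := IsLocalization.exists_mk'_eq Z b
  have hu : IsUnit (algebraMap (SymmetricAlgebra K V) B t) :=
    IsLocalization.map_units _ t
  have hFb : b * algebraMap _ B (t : SymmetricAlgebra K V) =
      algebraMap _ B F := by
    rw [← hb, IsLocalization.mk'_spec]
  have h1 := congrArg D hFb
  have h2 := congrArg D' hFb
  rw [Derivation.leibniz] at h1 h2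
  rw [hS F] at h1
  rw [hS t] at h1
  rw [← h2] at h1
  have h3 := add_left_cancel h1
  obtain ⟨u, hu⟩ := hu
  rw [← hu] at h3
  have h4 := congrArg (fun p => (↑u⁻¹ : B) • p) h3
  simpa only [smul_smul, Units.inv_mul, one_smul] using h4

theorem exists_derivation_of_algHom {S : Type*} [CommRing S] [Algebra K S] [Algebra S B]
    [IsScalarTower K S B] (Z : Submonoid S) [IsLocalization Z B]
    [IsScalarTower K B P] [Module Bᵐᵒᵖ P] [IsCentralScalar B P] [IsScalarTower K Bᵐᵒᵖ P]
    (g : S →ₐ[K] TrivSqZeroExt B P) (hg : ∀ F, (g F).fst = algebraMap S B F) :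
    ∃ D : Derivation K B P, ∀ F, D (algebraMap S B F) = (g F).snd := by
  have hunit : ∀ t : Z, IsUnit (g t) := by
    intro t
    rw [TrivSqZeroExt.isUnit_iff_isUnit_fst, hg]
    exact IsLocalization.map_units _ t
  obtain ⟨h, hh⟩ : ∃ h : B →ₐ[K] TrivSqZeroExt B P, ∀ F, h (algebraMap S B F) = g F :=
    ⟨IsLocalization.liftAlgHom (M := Z) (f := g) hunit, fun F => by
      rw [IsLocalization.liftAlgHom_apply]
      exact IsLocalization.lift_eq _ F⟩
  have hid : ∀ b, (h b).fst = b := by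
    have : (TrivSqZeroExt.fstHom K B P).comp h = AlgHom.id K _ := by
      apply IsLocalization.algHom_ext Z
      ext F
      change (h (algebraMap S B F)).fst = algebraMap S B F
      rw [hh, hg]
    exact fun b => DFunLike.congr_fun this b
  refine ⟨Derivation.mk' ((TrivSqZeroExt.sndHom B P).restrictScalars K ∘ₗ
    h.toLinearMap) ?_, ?_⟩
  · intro a b
    change (h (a * b)).snd = a • (h b).snd + b • (h a).snd
    rw [map_mul, TrivSqZeroExt.snd_mul, hid, hid, op_smul_eq_smul]
  · intro F
    change (h (algebraMap S B F)).snd = _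
    rw [hh]

theorem exists_derivation_aux (Z : Submonoid (SymmetricAlgebra K V)) [IsLocalization Z B]
    [IsScalarTower K B P] [Module Bᵐᵒᵖ P] [IsCentralScalar B P] [IsScalarTower K Bᵐᵒᵖ P]
    (d : V →ₗ[K] P) :
    ∃ D : Derivation K B P, ∀ v, D (algebraMap _ B (SymmetricAlgebra.ι K V v)) = d v := by
  obtain ⟨g, hg⟩ : ∃ g : SymmetricAlgebra K V →ₐ[K] TrivSqZeroExt B P,
      ∀ v, g (SymmetricAlgebra.ι K V v) =
        TrivSqZeroExt.inl (algebraMap _ B (SymmetricAlgebra.ι K V v)) +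
          TrivSqZeroExt.inr (d v) :=
    ⟨SymmetricAlgebra.lift
      ((TrivSqZeroExt.inlAlgHom K B P).toLinearMap ∘ₗ
        (IsScalarTower.toAlgHom K (SymmetricAlgebra K V) B).toLinearMap ∘ₗ
          SymmetricAlgebra.ι K V
      + (TrivSqZeroExt.inrHom B P).restrictScalars K ∘ₗ d), fun v => by
        rw [SymmetricAlgebra.lift_ι_apply]; rfl⟩
  have hfst : (TrivSqZeroExt.fstHom K B P).comp g =
      IsScalarTower.toAlgHom K (SymmetricAlgebra K V) B := by
    apply SymmetricAlgebra.algHom_ext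
    apply LinearMap.ext
    intro v
    change TrivSqZeroExt.fst (g (SymmetricAlgebra.ι K V v)) = algebraMap _ B _
    rw [hg, TrivSqZeroExt.fst_add, TrivSqZeroExt.fst_inl, TrivSqZeroExt.fst_inr, add_zero]
  obtain ⟨D, hD⟩ := exists_derivation_of_algHom Z g fun F => DFunLike.congr_fun hfst F
  exact ⟨D, fun v => by
    rw [hD, hg, TrivSqZeroExt.snd_add, TrivSqZeroExt.snd_inl, TrivSqZeroExt.snd_inr, zero_add]⟩

theorem exists_derivation (Z : Submonoid (SymmetricAlgebra K V)) [IsLocalization Z B]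
    [IsScalarTower K B P] (d : V →ₗ[K] P) :
    ∃ D : Derivation K B P, ∀ v, D (algebraMap _ B (SymmetricAlgebra.ι K V v)) = d v :=
  let _ : Module Bᵐᵒᵖ P :=
    Module.compHom P ((RingHom.id B).fromOpposite fun _ _ => mul_comm _ _)
  have _ : IsCentralScalar B P := ⟨fun _ _ => rfl⟩
  have _ : IsScalarTower K Bᵐᵒᵖ P := ⟨fun c b p => smul_assoc c b.unop p⟩
  exists_derivation_aux Z d

/-- The derivation `B → P` of a localization `B` of `S(V)` that extends a linear map `V → P`. -/
def extendDer (Z : Submonoid (SymmetricAlgebra K V)) [IsLocalization Z B]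
    [IsScalarTower K B P] (d : V →ₗ[K] P) : Derivation K B P :=
  (exists_derivation Z d).choose

theorem extendDer_ι (Z : Submonoid (SymmetricAlgebra K V)) [IsLocalization Z B]
    [IsScalarTower K B P] (d : V →ₗ[K] P) (v : V) :
    extendDer Z d (algebraMap _ B (SymmetricAlgebra.ι K V v)) = d v :=
  (exists_derivation Z d).choose_spec v

end Derivation

section LiePoisson

variable {𝔤 : Type*} [LieRing 𝔤] [LieAlgebra K 𝔤]
variable (B : Type*) [CommRing B] [Algebra K B] [Algebra (SymmetricAlgebra K 𝔤) B]
  [IsScalarTower K (SymmetricAlgebra K 𝔤) B]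

/-- The derivations `{x, ·}` of the localization of `S(𝔤)`, for `x ∈ 𝔤`. -/
def hamiltonian (Z : Submonoid (SymmetricAlgebra K 𝔤)) [IsLocalization Z B] : 𝔤 →ₗ[K] Derivation K B B where
  toFun x := extendDer Z ((IsScalarTower.toAlgHom K (SymmetricAlgebra K 𝔤) B).toLinearMap
    ∘ₗ SymmetricAlgebra.ι K 𝔤 ∘ₗ (LieAlgebra.ad K 𝔤 x : 𝔤 →ₗ[K] 𝔤))
  map_add' x y := by
    refine derivation_ext Z fun v => ?_
    simp [extendDer_ι]
  map_smul' c x := by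
    refine derivation_ext Z fun v => ?_
    simp only [extendDer_ι, RingHom.id_apply, Derivation.smul_apply, map_smul, LinearMap.comp_apply,
      LinearMap.smul_apply]

/-- The Poisson bracket of a localization `B` of `S(𝔤) = K[𝔤*]`: the unique `K`-bilinear operation
that is a derivation in each argument and satisfies `{x, y} = [x, y]` for `x, y ∈ 𝔤`. -/
def liePoisson (Z : Submonoid (SymmetricAlgebra K 𝔤)) [IsLocalization Z B] : B →ₗ[K] B →ₗ[K] B where
  toFun b := (extendDer Z (hamiltonian B Z) b : Derivation K B B)
  map_add' a b := by rw [map_add]; rfl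
  map_smul' c b := by rw [Derivation.map_smul]; rfl

theorem liePoisson_ι (Z : Submonoid (SymmetricAlgebra K 𝔤)) [IsLocalization Z B] (x y : 𝔤) :
    liePoisson B Z (algebraMap _ _ (SymmetricAlgebra.ι K 𝔤 x))
      (algebraMap _ _ (SymmetricAlgebra.ι K 𝔤 y)) =
      algebraMap _ _ (SymmetricAlgebra.ι K 𝔤 ⁅x, y⁆) := by
  change extendDer Z (hamiltonian B Z) _ _ = _
  rw [extendDer_ι]
  exact extendDer_ι Z _ y

theorem liePoisson_mul_right (Z : Submonoid (SymmetricAlgebra K 𝔤)) [IsLocalization Z B] (a b c : B) :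
    liePoisson B Z a (b * c) = b * liePoisson B Z a c + c * liePoisson B Z a b :=
  Derivation.leibniz (extendDer Z (hamiltonian B Z) a) b c

theorem liePoisson_mul_left (Z : Submonoid (SymmetricAlgebra K 𝔤)) [IsLocalization Z B] (a b c : B) :
    liePoisson B Z (a * b) c = a * liePoisson B Z b c + b * liePoisson B Z a c :=
  congrArg (fun D : Derivation K B B => D c) (Derivation.leibniz (extendDer Z (hamiltonian B Z)) a b)

end LiePoisson

section Canonical

variable (K) (m s : ℕ)

/-- The algebra `𝔸_m = K[p_1, …, p_m; q_1, …, q_m]`; the variable `p_i` is `X (Sum.inl i)` and the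
variable `q_i` is `X (Sum.inr i)`. -/
abbrev PolyPQ : Type _ := MvPolynomial (Fin m ⊕ Fin m) K

/-- The Poisson bracket of `𝔸_m`: `{F, G} = ∑ i, (∂F/∂p_i ∂G/∂q_i − ∂F/∂q_i ∂G/∂p_i)`. -/
def bracketPQ : PolyPQ K m →ₗ[K] PolyPQ K m →ₗ[K] PolyPQ K m :=
  ∑ i : Fin m,
    ((LinearMap.mul K (PolyPQ K m)).compl₁₂ (MvPolynomial.pderiv (Sum.inl i)).toLinearMap
        (MvPolynomial.pderiv (Sum.inr i)).toLinearMap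
      - (LinearMap.mul K (PolyPQ K m)).compl₁₂ (MvPolynomial.pderiv (Sum.inr i)).toLinearMap
        (MvPolynomial.pderiv (Sum.inl i)).toLinearMap)

/-- The algebra of Laurent polynomials `K[Z_1^±, …, Z_s^±]`. -/
abbrev Laurent : Type _ := AddMonoidAlgebra K (Fin s → ℤ)

variable {s} in
/-- The variable `Z_i`. -/
def Laurent.var (i : Fin s) : Laurent K s := AddMonoidAlgebra.single (Pi.single i 1) 1

end Canonical

/-- The Poisson bracket of a tensor product of two Poisson algebras:
`{a ⊗ b, a' ⊗ b'} = {a, a'} ⊗ b b' + a a' ⊗ {b, b'}`. -/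
def tensorBracket {A B : Type*} [CommRing A] [CommRing B] [Algebra K A] [Algebra K B]
    (α : A →ₗ[K] A →ₗ[K] A) (β : B →ₗ[K] B →ₗ[K] B) :
    A ⊗[K] B →ₗ[K] A ⊗[K] B →ₗ[K] A ⊗[K] B :=
  LinearMap.BilinMap.tmul α (LinearMap.mul K B) + LinearMap.BilinMap.tmul (LinearMap.mul K A) β

namespace RootIdeal

variable (𝔪 : RootIdeal K n)

/-- The complete diagram `𝒟_ℒ`. -/
def diagram : Diagram n := Diagram.final 𝔪.M

/-- The number `s` of symbols `⊗` in the diagram. -/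
def s : ℕ := 𝔪.diagram.count Mark.cross

/-- The properties of `z_1, …, z_s ∈ K[ℒ*]^L` relative to the diagram. -/
structure IsCasimirSystem [CharZero K] (z : Fin 𝔪.s → 𝔪.Reg) : Prop where
  /-- `z_i` is an invariant of the coadjoint representation. -/
  invariant : ∀ i, z i ∈ 𝔪.invReg
  /-- `z_i = y_{ξ_i} Q + P_{>i}`, where `ξ_i` is the place filled by `⊗` during the `i`-th step,
  `Q` is a product of powers of `z_1, …, z_{i-1}` and `P_{>i}` is a polynomial in the `y_η` with
  `η ≻ ξ_i`. -/
  triangular : ∀ i : Fin 𝔪.s, ∃ ξ, Diagram.crossPlace 𝔪.M i = some ξ ∧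
    ∃ e : Fin 𝔪.s → ℕ, ∃ P ∈ Algebra.adjoin K (𝔪.coord '' {η | ξ < η}),
      z i = 𝔪.coord ξ * ∏ j ∈ Finset.Iio i, z j ^ e j + P
  /-- The localization of `K[ℒ*]` with respect to the multiplicative set generated by
  `z_1, …, z_s` is isomorphic, as a Poisson algebra, to `K[z_1^±, …, z_s^±] ⊗ 𝔸_m` for some `m`,
  where the first factor has the zero bracket. -/
  decomposition : ∃ (m : ℕ)
    (φ : Localization (Submonoid.closure (Set.range z)) ≃ₐ[K] Laurent K 𝔪.s ⊗[K] PolyPQ K m),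
    (∀ i, φ (algebraMap 𝔪.Reg _ (z i)) = Laurent.var K i ⊗ₜ[K] 1) ∧
    ∀ a b, φ (liePoisson _ (Submonoid.closure (Set.range z)) a b) =
      tensorBracket 0 (bracketPQ K m) (φ a) (φ b)

end RootIdeal

end UTFactor

end

/-!
The proof runs along the diagram. Regard the coordinates `y_{ij}` as a matrix of rational functions
on `ℒ*`; on the set `E` of empty places their Poisson brackets are those of matrix units truncated
to `E` (`IsMatrixUnits`). If `⊗` is put on `(k, t)`, the function `y_{kt}` is central for the
remaining family, and the pairs `y_{ka}`, `y_{at} / y_{kt}` with `(k, a)` and `(a, t)` both in `E`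
(the places of the symbols `−` and `+`) are canonical. Conjugation by the unipotent matrix that
clears the column `t` (`reduced`) produces a family on the places that remain empty which commutes
with `y_{kt}` and with these pairs, and is again of the type of truncated matrix units
(`IsMatrixUnits.reduced`). This works because the set `E` stays closed and coclosed up to `M`
(`IsClosedRel`, `stepRel_closed`). When all places are filled, clearing denominators gives
polynomials `z_1, …, z_s` of the required triangular shape and `m` canonical pairs which generate
the localization of `K[ℒ*]` at the `z_i` (`RootIdeal.exists_isStage`). There are
`s + 2m = dim ℒ` of them, so they are algebraically independent and form Darboux coordinates
(`RootIdeal.IsDarboux`, `RootIdeal.exists_isDarboux`). Conversely the isomorphism of an adapted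
system with `K[Z^±] ⊗ 𝔸_m` gives Darboux coordinates; everything else is deduced from these.

For invariants, note that `N` is generated by the elements `1 + X` with `X` concentrated in one
column (`UT.column_induction`). Then `(ad X)² = 0`, so that `1 + cX` acts on `S(ℒ)` by values of the
polynomial flow `exp(T {X, ·})`. Hence Poisson central functions are invariant and, `K` being
infinite, rational invariants are Poisson central (`RootIdeal.mem_invReg_of_central`,
`RootIdeal.central_of_mem_invRat`). In Darboux coordinates the brackets with `p_a` and `q_a` are the
partial derivatives with respect to `q_a` and, up to sign, `p_a`, so that the central rational
functions are those of the `z_i` alone (`RootIdeal.IsDarboux.mem_adjoin_of_central`).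

At a point `f` where no `z_i` vanishes the form `f([x, y])` has rank `2m`, and the rank is lower
semicontinuous, so that the index is `dim ℒ - 2m = s` (`RootIdeal.IsDarboux.lieIndex_eq`).

The dimension of an orbit is the transcendence degree of its coordinate ring. Any `2m + 1` functions
satisfy a relation with coefficients in `K[z_1, …, z_s]`. Since the coefficients are invariant, their
values on a line through `f` are not changed when the line is moved by the group; division by a power
of the parameter of the line gives a nontrivial relation with constant coefficients on the orbit of
`f`, also if the `z_i` vanish there (`RootIdeal.IsDarboux.dim_orbit_le`). On the other hand, the
functions that vanish on an orbit form a Poisson ideal, and modulo a proper Poisson ideal canonical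
pairs stay algebraically independent in characteristic zero
(`IsCanonicalPairs.algebraicIndependent_of_hom`). So the orbits of the points where no `z_i` vanishes
have dimension `2m`, the number of symbols `+` and `−`.
-/
set_option linter.unusedSectionVars false

noncomputable section

namespace UTFactor

/-! ### Poisson brackets -/

/-- A bilinear operation that is skew-symmetric and a derivation in its second argument (hence in
both). The Jacobi identity is not part of the definition. -/
structure IsPoissonBracket {K B : Type*} [CommRing K] [CommRing B] [Algebra K B]
    (br : B →ₗ[K] B →ₗ[K] B) : Prop where
  skew : ∀ a b, br a b = -br b a
  mul_right : ∀ a b c, br a (b * c) = b * br a c + c * br a b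

namespace IsPoissonBracket

variable {K B : Type*} [CommRing K] [CommRing B] [Algebra K B] {br : B →ₗ[K] B →ₗ[K] B}

theorem mul_left (h : IsPoissonBracket br) (a b c : B) :
    br (a * b) c = a * br b c + b * br a c := by
  rw [h.skew, h.mul_right, h.skew c b, h.skew c a]; ring

theorem one_right (h : IsPoissonBracket br) (a : B) : br a 1 = 0 := by
  simpa using h.mul_right a 1 1

theorem algebraMap_right (h : IsPoissonBracket br) (a : B) (c : K) :
    br a (algebraMap K B c) = 0 := by
  rw [Algebra.algebraMap_eq_smul_one, map_smul, h.one_right, smul_zero]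

/-- The elements that Poisson commute with `a` form a subalgebra. -/
theorem adjoin_right (h : IsPoissonBracket br) {a : B} {s : Set B} (hs : ∀ x ∈ s, br a x = 0)
    {x : B} (hx : x ∈ Algebra.adjoin K s) : br a x = 0 := by
  induction hx using Algebra.adjoin_induction with
  | mem x hx => exact hs x hx
  | algebraMap c => exact h.algebraMap_right a c
  | add x y _ _ hx hy => rw [map_add, hx, hy, add_zero]
  | mul x y _ _ hx hy => rw [h.mul_right, hx, hy, mul_zero, mul_zero, add_zero]

end IsPoissonBracket

section Field

variable {K F : Type*} [CommRing K] [Field F] [Algebra K F] {br : F →ₗ[K] F →ₗ[K] F}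

theorem IsPoissonBracket.inv_right (h : IsPoissonBracket br) {a b : F} (hab : br a b = 0) :
    br a b⁻¹ = 0 := by
  by_cases hb : b = 0
  · simp [hb]
  have h1 : br a (b * b⁻¹) = 0 := by rw [mul_inv_cancel₀ hb, h.one_right]
  rw [h.mul_right, hab, mul_zero, add_zero] at h1
  exact (mul_eq_zero.mp h1).resolve_left hb

end Field

/-! ### Canonical pairs -/

/-- Families `p`, `q` with `{p_a, q_b} = δ_{ab}` and `{p_a, p_b} = {q_a, q_b} = 0`. -/
structure IsCanonicalPairs {K B α : Type*} [CommRing K] [CommRing B] [Algebra K B]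
    (br : B →ₗ[K] B →ₗ[K] B) (p q : α → B) : Prop where
  pp : ∀ a b, br (p a) (p b) = 0
  qq : ∀ a b, br (q a) (q b) = 0
  pq_self : ∀ a, br (p a) (q a) = 1
  pq_ne : ∀ a b, a ≠ b → br (p a) (q b) = 0

theorem IsCanonicalPairs.sum {K B α β : Type*} [CommRing K] [CommRing B] [Algebra K B]
    {br : B →ₗ[K] B →ₗ[K] B} (hb : IsPoissonBracket br) {p q : α → B} {p' q' : β → B}
    (h : IsCanonicalPairs br p q) (h' : IsCanonicalPairs br p' q')
    (hpp : ∀ a b, br (p' b) (p a) = 0) (hpq : ∀ a b, br (p' b) (q a) = 0)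
    (hqp : ∀ a b, br (q' b) (p a) = 0) (hqq : ∀ a b, br (q' b) (q a) = 0) :
    IsCanonicalPairs br (Sum.elim p p') (Sum.elim q q') where
  pp := by
    rintro (a | a) (b | b)
    · exact h.pp a b
    · exact (hb.skew _ _).trans (by rw [Sum.elim_inl, Sum.elim_inr, hpp, neg_zero])
    · exact hpp b a
    · exact h'.pp a b
  qq := by
    rintro (a | a) (b | b)
    · exact h.qq a b
    · exact (hb.skew _ _).trans (by rw [Sum.elim_inl, Sum.elim_inr, hqq, neg_zero])
    · exact hqq b a
    · exact h'.qq a b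
  pq_self := by
    rintro (a | a)
    · exact h.pq_self a
    · exact h'.pq_self a
  pq_ne := by
    rintro (a | a) (b | b) hab
    · exact h.pq_ne a b fun e => hab (congrArg _ e)
    · exact (hb.skew _ _).trans (by rw [Sum.elim_inl, Sum.elim_inr, hqp, neg_zero])
    · exact hpq b a
    · exact h'.pq_ne a b fun e => hab (congrArg _ e)

/-! ### Closed sets of places -/

/-- A set `E` of places, disjoint from an ideal `M` of places, such that `E` and the complement of
`E` are both transitive up to `M`; compare the inversion set of a permutation. The sets of empty
places of a diagram are of this kind. -/
structure IsClosedRel {ι : Type*} [LinearOrder ι] (E M : ι → ι → Prop) : Prop where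
  lt : ∀ {i j}, E i j → j < i
  not_mem : ∀ {i j}, E i j → ¬M i j
  ideal : ∀ {i j i' j'}, M i j → i ≤ i' → j' ≤ j → M i' j'
  trans : ∀ {i j l}, E i j → E j l → E i l ∨ M i l
  cotrans : ∀ {i j l}, E i l → l < j → j < i → E i j ∨ E j l
  mixed : ∀ {i j l}, M i l → E j l → j < i → E i j ∨ M i j

/-- The place `(k, t)` is the greatest place of `E`. -/
structure IsTop {ι : Type*} [LinearOrder ι] (E : ι → ι → Prop) (k t : ι) : Prop where
  mem : E k t
  col_le : ∀ {i j}, E i j → t ≤ j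
  le_row : ∀ {i}, E i t → i ≤ k

/-- The set of empty places that remains after `⊗` has been put on `(k, t)`. -/
def stepRel {ι : Type*} (E : ι → ι → Prop) (k t : ι) (i j : ι) : Prop :=
  E i j ∧ ¬(i = k ∧ j = t) ∧ ¬(i = k ∧ E j t) ∧ ¬(j = t ∧ E k i)

section Step

variable {ι : Type*} [LinearOrder ι] {E M : ι → ι → Prop} {k t : ι}

theorem IsClosedRel.not_mem_of_le (hE : IsClosedRel E M) {i j i' j' : ι} (h : E i j)
    (hi : i' ≤ i) (hj : j ≤ j') : ¬M i' j' :=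
  fun hM => hE.not_mem h (hE.ideal hM hi hj)

/-- An empty place right of or in the pivot column `t` and below the pivot row `k` forces the place
in column `t` to lie in `M`. -/
theorem IsClosedRel.mem_of_row_lt (hE : IsClosedRel E M) (ht : IsTop E k t) {l a : ι}
    (h1 : E l a) (h2 : E a t) (hl : k < l) : M l t :=
  (hE.trans h1 h2).resolve_left fun h => (ht.le_row h).not_gt hl

theorem IsClosedRel.row_mem (hE : IsClosedRel E M) (ht : IsTop E k t) {l i j : ι}
    (hlk : E l k) (hit : E i t) (hlj : E l j) (hji : j ≤ i) (hik : i < k) : E l i := by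
  have hkl := hE.lt hlk
  have hM := hE.mem_of_row_lt ht hlk ht.mem hkl
  exact (hE.mixed hM hit (hik.trans hkl)).resolve_right (hE.not_mem_of_le hlj le_rfl hji)

theorem stepRel_closed (hE : IsClosedRel E M) (ht : IsTop E k t) :
    IsClosedRel (stepRel E k t) M where
  lt h := hE.lt h.1
  not_mem h := hE.not_mem h.1
  ideal := hE.ideal
  trans := by
    rintro i j l ⟨h1, a1, b1, c1⟩ ⟨h2, a2, b2, c2⟩
    rcases hE.trans h1 h2 with h | h
    swap
    · exact Or.inr h
    refine Or.inl ⟨h, ?_, ?_, ?_⟩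
    · rintro ⟨rfl, rfl⟩
      exact b1 ⟨rfl, h2⟩
    · rintro ⟨rfl, hl⟩
      rcases hE.trans h2 hl with h3 | h3
      · exact b1 ⟨rfl, h3⟩
      · exact hE.not_mem_of_le ht.mem (hE.lt h1).le le_rfl h3
    · rintro ⟨rfl, hl⟩
      rcases hE.trans hl h1 with h3 | h3
      · exact c2 ⟨rfl, h3⟩
      · exact hE.not_mem_of_le ht.mem le_rfl (hE.lt h2).le h3
  cotrans := by
    rintro i j l ⟨h, a, b, c⟩ hlj hji
    have htl := ht.col_le h
    have hjt : j ≠ t := (htl.trans_lt hlj).ne'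
    by_cases hik : i = k
    · subst hik
      have hlt : l ≠ t := fun h => a ⟨rfl, h⟩
      by_cases hjl : E j l
      · exact Or.inr ⟨hjl, fun e => hlt e.2, fun e => hji.ne e.1, fun e => hlt e.1⟩
      · have h1 := (hE.cotrans h hlj hji).resolve_right hjl
        refine Or.inl ⟨h1, fun e => hjt e.2, fun e => ?_, fun e => hjt e.1⟩
        rcases hE.cotrans e.2 (lt_of_le_of_ne htl hlt.symm) hlj with h2 | h2
        · exact hjl h2
        · exact b ⟨rfl, h2⟩
    · by_cases hij : E i j
      · exact Or.inl ⟨hij, fun e => hik e.1, fun e => hik e.1, fun e => hjt e.1⟩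
      · have h1 := (hE.cotrans h hlj hji).resolve_left hij
        refine Or.inr ⟨h1, ?_, ?_, ?_⟩
        · rintro ⟨rfl, rfl⟩
          exact (ht.le_row h).not_gt hji
        · rintro ⟨rfl, hl⟩
          have hM := hE.mem_of_row_lt ht h hl hji
          rcases hE.mixed hM ht.mem hji with h2 | h2
          · exact hij h2
          · exact hE.not_mem_of_le h le_rfl hlj.le h2
        · rintro ⟨rfl, hj⟩
          have hi : i < k := lt_of_le_of_ne (ht.le_row h) hik
          rcases hE.cotrans hj hji hi with h2 | h2
          · exact c ⟨rfl, h2⟩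
          · exact hij h2
  mixed := by
    rintro i j l hM ⟨h, a, b, c⟩ hji
    rcases hE.mixed hM h hji with h1 | h1
    swap
    · exact Or.inr h1
    have htl := ht.col_le h
    have hjt : j ≠ t := (htl.trans_lt (hE.lt h)).ne'
    have hik : i ≠ k := by
      rintro rfl
      exact hE.not_mem_of_le ht.mem le_rfl htl hM
    exact Or.inl ⟨h1, fun e => hik e.1, fun e => hik e.1, fun e => hjt e.1⟩

end Step

/-! ### Reduction with respect to the greatest empty place -/

/-- The family `Y` is supported on `E` and its Poisson brackets are those of the matrix units
`y_{ij}`, `(i, j) ∈ E`, truncated to `E`. -/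
structure IsMatrixUnits {ι K F : Type*} [CommRing K] [Field F] [Algebra K F]
    (br : F →ₗ[K] F →ₗ[K] F) (E : ι → ι → Prop) (Y : ι → ι → F) : Prop where
  zero : ∀ {i j}, ¬E i j → Y i j = 0
  comp : ∀ {i j m}, E i j → E j m → br (Y i j) (Y j m) = Y i m
  ne : ∀ {i j l m}, j ≠ l → m ≠ i → br (Y i j) (Y l m) = 0

open Classical in
/-- The generators of the Poisson centralizer of the `Y k a` and `Y a t`: the entries of the matrix
`Y` after conjugation by the unipotent matrix that clears the column `t` above the place
`(k, t)`, taken only on the places that remain empty. -/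
def reduced {ι F : Type*} [Fintype ι] [Field F] (E : ι → ι → Prop) (k t : ι) (Y : ι → ι → F)
    (i j : ι) : F :=
  if stepRel E k t i j then
    if j = k then (Y k t)⁻¹ * ∑ a, Y i a * Y a t
    else if i = k ∨ j = t then Y i j
    else Y i j - (Y k t)⁻¹ * (Y i t * Y k j)
  else 0

section Reduction

variable {ι K F : Type*} [LinearOrder ι] [CommRing K] [Field F] [Algebra K F]
  {br : F →ₗ[K] F →ₗ[K] F} {E M : ι → ι → Prop} {Y : ι → ι → F} {k t : ι}

theorem IsTop.lt (hE : IsClosedRel E M) (ht : IsTop E k t) : t < k := hE.lt ht.mem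

theorem IsTop.row_ne (hE : IsClosedRel E M) (ht : IsTop E k t) {i j : ι} (h : E i j) : i ≠ t :=
  ((ht.col_le h).trans_lt (hE.lt h)).ne'

namespace IsMatrixUnits

omit [LinearOrder ι] in
theorem comp' (hb : IsPoissonBracket br) (hY : IsMatrixUnits br E Y) {i j l : ι}
    (h1 : E i j) (h2 : E l i) : br (Y i j) (Y l i) = -Y l j := by
  rw [hb.skew, hY.comp h2 h1]

theorem col_eq_zero (ht : IsTop E k t) (hY : IsMatrixUnits br E Y) {i : ι} (h : k < i) :
    Y i t = 0 :=
  hY.zero fun e => (ht.le_row e).not_gt h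

theorem top_left (hE : IsClosedRel E M) (ht : IsTop E k t) (hb : IsPoissonBracket br)
    (hY : IsMatrixUnits br E Y) (i j : ι) : br (Y k t) (Y i j) = 0 := by
  by_cases h : E i j
  swap
  · rw [hY.zero h, map_zero]
  by_cases hj : j = k
  · subst hj
    rw [hY.comp' hb ht.mem h, hY.col_eq_zero ht (hE.lt h), neg_zero]
  · exact hY.ne (ht.row_ne hE h).symm hj

theorem top_right (hE : IsClosedRel E M) (ht : IsTop E k t) (hb : IsPoissonBracket br)
    (hY : IsMatrixUnits br E Y) (i j : ι) : br (Y i j) (Y k t) = 0 := by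
  rw [hb.skew, hY.top_left hE ht hb, neg_zero]

theorem inv_right (hE : IsClosedRel E M) (ht : IsTop E k t) (hb : IsPoissonBracket br)
    (hY : IsMatrixUnits br E Y) (i j : ι) : br (Y i j) (Y k t)⁻¹ = 0 :=
  hb.inv_right (hY.top_right hE ht hb i j)

theorem inv_left (hE : IsClosedRel E M) (ht : IsTop E k t) (hb : IsPoissonBracket br)
    (hY : IsMatrixUnits br E Y) (i j : ι) : br (Y k t)⁻¹ (Y i j) = 0 := by
  rw [hb.skew, hY.inv_right hE ht hb, neg_zero]

theorem inv_inv (hE : IsClosedRel E M) (ht : IsTop E k t) (hb : IsPoissonBracket br)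
    (hY : IsMatrixUnits br E Y) : br (Y k t)⁻¹ (Y k t)⁻¹ = 0 :=
  hb.inv_right (hY.inv_left hE ht hb k t)

theorem col_col (hE : IsClosedRel E M) (ht : IsTop E k t) (hY : IsMatrixUnits br E Y) (i j : ι) :
    br (Y i t) (Y j t) = 0 := by
  by_cases h : E i t
  swap
  · rw [hY.zero h, map_zero, LinearMap.zero_apply]
  by_cases h' : E j t
  swap
  · rw [hY.zero h', map_zero]
  exact hY.ne (ht.row_ne hE h').symm (ht.row_ne hE h).symm

theorem row_row (hE : IsClosedRel E M) (hY : IsMatrixUnits br E Y) (i j : ι) :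
    br (Y k i) (Y k j) = 0 := by
  by_cases h : E k i
  swap
  · rw [hY.zero h, map_zero, LinearMap.zero_apply]
  by_cases h' : E k j
  swap
  · rw [hY.zero h', map_zero]
  exact hY.ne (hE.lt h).ne (hE.lt h').ne

theorem row_col (hE : IsClosedRel E M) (ht : IsTop E k t) (hY : IsMatrixUnits br E Y) {i j : ι}
    (h : i ≠ j) : br (Y k i) (Y j t) = 0 :=
  hY.ne h (ht.lt hE).ne

theorem col_row (hE : IsClosedRel E M) (ht : IsTop E k t) (hY : IsMatrixUnits br E Y) {i j : ι}
    (h : i ≠ j) : br (Y j t) (Y k i) = 0 :=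
  hY.ne (ht.lt hE).ne h

end IsMatrixUnits

/-! ### The three shapes of the reduced generators -/

variable [Fintype ι]

omit [LinearOrder ι] in
theorem reduced_zero {i j : ι} (h : ¬stepRel E k t i j) : reduced E k t Y i j = 0 := if_neg h

omit [LinearOrder ι] in
theorem reduced_sum {i : ι} (h : stepRel E k t i k) :
    reduced E k t Y i k = (Y k t)⁻¹ * ∑ a, Y i a * Y a t := by
  rw [reduced, if_pos h, if_pos rfl]

theorem reduced_plain (ht : IsTop E k t) (hY : IsMatrixUnits br E Y)
    {i j : ι} (h : stepRel E k t i j) (hj : j ≠ k) (hi : k ≤ i ∨ j = t) :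
    reduced E k t Y i j = Y i j := by
  rw [reduced, if_pos h, if_neg hj]
  split_ifs with h1
  · rfl
  · rw [not_or] at h1
    have h2 := lt_of_le_of_ne (hi.resolve_right h1.2) (Ne.symm h1.1)
    rw [hY.col_eq_zero ht h2, zero_mul, mul_zero, sub_zero]

theorem reduced_corrected (hE : IsClosedRel E M) {i j : ι}
    (h : stepRel E k t i j) (hi : i < k) (hj : j ≠ t) :
    reduced E k t Y i j = Y i j - (Y k t)⁻¹ * (Y i t * Y k j) := by
  rw [reduced, if_pos h, if_neg ((hE.lt h.1).trans hi).ne, if_neg (not_or.mpr ⟨hi.ne, hj⟩)]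

/-- Outside the new set of empty places the uncorrected generators of the lower rows vanish
whenever the place is reached by a product. -/
theorem reduced_eq_of_plain (hE : IsClosedRel E M) (ht : IsTop E k t)
    (hY : IsMatrixUnits br E Y) {i j m : ι} (h1 : stepRel E k t i j) (h2 : stepRel E k t j m)
    (hj : m ≠ k) (hi : k ≤ i ∨ m = t) :
    reduced E k t Y i m = Y i m := by
  rcases (stepRel_closed hE ht).trans h1 h2 with h | h
  · exact reduced_plain ht hY h hj hi
  · rw [reduced_zero fun h' => hE.not_mem h'.1 h, hY.zero fun h' => hE.not_mem h' h]

namespace IsMatrixUnits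

/-! ### Brackets with the sums -/

theorem sum_col (hE : IsClosedRel E M) (ht : IsTop E k t) (hb : IsPoissonBracket br)
    (hY : IsMatrixUnits br E Y) {l : ι} (hl : k < l) (b : ι) :
    br (Y b t) ((Y k t)⁻¹ * ∑ a, Y l a * Y a t) = 0 := by
  have h : ∀ a, br (Y b t) (Y l a * Y a t) = 0 := by
    intro a
    rw [hb.mul_right, hY.col_col hE ht, mul_zero, zero_add]
    by_cases ha : a = b
    · subst ha
      by_cases h1 : E a t
      swap
      · rw [hY.zero h1, zero_mul]
      by_cases h2 : E l a
      swap
      · rw [hY.zero h2, map_zero, mul_zero]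
      rw [hY.comp' hb h1 h2, hY.col_eq_zero ht hl, neg_zero, mul_zero]
    · rw [hY.ne (ht.lt hE |>.trans hl).ne ha, mul_zero]
  rw [hb.mul_right, hY.inv_right hE ht hb, map_sum, Finset.sum_eq_zero fun a _ => h a, mul_zero,
    mul_zero, add_zero]

theorem sum_row (hE : IsClosedRel E M) (ht : IsTop E k t) (hb : IsPoissonBracket br)
    (hY : IsMatrixUnits br E Y) (hz : Y k t ≠ 0) {l b : ι} (hl : E l k) (hkb : E k b) :
    br ((Y k t)⁻¹ * ∑ a, Y l a * Y a t) (Y k b) =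
      Y l b + (Y k t)⁻¹ * Y l b * br (Y b t) (Y k b) := by
  have h : ∀ a, br (Y l a * Y a t) (Y k b) =
      (if a = b then Y l b * br (Y b t) (Y k b) else 0) + if a = k then Y k t * Y l b else 0 := by
    intro a
    rw [hb.mul_left]
    congr 1
    · split_ifs with hab
      · rw [hab]
      · rw [hY.col_row hE ht (Ne.symm hab), mul_zero]
    · split_ifs with hak
      · rw [hak, hY.comp hl hkb]
      · rw [hY.ne hak ((hE.lt hkb).trans (hE.lt hl)).ne, mul_zero]
  rw [hb.mul_left, hY.inv_left hE ht hb, map_sum, LinearMap.sum_apply, Finset.sum_congr rfl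
    fun a _ => h a, Finset.sum_add_distrib, Finset.sum_ite_eq' , Finset.sum_ite_eq']
  simp only [Finset.mem_univ, if_true]
  field_simp
  ring

/-- The bracket of a sum with a plain generator in another row. -/
theorem plain_sum (hE : IsClosedRel E M) (ht : IsTop E k t) (hb : IsPoissonBracket br)
    (hY : IsMatrixUnits br E Y) {i j l : ι} (hi : k < i) (hjl : j ≠ l) :
    br (Y i j) ((Y k t)⁻¹ * ∑ a, Y l a * Y a t) = 0 := by
  have h : ∀ a, br (Y i j) (Y l a * Y a t) = 0 := by
    intro a
    rw [hb.mul_right]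
    have h1 : br (Y i j) (Y a t) = 0 := by
      by_cases hja : j = a
      · subst hja
        by_cases h1 : E i j
        swap
        · rw [hY.zero h1, map_zero, LinearMap.zero_apply]
        by_cases h2 : E j t
        swap
        · rw [hY.zero h2, map_zero]
        rw [hY.comp h1 h2, hY.col_eq_zero ht hi]
      · exact hY.ne hja ((ht.lt hE).trans hi).ne
    rw [h1, mul_zero, zero_add]
    by_cases hai : a = i
    · rw [hai, hY.col_eq_zero ht hi, zero_mul]
    · rw [hY.ne hjl hai, mul_zero]
  rw [hb.mul_right, hY.inv_right hE ht hb, map_sum, Finset.sum_eq_zero fun a _ => h a, mul_zero,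
    mul_zero, add_zero]

/-- The bracket of a plain generator `(i, l)` with the sum in row `l` is the sum in row `i`. -/
theorem comp_sum (hE : IsClosedRel E M) (ht : IsTop E k t) (hb : IsPoissonBracket br)
    (hY : IsMatrixUnits br E Y) {i l : ι} (hil : E i l) (hl : E l k) :
    br (Y i l) ((Y k t)⁻¹ * ∑ a, Y l a * Y a t) = (Y k t)⁻¹ * ∑ a, Y i a * Y a t := by
  have hkl := hE.lt hl
  have h : ∀ a, br (Y i l) (Y l a * Y a t) = Y i a * Y a t := by
    intro a
    rw [hb.mul_right]
    have h1 : br (Y i l) (Y a t) = 0 := by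
      by_cases hla : l = a
      · rw [← hla, hY.col_eq_zero ht hkl, map_zero]
      · exact hY.ne hla ((ht.lt hE).trans (hkl.trans (hE.lt hil))).ne
    rw [h1, mul_zero, zero_add]
    by_cases h2 : E a t
    swap
    · rw [hY.zero h2, zero_mul, mul_zero]
    by_cases h3 : E l a
    · rw [hY.comp hil h3, mul_comm]
    · rw [hY.zero h3, map_zero, mul_zero]
      by_cases h4 : E i a
      swap
      · rw [hY.zero h4, zero_mul]
      exfalso
      rcases (ht.le_row h2).eq_or_lt with rfl | hak
      · exact h3 hl
      · have hM := hE.mem_of_row_lt ht hl ht.mem hkl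
        rcases hE.mixed hM h2 (hak.trans hkl) with h5 | h5
        · exact h3 h5
        · exact hE.not_mem_of_le h4 (hE.lt hil).le le_rfl h5
  rw [hb.mul_right, hY.inv_right hE ht hb, map_sum, Finset.sum_congr rfl fun a _ => h a, mul_zero,
    add_zero]

/-- The bracket of a sum with a corrected generator vanishes. -/
theorem corrected_sum (hE : IsClosedRel E M) (ht : IsTop E k t) (hb : IsPoissonBracket br)
    (hY : IsMatrixUnits br E Y) (hz : Y k t ≠ 0) {i j l : ι} (hl : E l k) (hij : E i j)
    (hi : i < k) (hj : j ≠ t) :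
    br ((Y k t)⁻¹ * ∑ a, Y l a * Y a t) (Y i j - (Y k t)⁻¹ * (Y i t * Y k j)) = 0 := by
  have hkl := hE.lt hl
  have hji := hE.lt hij
  have htj : t < j := lt_of_le_of_ne (ht.col_le hij) hj.symm
  -- the bracket of the sum with `Y i j`
  have h1 : ∀ a, br (Y l a * Y a t) (Y i j) =
      (if a = i then Y i t * br (Y l i) (Y i j) else 0) +
        if a = j then Y l j * br (Y j t) (Y i j) else 0 := by
    intro a
    rw [hb.mul_left, add_comm]
    congr 1
    · split_ifs with h
      · rw [h]
      · rw [hY.ne h (hji.trans (hi.trans hkl)).ne, mul_zero]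
    · split_ifs with h
      · rw [h]
      · rw [hY.ne (ht.row_ne hE hij).symm (Ne.symm h), mul_zero]
  have h1' : br ((Y k t)⁻¹ * ∑ a, Y l a * Y a t) (Y i j) =
      (Y k t)⁻¹ * (Y i t * br (Y l i) (Y i j) + Y l j * br (Y j t) (Y i j)) := by
    rw [hb.mul_left, hY.inv_left hE ht hb, map_sum, LinearMap.sum_apply, Finset.sum_congr rfl
      fun a _ => h1 a, Finset.sum_add_distrib, Finset.sum_ite_eq', Finset.sum_ite_eq']
    simp
  have h2 : br ((Y k t)⁻¹ * ∑ a, Y l a * Y a t) (Y k t)⁻¹ = 0 := by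
    refine hb.inv_right ?_
    rw [hb.skew, hY.sum_col hE ht hb hkl, neg_zero]
  have h3 : br ((Y k t)⁻¹ * ∑ a, Y l a * Y a t) (Y i t) = 0 := by
    rw [hb.skew, hY.sum_col hE ht hb hkl, neg_zero]
  rw [map_sub, h1', hb.mul_right, h2, mul_zero, add_zero, hb.mul_right, h3, mul_zero, add_zero]
  by_cases hit : E i t
  swap
  · rw [hY.zero hit]
    by_cases hjt : E j t
    · rw [hY.comp' hb hjt hij, hY.zero hit]; ring
    · rw [hY.zero hjt, map_zero, LinearMap.zero_apply]; ring
  by_cases hlj : E l j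
  swap
  · have e : br (Y l i) (Y i j) = 0 := by
      by_cases hli : E l i
      · rw [hY.comp hli hij, hY.zero hlj]
      · rw [hY.zero hli, map_zero, LinearMap.zero_apply]
    rw [e, hY.zero hlj]
    by_cases hkj : E k j
    · rw [hY.sum_row hE ht hb hz hl hkj, hY.zero hlj]; ring
    · rw [hY.zero hkj, map_zero]; ring
  rw [hY.comp (hE.row_mem ht hl hit hlj hji.le hi) hij]
  by_cases hkj : E k j
  · rw [hY.sum_row hE ht hb hz hl hkj]
    by_cases hjt : E j t
    · rw [hY.comp' hb hjt hij, hY.comp' hb hjt hkj]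
      field_simp
      ring
    · rw [hY.zero hjt, map_zero, LinearMap.zero_apply, LinearMap.zero_apply]
      ring
  · have hjt := (hE.cotrans ht.mem htj (hji.trans hi)).resolve_left hkj
    rw [hY.zero hkj, map_zero, hY.comp' hb hjt hij]
    ring

theorem sum_sum (hE : IsClosedRel E M) (ht : IsTop E k t) (hb : IsPoissonBracket br)
    (hY : IsMatrixUnits br E Y) {l l' : ι} (hl : k < l) (hl' : k < l') :
    br ((Y k t)⁻¹ * ∑ a, Y l a * Y a t) ((Y k t)⁻¹ * ∑ a, Y l' a * Y a t) = 0 := by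
  have h0 : ∀ a, Y a t * br (Y l a) ((Y k t)⁻¹ * ∑ a, Y l' a * Y a t) = 0 := by
    intro a
    by_cases h : E a t
    · rw [hY.plain_sum hE ht hb hl ((ht.le_row h).trans_lt hl').ne, mul_zero]
    · rw [hY.zero h, zero_mul]
  have h : ∀ a, br (Y l a * Y a t) ((Y k t)⁻¹ * ∑ a, Y l' a * Y a t) = 0 := by
    intro a
    rw [hb.mul_left, hY.sum_col hE ht hb hl', h0 a, mul_zero, add_zero]
  have h2 : br (Y k t)⁻¹ ((Y k t)⁻¹ * ∑ a, Y l' a * Y a t) = 0 := by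
    rw [hb.skew, hb.inv_right, neg_zero]
    rw [hb.skew, hY.sum_col hE ht hb hl', neg_zero]
  rw [hb.mul_left, h2, map_sum, LinearMap.sum_apply, Finset.sum_eq_zero fun a _ => h a, mul_zero,
    mul_zero, add_zero]

/-- The corrected generators commute with the pivot column, except for the bracket that defines the
reduced column. -/
theorem corrected_col (hE : IsClosedRel E M) (ht : IsTop E k t) (hb : IsPoissonBracket br)
    (hY : IsMatrixUnits br E Y) {i j a : ι} :
    br (Y i j - (Y k t)⁻¹ * (Y i t * Y k j)) (Y a t) =
      br (Y i j) (Y a t) - (Y k t)⁻¹ * Y i t * br (Y k j) (Y a t) := by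
  rw [map_sub, LinearMap.sub_apply, hb.mul_left, hY.inv_left hE ht hb, hb.mul_left,
    hY.col_col hE ht]
  ring

theorem corrected_row (hE : IsClosedRel E M) (ht : IsTop E k t) (hb : IsPoissonBracket br)
    (hY : IsMatrixUnits br E Y) {i j a : ι} :
    br (Y i j - (Y k t)⁻¹ * (Y i t * Y k j)) (Y k a) =
      br (Y i j) (Y k a) - (Y k t)⁻¹ * Y k j * br (Y i t) (Y k a) := by
  rw [map_sub, LinearMap.sub_apply, hb.mul_left, hY.inv_left hE ht hb, hb.mul_left,
    hY.row_row hE]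
  ring

theorem corrected_corrected (hE : IsClosedRel E M) (ht : IsTop E k t) (hb : IsPoissonBracket br)
    (hY : IsMatrixUnits br E Y) (hz : Y k t ≠ 0) {i j m : ι} (hij : E i j) (hjm : E j m)
    (hi : i < k) (hm : m ≠ t) :
    br (Y i j - (Y k t)⁻¹ * (Y i t * Y k j)) (Y j m - (Y k t)⁻¹ * (Y j t * Y k m)) =
      Y i m - (Y k t)⁻¹ * (Y i t * Y k m) := by
  have hji := hE.lt hij
  have hmj := hE.lt hjm
  have htm : t < m := lt_of_le_of_ne (ht.col_le hjm) hm.symm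
  have hc : br (Y i j - (Y k t)⁻¹ * (Y i t * Y k j)) (Y k t)⁻¹ = 0 := by
    refine hb.inv_right ?_
    rw [hY.corrected_col hE ht hb, hY.top_right hE ht hb, hY.top_right hE ht hb]
    ring
  have e1 : br (Y i j) (Y k m) = 0 := hY.ne (hji.trans hi).ne (hmj.trans hji).ne
  have e2 : br (Y i t) (Y k m) = 0 := hY.col_row hE ht (hmj.trans hji).ne
  have e4 : br (Y i t) (Y j m) = 0 := hY.ne (ht.row_ne hE hjm).symm (hmj.trans hji).ne
  rw [map_sub, hb.mul_right, hc, hb.mul_right, hY.corrected_col hE ht hb,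
    hY.corrected_row hE ht hb, e1, e2, map_sub, LinearMap.sub_apply, hY.comp hij hjm,
    hb.mul_left, hb.mul_left, hY.inv_left hE ht hb, e4]
  by_cases hit : E i t
  swap
  · rw [hY.zero hit]
    by_cases hjt : E j t
    · rw [hY.comp hij hjt, hY.zero hit]; ring
    · rw [hY.zero hjt, map_zero]; ring
  by_cases hkm : E k m
  swap
  · have e3 : br (Y k j) (Y j m) = 0 := by
      by_cases hkj : E k j
      · rw [hY.comp hkj hjm, hY.zero hkm]
      · rw [hY.zero hkj, map_zero, LinearMap.zero_apply]
    rw [hY.zero hkm, e3]; ring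
  by_cases hjt : E j t
  · by_cases hkj : E k j
    · rw [hY.comp hij hjt, hY.comp hkj hjt, hY.comp hkj hjm]
      field_simp
      ring
    · rw [hY.comp hij hjt, hY.zero hkj, map_zero, LinearMap.zero_apply, LinearMap.zero_apply]
      field_simp
      ring
  · have hkj := (hE.cotrans ht.mem (htm.trans hmj) (hji.trans hi)).resolve_right hjt
    rw [hY.zero hjt, hY.comp hkj hjm, map_zero, map_zero]
    ring

/-! ### The reduced family -/

theorem reduced_comp (hE : IsClosedRel E M) (ht : IsTop E k t) (hb : IsPoissonBracket br)
    (hY : IsMatrixUnits br E Y) (hz : Y k t ≠ 0) {i j m : ι}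
    (h1 : stepRel E k t i j) (h2 : stepRel E k t j m) :
    br (reduced E k t Y i j) (reduced E k t Y j m) = reduced E k t Y i m := by
  have hji := hE.lt h1.1
  have hmj := hE.lt h2.1
  have htj : t < j := (ht.col_le h2.1).trans_lt hmj
  by_cases hmk : m = k
  · subst hmk
    rw [reduced_plain ht hY h1 hmj.ne' (Or.inl (hmj.trans hji).le), reduced_sum h2,
      hY.comp_sum hE ht hb h1.1 h2.1]
    by_cases h3 : stepRel E m t i m
    · rw [reduced_sum h3]
    · rw [reduced_zero h3]
      have hM := ((stepRel_closed hE ht).trans h1 h2).resolve_left h3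
      rw [Finset.sum_eq_zero, mul_zero]
      intro a _
      by_cases ha : E a t
      · rw [hY.zero fun h => hE.not_mem_of_le h le_rfl (ht.le_row ha) hM, zero_mul]
      · rw [hY.zero ha, mul_zero]
  by_cases hjk : j = k
  · subst hjk
    have hmt : m ≠ t := fun h => h2.2.1 ⟨rfl, h⟩
    rw [reduced_sum h1, reduced_plain ht hY h2 hmk (Or.inl le_rfl),
      hY.sum_row hE ht hb hz h1.1 h2.1, hY.zero (i := m) (j := t) fun h => h2.2.2.1 ⟨rfl, h⟩,
      reduced_eq_of_plain hE ht hY h1 h2 hmk (Or.inl hji.le)]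
    simp
  by_cases hik : k ≤ i
  · rw [reduced_plain ht hY h1 hjk (Or.inl hik), reduced_eq_of_plain hE ht hY h1 h2 hmk
      (Or.inl hik)]
    by_cases hmt : k ≤ j ∨ m = t
    · rw [reduced_plain ht hY h2 hmk hmt, hY.comp h1.1 h2.1]
    · rw [not_or, not_le] at hmt
      rw [reduced_corrected hE h2 hmt.1 hmt.2, map_sub, hY.comp h1.1 h2.1, hb.mul_right,
        hY.inv_right hE ht hb, hb.mul_right]
      have e1 : Y k m * br (Y i j) (Y j t) = 0 := by
        by_cases hjt : E j t
        swap
        · rw [hY.zero hjt, map_zero, mul_zero]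
        rw [hY.comp h1.1 hjt]
        rcases hik.eq_or_lt with rfl | hik
        · exact absurd ⟨rfl, hjt⟩ h1.2.2.1
        · rw [hY.col_eq_zero ht hik, mul_zero]
      rw [e1, hY.ne (l := k) hjk (hmj.trans hji).ne]
      ring
  · rw [not_le] at hik
    rw [reduced_corrected hE h1 hik htj.ne']
    by_cases hmt : m = t
    · subst hmt
      rw [reduced_plain ht hY h2 hmk (Or.inr rfl), reduced_eq_of_plain hE ht hY h1 h2 hmk
        (Or.inr rfl), hY.corrected_col hE ht hb, hY.comp h1.1 h2.1,
        hY.zero (i := k) (j := j) fun h => h2.2.2.2 ⟨rfl, h⟩]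
      simp
    · rw [reduced_corrected hE h2 (hji.trans hik) hmt, hY.corrected_corrected hE ht hb hz h1.1 h2.1
        hik hmt]
      by_cases h3 : stepRel E k t i m
      · rw [reduced_corrected hE h3 hik hmt]
      · have hM := ((stepRel_closed hE ht).trans h1 h2).resolve_left h3
        rw [reduced_zero h3, hY.zero fun h => hE.not_mem h hM, hY.zero (i := i) (j := t)
          fun h => hE.not_mem_of_le h le_rfl (ht.col_le h2.1) hM]
        ring

/-- A plain generator commutes with every other non-adjacent reduced generator. -/
theorem plain_reduced_ne (hE : IsClosedRel E M) (ht : IsTop E k t) (hb : IsPoissonBracket br)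
    (hY : IsMatrixUnits br E Y) {i j l m : ι} (h1 : stepRel E k t i j)
    (h2 : stepRel E k t l m) (hj : j ≠ k) (hi : k ≤ i ∨ j = t) (hjl : j ≠ l) (hmi : m ≠ i) :
    br (Y i j) (reduced E k t Y l m) = 0 := by
  by_cases hmk : m = k
  · subst hmk
    rw [reduced_sum h2]
    rcases hi with hi | rfl
    · exact hY.plain_sum hE ht hb (lt_of_le_of_ne hi hmi) hjl
    · exact hY.sum_col hE ht hb (hE.lt h2.1) i
  by_cases hl : k ≤ l ∨ m = t
  · rw [reduced_plain ht hY h2 hmk hl, hY.ne hjl hmi]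
  · rw [not_or, not_le] at hl
    rw [reduced_corrected hE h2 hl.1 hl.2, map_sub, hY.ne hjl hmi, hb.mul_right,
      hY.inv_right hE ht hb, hb.mul_right, hY.ne hjl (ht.row_ne hE h1.1).symm, hY.ne hj hmi]
    ring

theorem reduced_ne (hE : IsClosedRel E M) (ht : IsTop E k t) (hb : IsPoissonBracket br)
    (hY : IsMatrixUnits br E Y) (hz : Y k t ≠ 0) {i j l m : ι} (hjl : j ≠ l) (hmi : m ≠ i) :
    br (reduced E k t Y i j) (reduced E k t Y l m) = 0 := by
  by_cases h1 : stepRel E k t i j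
  swap
  · rw [reduced_zero h1, map_zero, LinearMap.zero_apply]
  by_cases h2 : stepRel E k t l m
  swap
  · rw [reduced_zero h2, map_zero]
  by_cases p1 : j ≠ k ∧ (k ≤ i ∨ j = t)
  · rw [reduced_plain ht hY h1 p1.1 p1.2, hY.plain_reduced_ne hE ht hb h1 h2 p1.1 p1.2 hjl hmi]
  by_cases p2 : m ≠ k ∧ (k ≤ l ∨ m = t)
  · rw [hb.skew, reduced_plain ht hY h2 p2.1 p2.2,
      hY.plain_reduced_ne hE ht hb h2 h1 p2.1 p2.2 hmi hjl, neg_zero]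
  by_cases hjk : j = k
  · subst hjk
    have hji := hE.lt h1.1
    rw [reduced_sum h1]
    by_cases hmk : m = j
    · subst hmk
      rw [reduced_sum h2, hY.sum_sum hE ht hb hji (hE.lt h2.1)]
    · have := not_or.mp fun h => p2 ⟨hmk, h⟩
      rw [reduced_corrected hE h2 (not_le.mp this.1) this.2,
        hY.corrected_sum hE ht hb hz h1.1 h2.1 (not_le.mp this.1) this.2]
  · have c1 := not_or.mp fun h => p1 ⟨hjk, h⟩
    rw [reduced_corrected hE h1 (not_le.mp c1.1) c1.2]
    by_cases hmk : m = k
    · subst hmk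
      rw [reduced_sum h2, hb.skew, hY.corrected_sum hE ht hb hz h2.1 h1.1 (not_le.mp c1.1) c1.2,
        neg_zero]
    · have c2 := not_or.mp fun h => p2 ⟨hmk, h⟩
      rw [reduced_corrected hE h2 (not_le.mp c2.1) c2.2]
      have hc : br (Y i j - (Y k t)⁻¹ * (Y i t * Y k j)) (Y k t)⁻¹ = 0 := by
        refine hb.inv_right ?_
        rw [hY.corrected_col hE ht hb, hY.top_right hE ht hb, hY.top_right hE ht hb]
        ring
      rw [map_sub, hb.mul_right, hc, hb.mul_right, hY.corrected_col hE ht hb,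
        hY.corrected_row hE ht hb, map_sub, LinearMap.sub_apply, hY.ne hjl hmi, hb.mul_left,
        hb.mul_left, hY.inv_left hE ht hb, hY.ne hjl (ht.row_ne hE h1.1).symm, hY.ne hjk hmi,
        hY.row_col hE ht hjl, hY.col_row hE ht hmi, hY.ne hjl hmk,
        hY.ne (ht.row_ne hE h2.1).symm hmi]
      ring

theorem reduced (hE : IsClosedRel E M) (ht : IsTop E k t) (hb : IsPoissonBracket br)
    (hY : IsMatrixUnits br E Y) (hz : Y k t ≠ 0) :
    IsMatrixUnits br (stepRel E k t) (reduced E k t Y) where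
  zero h := reduced_zero h
  comp h1 h2 := hY.reduced_comp hE ht hb hz h1 h2
  ne h1 h2 := hY.reduced_ne hE ht hb hz h1 h2

/-- The reduced generators commute with the column members of the removed pairs. -/
theorem reduced_col (hE : IsClosedRel E M) (ht : IsTop E k t) (hb : IsPoissonBracket br)
    (hY : IsMatrixUnits br E Y) (hz : Y k t ≠ 0) {a : ι} (h1 : E k a) (h2 : E a t) (i j : ι) :
    br (UTFactor.reduced E k t Y i j) (Y a t) = 0 := by
  by_cases h : stepRel E k t i j
  swap
  · rw [reduced_zero h, map_zero, LinearMap.zero_apply]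
  by_cases hjk : j = k
  · subst hjk
    rw [reduced_sum h, hb.skew, hY.sum_col hE ht hb (hE.lt h.1), neg_zero]
  by_cases hp : k ≤ i ∨ j = t
  · rw [reduced_plain ht hY h hjk hp]
    by_cases hja : j = a
    · subst hja
      rw [hY.comp h.1 h2]
      rcases (hp.resolve_right (ht.row_ne hE h2)).eq_or_lt with rfl | hki
      · exact absurd ⟨rfl, h2⟩ h.2.2.1
      · exact hY.col_eq_zero ht hki
    · exact hY.ne hja (ht.row_ne hE h.1).symm
  · rw [not_or, not_le] at hp
    rw [reduced_corrected hE h hp.1 hp.2, hY.corrected_col hE ht hb]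
    by_cases hja : j = a
    · subst hja
      rw [hY.comp h.1 h2, hY.comp h1 h2]
      field_simp
      ring
    · rw [hY.ne hja (ht.row_ne hE h.1).symm, hY.row_col hE ht hja]
      ring

/-- The reduced generators commute with the row members of the removed pairs. -/
theorem reduced_row (hE : IsClosedRel E M) (ht : IsTop E k t) (hb : IsPoissonBracket br)
    (hY : IsMatrixUnits br E Y) (hz : Y k t ≠ 0) {a : ι} (h1 : E k a) (h2 : E a t) (i j : ι) :
    br (UTFactor.reduced E k t Y i j) (Y k a) = 0 := by
  have hak := hE.lt h1
  by_cases h : stepRel E k t i j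
  swap
  · rw [reduced_zero h, map_zero, LinearMap.zero_apply]
  by_cases hjk : j = k
  · subst hjk
    rw [reduced_sum h, hY.sum_row hE ht hb hz h.1 h1, hY.comp' hb h2 h1]
    field_simp
    ring
  by_cases hp : k ≤ i ∨ j = t
  · rw [reduced_plain ht hY h hjk hp]
    refine hY.ne hjk ?_
    rintro rfl
    rcases hp with hp | rfl
    · exact hp.not_gt hak
    · exact h.2.2.2 ⟨rfl, h1⟩
  · rw [not_or, not_le] at hp
    rw [reduced_corrected hE h hp.1 hp.2, hY.corrected_row hE ht hb]
    by_cases hai : a = i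
    · subst hai
      rw [hY.comp' hb h.1 h1, hY.comp' hb h2 h1]
      field_simp
      ring
    · rw [hY.ne hjk hai, hY.col_row hE ht hai]
      ring

/-- The removed places of the pivot row and of the pivot column form canonical pairs. -/
theorem canonicalPairs (hE : IsClosedRel E M) (ht : IsTop E k t) (hb : IsPoissonBracket br)
    (hY : IsMatrixUnits br E Y) (hz : Y k t ≠ 0) :
    IsCanonicalPairs br (fun a : {a // E k a ∧ E a t} => Y k a)
      (fun a : {a // E k a ∧ E a t} => (Y k t)⁻¹ * Y a t) where
  pp a b := hY.row_row hE a.1 b.1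
  qq a b := by
    rw [hb.mul_right, hb.mul_left, hb.mul_left, hY.col_col hE ht, hY.inv_left hE ht hb,
      hY.inv_inv hE ht hb, hY.inv_right hE ht hb]
    ring
  pq_self a := by
    rw [hb.mul_right, hY.inv_right hE ht hb, hY.comp a.2.1 a.2.2, inv_mul_cancel₀ hz]
    ring
  pq_ne a b hab := by
    rw [hb.mul_right, hY.inv_right hE ht hb, hY.row_col hE ht fun e => hab (Subtype.ext e)]
    ring

/-! ### Generation by the reduced family -/

variable {A : Subalgebra K F}

theorem reduced_mem (hY : ∀ i j, Y i j ∈ A) (hz : (Y k t)⁻¹ ∈ A) (i j : ι) :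
    UTFactor.reduced E k t Y i j ∈ A := by
  rw [UTFactor.reduced]
  split_ifs
  · exact mul_mem hz (sum_mem fun a _ => mul_mem (hY i a) (hY a t))
  · exact hY i j
  · exact sub_mem (hY i j) (mul_mem hz (mul_mem (hY i t) (hY k j)))
  · exact zero_mem A

/-- The difference of a reduced generator and the original one only involves greater places. -/
theorem reduced_sub_mem (hE : IsClosedRel E M) (ht : IsTop E k t)
    (hY : IsMatrixUnits br E Y) (hz0 : Y k t ≠ 0) {i j : ι} (h : stepRel E k t i j)
    (hA : ∀ l m, E l m → m < j ∨ (m = j ∧ i < l) → Y l m ∈ A) (hz : (Y k t)⁻¹ ∈ A) :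
    UTFactor.reduced E k t Y i j - Y i j ∈ A := by
  have hji := hE.lt h.1
  have hmem : ∀ l m, m < j ∨ (m = j ∧ i < l) → Y l m ∈ A := by
    intro l m hlm
    by_cases h1 : E l m
    · exact hA l m h1 hlm
    · rw [hY.zero h1]; exact zero_mem A
  by_cases hjk : j = k
  · subst hjk
    rw [reduced_sum h, ← Finset.add_sum_erase _ _ (Finset.mem_univ j), mul_add,
      mul_comm (Y i j), inv_mul_cancel_left₀ hz0, add_sub_cancel_left]
    refine mul_mem hz (sum_mem fun a ha => ?_)
    by_cases h1 : E a t
    · have haj := lt_of_le_of_ne (ht.le_row h1) (Finset.ne_of_mem_erase ha)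
      exact mul_mem (hmem _ _ (Or.inl haj)) (hmem _ _ (Or.inl (ht.lt hE)))
    · rw [hY.zero h1, mul_zero]; exact zero_mem A
  by_cases hp : k ≤ i ∨ j = t
  · rw [reduced_plain ht hY h hjk hp, sub_self]; exact zero_mem A
  · rw [not_or, not_le] at hp
    rw [reduced_corrected hE h hp.1 hp.2, sub_sub_cancel_left]
    exact neg_mem (mul_mem hz (mul_mem (hmem _ _ (Or.inl (lt_of_le_of_ne (ht.col_le h.1)
      (Ne.symm hp.2)))) (hmem _ _ (Or.inr ⟨rfl, hp.1⟩))))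

/-- The original generators are polynomials in the reduced ones, the removed ones, and the inverse of
the pivot. -/
theorem mem_of_reduced (hE : IsClosedRel E M) (ht : IsTop E k t)
    (hY : IsMatrixUnits br E Y) (hz0 : Y k t ≠ 0) (hz : Y k t ∈ A) (hz' : (Y k t)⁻¹ ∈ A)
    (hrow : ∀ a, E k a → E a t → Y k a ∈ A) (hcol : ∀ a, E k a → E a t → Y a t ∈ A)
    (hW : ∀ i j, UTFactor.reduced E k t Y i j ∈ A) (i j : ι) : Y i j ∈ A := by
  have hc : ∀ a, Y a t ∈ A := by
    intro a
    by_cases h : E a t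
    swap
    · rw [hY.zero h]; exact zero_mem A
    by_cases hk : a = k
    · rw [hk]; exact hz
    by_cases hka : E k a
    · exact hcol a hka h
    · have hs : stepRel E k t a t := ⟨h, fun e => hk e.1, fun e => hk e.1, fun e => hka e.2⟩
      rw [← reduced_plain ht hY hs (ht.lt hE).ne (Or.inr rfl)]
      exact hW a t
  have hr : ∀ a, Y k a ∈ A := by
    intro a
    by_cases h : E k a
    swap
    · rw [hY.zero h]; exact zero_mem A
    by_cases hk : a = t
    · rw [hk]; exact hz
    by_cases hat : E a t
    · exact hrow a h hat
    · have hs : stepRel E k t k a := ⟨h, fun e => hk e.2, fun e => hat e.2, fun e => hk e.1⟩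
      rw [← reduced_plain ht hY hs (hE.lt h).ne (Or.inl le_rfl)]
      exact hW k a
  have hg : ∀ i j, j ≠ k → Y i j ∈ A := by
    intro i j hjk
    by_cases hjt : j = t
    · rw [hjt]; exact hc i
    by_cases hik : i = k
    · rw [hik]; exact hr j
    by_cases h : E i j
    swap
    · rw [hY.zero h]; exact zero_mem A
    have hs : stepRel E k t i j := ⟨h, fun e => hik e.1, fun e => hik e.1, fun e => hjt e.1⟩
    have h1 := hW i j
    rw [UTFactor.reduced, if_pos hs, if_neg hjk, if_neg (not_or.mpr ⟨hik, hjt⟩)] at h1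
    rw [← sub_add_cancel (Y i j) ((Y k t)⁻¹ * (Y i t * Y k j))]
    exact add_mem h1 (mul_mem hz' (mul_mem (hc i) (hr j)))
  by_cases hjk : j = k
  swap
  · exact hg i j hjk
  subst hjk
  by_cases h : E i j
  swap
  · rw [hY.zero h]; exact zero_mem A
  have hji := hE.lt h
  have hs : stepRel E j t i j := ⟨h, fun e => hji.ne' e.1, fun e => hji.ne' e.1,
    fun e => (ht.lt hE).ne' e.1⟩
  have h1 := hW i j
  rw [reduced_sum hs, ← Finset.add_sum_erase _ _ (Finset.mem_univ j), mul_add,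
    mul_comm (Y i j), inv_mul_cancel_left₀ hz0] at h1
  rw [← add_sub_cancel_right (Y i j) ((Y j t)⁻¹ * ∑ a ∈ Finset.univ.erase j, Y i a * Y a t)]
  exact sub_mem h1 (mul_mem hz' (sum_mem fun a ha =>
    mul_mem (hg i a (Finset.ne_of_mem_erase ha)) (hc a)))

end IsMatrixUnits

end Reduction

/-! ### The Poisson bracket of a localization of a symmetric algebra -/

section LiePoisson

variable {K : Type*} [Field K] {𝔤 : Type*} [LieRing 𝔤] [LieAlgebra K 𝔤]
variable {B : Type*} [CommRing B] [Algebra K B] [Algebra (SymmetricAlgebra K 𝔤) B]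
  [IsScalarTower K (SymmetricAlgebra K 𝔤) B]

/-- Two derivations along an algebra homomorphism from a localization of a symmetric algebra agree if
they agree on the generators. -/
theorem leibniz_ext {V : Type*} [AddCommGroup V] [Module K V]
    [Algebra (SymmetricAlgebra K V) B] [IsScalarTower K (SymmetricAlgebra K V) B]
    (Z : Submonoid (SymmetricAlgebra K V)) [IsLocalization Z B]
    {C : Type*} [CommRing C] [Algebra K C] (j : B →ₐ[K] C) {f g : B →ₗ[K] C}
    (hf : ∀ a b, f (a * b) = j a * f b + j b * f a)
    (hg : ∀ a b, g (a * b) = j a * g b + j b * g a)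
    (h : ∀ v, f (algebraMap _ B (SymmetricAlgebra.ι K V v)) =
      g (algebraMap _ B (SymmetricAlgebra.ι K V v))) : f = g := by
  have hone : ∀ {f : B →ₗ[K] C}, (∀ a b, f (a * b) = j a * f b + j b * f a) → f 1 = 0 := by
    intro f hf
    simpa using hf 1 1
  have hS : ∀ F : SymmetricAlgebra K V, f (algebraMap _ B F) = g (algebraMap _ B F) := by
    intro F
    induction F using SymmetricAlgebra.induction with
    | algebraMap c =>
      rw [← IsScalarTower.algebraMap_apply, Algebra.algebraMap_eq_smul_one, map_smul, map_smul,
        hone hf, hone hg]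
    | ι v => exact h v
    | mul a b ha hb => rw [map_mul, hf, hg, ha, hb]
    | add a b ha hb => rw [map_add, map_add, map_add, ha, hb]
  ext b
  obtain ⟨F, t, hb⟩ := IsLocalization.exists_mk'_eq Z b
  have hFb : b * algebraMap _ B (t : SymmetricAlgebra K V) = algebraMap _ B F := by
    rw [← hb, IsLocalization.mk'_spec]
  have hu : IsUnit (j (algebraMap (SymmetricAlgebra K V) B t)) :=
    (IsLocalization.map_units B t).map j
  have h1 := hS F
  rw [← hFb, hf, hg, hS t] at h1
  exact hu.mul_left_cancel (add_left_cancel h1)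

theorem liePoisson_isPoissonBracket (Z : Submonoid (SymmetricAlgebra K 𝔤)) [IsLocalization Z B] :
    IsPoissonBracket (liePoisson B Z) := by
  refine ⟨?_, liePoisson_mul_right B Z⟩
  have h1 : ∀ (x : 𝔤) (a : B), liePoisson B Z a (algebraMap _ B (SymmetricAlgebra.ι K 𝔤 x)) =
      -liePoisson B Z (algebraMap _ B (SymmetricAlgebra.ι K 𝔤 x)) a := by
    intro x a
    have := leibniz_ext Z (AlgHom.id K B)
      (f := (liePoisson B Z).flip (algebraMap _ B (SymmetricAlgebra.ι K 𝔤 x)))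
      (g := -liePoisson B Z (algebraMap _ B (SymmetricAlgebra.ι K 𝔤 x)))
      (fun a b => liePoisson_mul_left B Z a b _)
      (fun a b => by simp [liePoisson_mul_right, add_comm])
      (fun v => by
        rw [LinearMap.flip_apply, liePoisson_ι, LinearMap.neg_apply, liePoisson_ι, ← lie_skew,
          map_neg, map_neg])
    exact DFunLike.congr_fun this a
  intro a b
  have := leibniz_ext Z (AlgHom.id K B) (f := liePoisson B Z a)
      (g := -(liePoisson B Z).flip a)
      (fun b c => liePoisson_mul_right B Z a b c)
      (fun b c => by simp [liePoisson_mul_left, add_comm])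
      (fun v => by simp [h1])
  exact DFunLike.congr_fun this b

/-- A homomorphism between two localizations of the symmetric algebra that is the identity on the
symmetric algebra respects the Poisson brackets. -/
theorem liePoisson_map (Z Z' : Submonoid (SymmetricAlgebra K 𝔤)) [IsLocalization Z B]
    {C : Type*} [CommRing C] [Algebra K C] [Algebra (SymmetricAlgebra K 𝔤) C]
    [IsScalarTower K (SymmetricAlgebra K 𝔤) C] [IsLocalization Z' C] (j : B →ₐ[K] C)
    (hj : ∀ F, j (algebraMap (SymmetricAlgebra K 𝔤) B F) = algebraMap _ C F) (a b : B) :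
    j (liePoisson B Z a b) = liePoisson C Z' (j a) (j b) := by
  have hB := liePoisson_isPoissonBracket (B := B) Z
  have hC := liePoisson_isPoissonBracket (B := C) Z'
  have h1 : ∀ (x : 𝔤) (a : B), j (liePoisson B Z a (algebraMap _ B (SymmetricAlgebra.ι K 𝔤 x))) =
      liePoisson C Z' (j a) (algebraMap _ C (SymmetricAlgebra.ι K 𝔤 x)) := by
    intro x a
    have := leibniz_ext Z j
      (f := j.toLinearMap ∘ₗ (liePoisson B Z).flip (algebraMap _ B (SymmetricAlgebra.ι K 𝔤 x)))
      (g := (liePoisson C Z').flip (algebraMap _ C (SymmetricAlgebra.ι K 𝔤 x)) ∘ₗ j.toLinearMap)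
      (fun a b => by simp [hB.mul_left]) (fun a b => by simp [hC.mul_left])
      (fun v => by simp [liePoisson_ι, hj])
    exact DFunLike.congr_fun this a
  have := leibniz_ext Z j (f := j.toLinearMap ∘ₗ liePoisson B Z a)
      (g := liePoisson C Z' (j a) ∘ₗ j.toLinearMap)
      (fun a b => by simp [hB.mul_right]) (fun a b => by simp [hC.mul_right])
      (fun v => by simp [h1, hj])
  exact DFunLike.congr_fun this b

end LiePoisson

section Coordinates

attribute [local instance 100] LieRing.ofAssociativeRing

/-! ### Coordinates on the factor algebra -/

variable {K : Type*} [Field K] {n : ℕ}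

theorem rootVec_apply (ξ : Root n) (i j : Fin n) :
    (rootVec K ξ : Matrix (Fin n) (Fin n) K) i j = if ξ.row = i ∧ ξ.col = j then 1 else 0 :=
  Matrix.single_apply ..

theorem linearIndependent_rootVec : LinearIndependent K (rootVec K (n := n)) := by
  classical
  rw [Fintype.linearIndependent_iff]
  intro g hg ξ
  have h := congrFun (congrFun (congrArg Subtype.val hg) ξ.row) ξ.col
  rw [AddSubmonoidClass.coe_finsetSum, Matrix.sum_apply, Finset.sum_eq_single ξ] at h
  · simpa [rootVec_apply] using h
  · intro η _ hne
    change (g η • (rootVec K η : Matrix (Fin n) (Fin n) K)) _ _ = 0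
    rw [Matrix.smul_apply, rootVec_apply, if_neg, smul_zero]
    rintro ⟨h1, h2⟩
    exact hne (Root.ext h1 h2)
  · intro h; exact absurd (Finset.mem_univ ξ) h

theorem span_rootVec : Submodule.span K (Set.range (rootVec K (n := n))) = ⊤ := by
  rw [eq_top_iff]
  rintro x -
  have h := mem_span_rootVec x.2
  have e : (Set.range fun ξ : Root n => (rootVec K ξ : Matrix (Fin n) (Fin n) K)) =
      (ut K n).toSubmodule.subtype '' Set.range (rootVec K) := by
    rw [← Set.range_comp]; rfl
  rw [e, ← Submodule.map_span] at h
  obtain ⟨y, hy, hyx⟩ := h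
  have : y = x := Subtype.ext hyx
  exact this ▸ hy

theorem lie_rootVec (i j m : Fin n) (h1 : j < i) (h2 : m < j) :
    ⁅rootVec K (⟨i, j, h1⟩ : Root n), rootVec K (⟨j, m, h2⟩ : Root n)⁆ =
      rootVec K ⟨i, m, h2.trans h1⟩ := by
  apply Subtype.ext
  rw [LieSubalgebra.coe_bracket, Ring.lie_def]
  change Matrix.single i j (1 : K) * Matrix.single j m 1 -
    Matrix.single j m 1 * Matrix.single i j 1 = Matrix.single i m 1
  rw [Matrix.single_mul_single_same, Matrix.single_mul_single_of_ne _ _ _ _ (h2.trans h1).ne,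
    sub_zero, mul_one]

theorem lie_rootVec_of_ne {ξ η : Root n} (h1 : ξ.col ≠ η.row) (h2 : η.col ≠ ξ.row) :
    ⁅rootVec K ξ, rootVec K η⁆ = 0 := by
  apply Subtype.ext
  rw [LieSubalgebra.coe_bracket, Ring.lie_def]
  change Matrix.single ξ.row ξ.col (1 : K) * Matrix.single η.row η.col 1 -
    Matrix.single η.row η.col 1 * Matrix.single ξ.row ξ.col 1 = 0
  rw [Matrix.single_mul_single_of_ne _ _ _ _ h1, Matrix.single_mul_single_of_ne _ _ _ _ h2,
    sub_zero]

namespace RootIdeal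

variable (𝔪 : RootIdeal K n)

theorem rootVec_mem_iff {ξ : Root n} : rootVec K ξ ∈ 𝔪.ideal ↔ ξ ∈ 𝔪.M := by
  rw [← LieSubmodule.mem_toSubmodule, 𝔪.span_eq]
  constructor
  · intro h
    by_contra hξ
    exact linearIndependent_rootVec.notMem_span_image (s := (𝔪.M : Set (Root n))) hξ h
  · exact fun h => Submodule.subset_span ⟨ξ, h, rfl⟩

theorem y_eq_zero_iff {ξ : Root n} : 𝔪.y ξ = 0 ↔ ξ ∈ 𝔪.M := by
  rw [← 𝔪.rootVec_mem_iff]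
  exact Submodule.Quotient.mk_eq_zero _

theorem linearIndependent_y : LinearIndependent K fun ξ : {ξ // ξ ∉ 𝔪.M} => 𝔪.y ξ := by
  have h : LinearIndependent K fun ξ : {ξ : Root n // ξ ∉ 𝔪.M} => rootVec K ξ.1 :=
    linearIndependent_rootVec.comp _ Subtype.val_injective
  have := h.map (f := 𝔪.ideal.toSubmodule.mkQ) (by
    rw [Submodule.ker_mkQ, 𝔪.span_eq]
    have h2 := (linearIndependent_rootVec (K := K) (n := n)).disjoint_span_image
      (s := {ξ | ξ ∉ 𝔪.M}) (t := (𝔪.M : Set (Root n)))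
      (Set.disjoint_left.mpr fun ξ h1 h2 => h1 h2)
    have e : (Set.range fun ξ : {ξ : Root n // ξ ∉ 𝔪.M} => rootVec K ξ.1) =
        rootVec K '' {ξ | ξ ∉ 𝔪.M} := by
      rw [Set.image_eq_range]; rfl
    rw [e]
    exact h2)
  exact this

/-- The basis of `ℒ` formed by the `y_ξ` with `ξ` outside `M`. -/
def basis : Module.Basis {ξ // ξ ∉ 𝔪.M} K 𝔪.factor :=
  Module.Basis.mk 𝔪.linearIndependent_y (by
    rintro x -
    obtain ⟨x, rfl⟩ := Submodule.Quotient.mk_surjective _ x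
    have hx : x ∈ Submodule.span K (Set.range (rootVec K (n := n))) := by
      rw [span_rootVec]; trivial
    induction hx using Submodule.span_induction with
    | mem x hx =>
      obtain ⟨ξ, rfl⟩ := hx
      by_cases h : ξ ∈ 𝔪.M
      · have := 𝔪.y_eq_zero_iff.mpr h
        change 𝔪.y ξ ∈ _
        rw [this]
        exact zero_mem _
      · exact Submodule.subset_span ⟨⟨ξ, h⟩, rfl⟩
    | zero => exact zero_mem _
    | add x y _ _ hx hy => exact add_mem hx hy
    | smul c x _ hx => exact Submodule.smul_mem _ c hx)

theorem basis_apply (ξ : {ξ // ξ ∉ 𝔪.M}) : 𝔪.basis ξ = 𝔪.y ξ := by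
  rw [basis, Module.Basis.mk_apply]

/-- The identification of `K[ℒ*]` with a polynomial ring. -/
def regEquiv : 𝔪.Reg ≃ₐ[K] MvPolynomial {ξ // ξ ∉ 𝔪.M} K :=
  SymmetricAlgebra.equivMvPolynomial 𝔪.basis

theorem regEquiv_coord (ξ : {ξ // ξ ∉ 𝔪.M}) : 𝔪.regEquiv (𝔪.coord ξ) = MvPolynomial.X ξ := by
  rw [coord, ← basis_apply]
  exact SymmetricAlgebra.equivMvPolynomial_ι_apply _ _

theorem coord_eq_zero {ξ : Root n} (h : ξ ∈ 𝔪.M) : 𝔪.coord ξ = 0 := by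
  rw [coord, 𝔪.y_eq_zero_iff.mpr h, map_zero]

theorem adjoin_coord : Algebra.adjoin K (Set.range 𝔪.coord) = ⊤ := by
  rw [eq_top_iff]
  rintro x -
  rw [← 𝔪.regEquiv.symm_apply_apply x]
  induction 𝔪.regEquiv x using MvPolynomial.induction_on with
  | C a => exact (AlgEquiv.commutes 𝔪.regEquiv.symm a) ▸ Subalgebra.algebraMap_mem _ a
  | add p q hp hq => rw [map_add]; exact add_mem hp hq
  | mul_X p ξ hp =>
    rw [map_mul, ← regEquiv_coord, AlgEquiv.symm_apply_apply]
    exact mul_mem hp (Algebra.subset_adjoin ⟨ξ, rfl⟩)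

theorem mem_M_of_le {ξ η : Root n} (h : ξ ∈ 𝔪.M) (hr : ξ.row ≤ η.row) (hc : η.col ≤ ξ.col) :
    η ∈ 𝔪.M := by
  have h1 : ∀ {i j l : Fin n} (hji : j < i) (hil : i ≤ l), (⟨i, j, hji⟩ : Root n) ∈ 𝔪.M →
      (⟨l, j, hji.trans_le hil⟩ : Root n) ∈ 𝔪.M := by
    intro i j l hji hil h
    rcases hil.eq_or_lt with rfl | hil
    · exact h
    rw [← rootVec_mem_iff, ← lie_rootVec l i j hil hji]
    exact lie_mem_right K (ut K n) 𝔪.ideal _ _ (𝔪.rootVec_mem_iff.mpr h)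
  have h2 : ∀ {i j l : Fin n} (hji : j < i) (hlj : l ≤ j), (⟨i, j, hji⟩ : Root n) ∈ 𝔪.M →
      (⟨i, l, hlj.trans_lt hji⟩ : Root n) ∈ 𝔪.M := by
    intro i j l hji hlj h
    rcases hlj.eq_or_lt with rfl | hlj
    · exact h
    rw [← rootVec_mem_iff, ← lie_rootVec i j l hji hlj]
    exact lie_mem_left K (ut K n) 𝔪.ideal _ _ (𝔪.rootVec_mem_iff.mpr h)
  exact h2 _ hc (h1 ξ.lt hr h)

/-- The Poisson bracket of the field of rational functions. -/
def bracket : 𝔪.RatFun →ₗ[K] 𝔪.RatFun →ₗ[K] 𝔪.RatFun :=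
  liePoisson 𝔪.RatFun (nonZeroDivisors 𝔪.Reg)

theorem bracket_isPoissonBracket : IsPoissonBracket 𝔪.bracket :=
  liePoisson_isPoissonBracket _

/-- The coordinate `y_ξ` as a rational function. -/
def ratCoord (ξ : Root n) : 𝔪.RatFun := algebraMap 𝔪.Reg 𝔪.RatFun (𝔪.coord ξ)

theorem bracket_ι (x y : 𝔪.factor) :
    𝔪.bracket (algebraMap _ _ (SymmetricAlgebra.ι K 𝔪.factor x))
      (algebraMap _ _ (SymmetricAlgebra.ι K 𝔪.factor y)) =
      algebraMap _ _ (SymmetricAlgebra.ι K 𝔪.factor ⁅x, y⁆) :=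
  liePoisson_ι _ _ x y

theorem bracket_ratCoord (ξ η : Root n) : 𝔪.bracket (𝔪.ratCoord ξ) (𝔪.ratCoord η) =
    algebraMap _ _ (SymmetricAlgebra.ι K 𝔪.factor ⁅𝔪.y ξ, 𝔪.y η⁆) :=
  𝔪.bracket_ι _ _

theorem lie_y (ξ η : Root n) : ⁅𝔪.y ξ, 𝔪.y η⁆ =
    LieSubmodule.Quotient.mk (N := 𝔪.ideal) ⁅rootVec K ξ, rootVec K η⁆ := rfl

theorem isTranscendenceBasis_ratCoord :
    IsTranscendenceBasis K fun ξ : {ξ // ξ ∉ 𝔪.M} => 𝔪.ratCoord ξ := by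
  have h := (IsTranscendenceBasis.mvPolynomial {ξ // ξ ∉ 𝔪.M} K)
  have h2 : IsTranscendenceBasis K fun ξ : {ξ // ξ ∉ 𝔪.M} => 𝔪.coord ξ := by
    have := 𝔪.regEquiv.symm.isTranscendenceBasis h
    convert this using 1
    ext ξ
    simp [← regEquiv_coord]
  have : Algebra.IsAlgebraic 𝔪.Reg 𝔪.RatFun :=
    (IsFractionRing.comap_isAlgebraic_iff (K := 𝔪.RatFun)).mpr inferInstance
  exact h2.algebraMap_comp (A := 𝔪.RatFun)

/-- The number of places outside `M` is the transcendence degree of `K(ℒ*)`. -/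
theorem trdeg_ratFun :
    Algebra.trdeg K 𝔪.RatFun = (Fintype.card {ξ // ξ ∉ 𝔪.M} : Cardinal) := by
  have := 𝔪.isTranscendenceBasis_ratCoord.lift_cardinalMk_eq_trdeg
  simpa using this.symm

end RootIdeal
end Coordinates

/-! ### The empty places of a diagram -/

namespace Diagram

variable {n : ℕ}

/-- The empty places of a diagram as a relation between rows and columns. -/
def rel (D : Diagram n) (i j : Fin n) : Prop := ∃ h : j < i, D ⟨i, j, h⟩ = none

theorem rel_root {D : Diagram n} {ξ : Root n} : D.rel ξ.row ξ.col ↔ D ξ = none :=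
  ⟨fun h => h.2, fun h => ⟨ξ.lt, h⟩⟩

theorem next_mem {D : Diagram n} {ξ : Root n} (h : D.next = some ξ) : D ξ = none := by
  rw [next] at h
  split_ifs at h with h1
  rw [Option.some_inj] at h
  have := D.empties.max'_mem h1
  rw [h, empties, Finset.mem_filter] at this
  exact this.2

theorem le_next {D : Diagram n} {ξ η : Root n} (h : D.next = some ξ) (hη : D η = none) :
    η ≤ ξ := by
  rw [next] at h
  split_ifs at h with h1
  rw [Option.some_inj] at h
  rw [← h]
  exact D.empties.le_max' η (Finset.mem_filter.mpr ⟨Finset.mem_univ _, hη⟩)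

theorem next_eq_none {D : Diagram n} : D.next = none ↔ ∀ ξ, D ξ ≠ none := by
  rw [next]
  split_ifs with h
  · obtain ⟨ξ, hξ⟩ := h
    simp only [false_iff, not_forall]
    exact ⟨ξ, fun h => h (Finset.mem_filter.mp hξ).2⟩
  · simp only [true_iff]
    intro ξ hξ
    exact h ⟨ξ, Finset.mem_filter.mpr ⟨Finset.mem_univ _, hξ⟩⟩

theorem isTop_next {D : Diagram n} {ξ : Root n} (h : D.next = some ξ) :
    IsTop D.rel ξ.row ξ.col where
  mem := rel_root.mpr (next_mem h)
  col_le := by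
    rintro i j ⟨hji, hD⟩
    have := le_next h hD
    rcases this.eq_or_lt with h1 | h1
    · rw [← h1]
    · rcases (Root.lt_iff _ _).mp h1 with h2 | h2
      · exact h2.le
      · exact h2.1.le
  le_row := by
    rintro i ⟨hji, hD⟩
    have := le_next h hD
    rcases this.eq_or_lt with h1 | h1
    · rw [← h1]
    · rcases (Root.lt_iff _ _).mp h1 with h2 | h2
      · exact absurd h2 (lt_irrefl _)
      · exact h2.2.le

theorem fill_eq_none {D : Diagram n} {ξ η : Root n} :
    D.fill ξ η = none ↔ stepRel D.rel ξ.row ξ.col η.row η.col := by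
  have e1 : (∃ ζ : Root n, ζ.row = η.col ∧ ζ.col = ξ.col ∧ D ζ = none) ↔
      D.rel η.col ξ.col := by
    constructor
    · rintro ⟨ζ, h1, h2, h3⟩
      rw [← h1, ← h2]; exact rel_root.mpr h3
    · rintro ⟨h, h3⟩
      exact ⟨⟨η.col, ξ.col, h⟩, rfl, rfl, h3⟩
  have e2 : (∃ ζ : Root n, ζ.row = ξ.row ∧ ζ.col = η.row ∧ D ζ = none) ↔
      D.rel ξ.row η.row := by
    constructor
    · rintro ⟨ζ, h1, h2, h3⟩
      rw [← h1, ← h2]; exact rel_root.mpr h3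
    · rintro ⟨h, h3⟩
      exact ⟨⟨ξ.row, η.row, h⟩, rfl, rfl, h3⟩
  rw [fill, stepRel, ← e1, ← e2, rel_root, ← Root.ext_iff]
  split_ifs <;> simp_all

theorem rel_fill {D : Diagram n} {ξ : Root n} :
    (D.fill ξ).rel = stepRel D.rel ξ.row ξ.col := by
  ext i j
  constructor
  · rintro ⟨h, h1⟩
    exact fill_eq_none.mp h1
  · intro h
    obtain ⟨hji, h2⟩ := h.1
    exact ⟨hji, fill_eq_none.mpr h⟩

/-- The indices `a` that give a pair `−`, `+` in the step with `⊗` on `ξ`. -/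
abbrev Pairs (D : Diagram n) (ξ : Root n) : Type :=
  {a : Fin n // D.rel ξ.row a ∧ D.rel a ξ.col}

instance (D : Diagram n) (ξ : Root n) : Fintype (D.Pairs ξ) := Fintype.ofFinite _

theorem card_fill_le {D : Diagram n} {ξ : Root n} (hξ : D ξ = none) :
    1 + 2 * Fintype.card (D.Pairs ξ) + (D.fill ξ).empties.card ≤ D.empties.card := by
  classical
  let g : (Unit ⊕ D.Pairs ξ ⊕ D.Pairs ξ) ⊕ {η // η ∈ (D.fill ξ).empties} → {η // η ∈ D.empties} :=
    Sum.elim (Sum.elim (fun _ => ⟨ξ, by simp [empties, hξ]⟩) (Sum.elim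
      (fun a => ⟨⟨ξ.row, a, a.2.1.1⟩, by simpa [empties] using a.2.1.2⟩)
      (fun a => ⟨⟨a, ξ.col, a.2.2.1⟩, by simpa [empties] using a.2.2.2⟩)))
      (fun η => ⟨η.1, by
        have h := η.2
        simp only [empties, Finset.mem_filter, Finset.mem_univ, true_and] at h ⊢
        exact rel_root.mp (fill_eq_none.mp h).1⟩)
  have hg : Function.Injective g := by
    have hf : ∀ η : {η // η ∈ (D.fill ξ).empties}, stepRel D.rel ξ.row ξ.col η.1.row η.1.col :=
      fun η => fill_eq_none.mp (Finset.mem_filter.mp η.2).2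
    rintro ((x | (a | a)) | η) ((x' | (a' | a')) | η') h
    all_goals
      have h1 := congrArg (fun x => x.1.row) h
      have h2 := congrArg (fun x => x.1.col) h
      simp only [g, Sum.elim_inl, Sum.elim_inr] at h1 h2
    · rfl
    · exact absurd h2 a'.2.2.1.ne
    · exact absurd h1 a'.2.1.1.ne'
    · exact absurd ⟨h1.symm, h2.symm⟩ (hf η').2.1
    · exact absurd h2 a.2.2.1.ne'
    · rw [Subtype.ext h2]
    · exact absurd h1 a'.2.1.1.ne'
    · exact absurd ⟨h1.symm, h2 ▸ a.2.2⟩ (hf η').2.2.1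
    · exact absurd h1 a.2.1.1.ne
    · exact absurd h1 a.2.1.1.ne
    · rw [Subtype.ext h1]
    · exact absurd ⟨h2.symm, h1 ▸ a.2.1⟩ (hf η').2.2.2
    · exact absurd ⟨h1, h2⟩ (hf η).2.1
    · exact absurd ⟨h1, h2 ▸ a'.2.2⟩ (hf η).2.2.1
    · exact absurd ⟨h2, h1 ▸ a'.2.1⟩ (hf η).2.2.2
    · rw [Subtype.ext (Root.ext h1 h2)]
  have := Fintype.card_le_of_injective g hg
  simp only [Fintype.card_sum, Fintype.card_unit, Fintype.card_coe] at this
  omega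

end Diagram

namespace RootIdeal

variable {K : Type*} [Field K] {n : ℕ} (𝔪 : RootIdeal K n)

/-- The places of `M` as a relation between rows and columns. -/
def rel (i j : Fin n) : Prop := ∃ h : j < i, (⟨i, j, h⟩ : Root n) ∈ 𝔪.M

theorem zeroStep_eq_none {ξ : Root n} : Diagram.zeroStep 𝔪.M ξ = none ↔ ξ ∉ 𝔪.M := by
  simp [Diagram.zeroStep]

theorem zeroStep_closed : IsClosedRel (Diagram.zeroStep 𝔪.M).rel 𝔪.rel where
  lt h := h.1
  not_mem := by
    rintro i j ⟨h, h1⟩ ⟨_, h2⟩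
    exact 𝔪.zeroStep_eq_none.mp h1 h2
  ideal := by
    rintro i j i' j' ⟨h, h1⟩ hi hj
    exact ⟨hj.trans_lt (h.trans_le hi), 𝔪.mem_M_of_le h1 hi hj⟩
  trans := by
    rintro i j l ⟨h, h1⟩ ⟨h', h2⟩
    by_cases hM : (⟨i, l, h'.trans h⟩ : Root n) ∈ 𝔪.M
    · exact Or.inr ⟨_, hM⟩
    · exact Or.inl ⟨_, 𝔪.zeroStep_eq_none.mpr hM⟩
  cotrans := by
    rintro i j l ⟨h, h1⟩ hlj hji
    refine Or.inl ⟨hji, 𝔪.zeroStep_eq_none.mpr fun hM => 𝔪.zeroStep_eq_none.mp h1 ?_⟩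
    exact 𝔪.mem_M_of_le hM le_rfl hlj.le
  mixed := by
    rintro i j l - - hji
    by_cases hM : (⟨i, j, hji⟩ : Root n) ∈ 𝔪.M
    · exact Or.inr ⟨_, hM⟩
    · exact Or.inl ⟨_, 𝔪.zeroStep_eq_none.mpr hM⟩

open Classical in
/-- The coordinates `y_{ij}` as a matrix of rational functions, with zeros on and above the
diagonal. -/
def coordMatrix (i j : Fin n) : 𝔪.RatFun := if h : j < i then 𝔪.ratCoord ⟨i, j, h⟩ else 0

theorem coordMatrix_root (ξ : Root n) : 𝔪.coordMatrix ξ.row ξ.col = 𝔪.ratCoord ξ := by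
  rw [coordMatrix, dif_pos ξ.lt]

theorem coordMatrix_units :
    IsMatrixUnits 𝔪.bracket (Diagram.zeroStep 𝔪.M).rel 𝔪.coordMatrix where
  zero := by
    intro i j h
    rw [coordMatrix]
    split_ifs with hji
    · have hM : (⟨i, j, hji⟩ : Root n) ∈ 𝔪.M := by
        by_contra hM
        exact h ⟨hji, 𝔪.zeroStep_eq_none.mpr hM⟩
      rw [ratCoord, 𝔪.coord_eq_zero hM, map_zero]
    · rfl
  comp := by
    rintro i j m ⟨h1, -⟩ ⟨h2, -⟩
    rw [coordMatrix, coordMatrix, coordMatrix, dif_pos h1, dif_pos h2, dif_pos (h2.trans h1),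
      bracket_ratCoord, lie_y, lie_rootVec]
    rfl
  ne := by
    intro i j l m h1 h2
    rw [coordMatrix, coordMatrix]
    split_ifs
    · rw [bracket_ratCoord, lie_y, lie_rootVec_of_ne h1 h2]
      exact (congrArg _ (map_zero _)).trans (map_zero _)
    all_goals simp

/-- An element that Poisson commutes with all coordinates is central. -/
theorem central_of_coord {c : 𝔪.RatFun} (h : ∀ ξ, 𝔪.bracket c (𝔪.ratCoord ξ) = 0)
    (x : 𝔪.RatFun) : 𝔪.bracket c x = 0 := by
  have hb := 𝔪.bracket_isPoissonBracket
  have h1 : ∀ F : 𝔪.Reg, 𝔪.bracket c (algebraMap _ _ F) = 0 := by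
    intro F
    refine hb.adjoin_right (s := Set.range 𝔪.ratCoord) ?_ ?_
    · rintro _ ⟨ξ, rfl⟩; exact h ξ
    · have hF : F ∈ Algebra.adjoin K (Set.range 𝔪.coord) := by rw [adjoin_coord]; trivial
      have : IsScalarTower.toAlgHom K 𝔪.Reg 𝔪.RatFun F ∈ (Algebra.adjoin K
          (Set.range 𝔪.coord)).map (IsScalarTower.toAlgHom K 𝔪.Reg 𝔪.RatFun) := ⟨F, hF, rfl⟩
      rw [AlgHom.map_adjoin, ← Set.range_comp] at this
      exact this
  obtain ⟨a, b, -, rfl⟩ := IsFractionRing.div_surjective (A := 𝔪.Reg) x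
  rw [div_eq_mul_inv, hb.mul_right, h1, hb.inv_right (h1 b), mul_zero, mul_zero, add_zero]

end RootIdeal

namespace RootIdeal

/-! ### The inductive construction of the invariants -/

variable {K : Type*} [Field K] {n : ℕ} (𝔪 : RootIdeal K n)

/-- The inverses of `z_0, …, z_{i-1}`. -/
def invs (z : ℕ → 𝔪.Reg) (i : ℕ) : Set 𝔪.RatFun :=
  (fun j => (algebraMap 𝔪.Reg 𝔪.RatFun (z j))⁻¹) '' Set.Iio i

/-- The elements `z_j^{±1}`, `p_a`, `q_a` and `w_{ij}`. -/
def gens (z : ℕ → 𝔪.Reg) (i : ℕ) {ι : Type} (p q : ι → 𝔪.RatFun)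
    (w : Fin n → Fin n → 𝔪.RatFun) : Set 𝔪.RatFun :=
  (fun j => algebraMap 𝔪.Reg 𝔪.RatFun (z j)) '' Set.Iio i ∪ 𝔪.invs z i ∪ Set.range p ∪
    Set.range q ∪ Set.range fun ij : Fin n × Fin n => w ij.1 ij.2

/-- The data obtained after `i` steps: central elements `z_0, …, z_{i-1}`, canonical pairs
`(p_a, q_a)`, and a family `w` on the empty places that has the brackets of matrix units, commutes
with the `p_a` and `q_a`, and agrees with the coordinates up to greater places. Together they
generate the same algebra as the coordinates, once the `z_j` are inverted. -/
structure IsStage (D : Diagram n) (z : ℕ → 𝔪.Reg) (i : ℕ) {ι : Type} [Fintype ι]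
    (p q : ι → 𝔪.RatFun) (w : Fin n → Fin n → 𝔪.RatFun) : Prop where
  closed : IsClosedRel D.rel 𝔪.rel
  units : IsMatrixUnits 𝔪.bracket D.rel w
  ne_zero : ∀ j < i, z j ≠ 0
  central : ∀ j < i, ∀ x, 𝔪.bracket (algebraMap _ _ (z j)) x = 0
  pairs : IsCanonicalPairs 𝔪.bracket p q
  wp : ∀ a i j, 𝔪.bracket (w i j) (p a) = 0
  wq : ∀ a i j, 𝔪.bracket (w i j) (q a) = 0
  coord_mem : ∀ ξ, 𝔪.ratCoord ξ ∈ Algebra.adjoin K (𝔪.gens z i p q w)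
  p_mem : ∀ a, p a ∈ Algebra.adjoin K (Set.range 𝔪.ratCoord ∪ 𝔪.invs z i)
  q_mem : ∀ a, q a ∈ Algebra.adjoin K (Set.range 𝔪.ratCoord ∪ 𝔪.invs z i)
  w_mem : ∀ i' j', w i' j' ∈ Algebra.adjoin K (Set.range 𝔪.ratCoord ∪ 𝔪.invs z i)
  w_sub_mem : ∀ η, D η = none → w η.row η.col - 𝔪.ratCoord η ∈
    Algebra.adjoin K (𝔪.ratCoord '' Set.Ioi η ∪ 𝔪.invs z i)
  z_mem : ∀ j < i, ∀ η, D η = none → z j ∈ Algebra.adjoin K (𝔪.coord '' Set.Ioi η)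
  card_le : i + 2 * Fintype.card ι + D.empties.card ≤ Fintype.card {ξ // ξ ∉ 𝔪.M}

variable {𝔪}

theorem algebraMap_mem_adjoin {s : Set (Root n)} {P : 𝔪.Reg}
    (hP : P ∈ Algebra.adjoin K (𝔪.coord '' s)) :
    algebraMap 𝔪.Reg 𝔪.RatFun P ∈ Algebra.adjoin K (𝔪.ratCoord '' s) := by
  have : IsScalarTower.toAlgHom K 𝔪.Reg 𝔪.RatFun P ∈ (Algebra.adjoin K
      (𝔪.coord '' s)).map (IsScalarTower.toAlgHom K 𝔪.Reg 𝔪.RatFun) := ⟨P, hP, rfl⟩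
  rw [AlgHom.map_adjoin, ← Set.image_comp] at this
  exact this

/-- A polynomial in coordinates and inverses of the `z_j` becomes a polynomial in the coordinates after
multiplication by a monomial in the `z_j`. -/
theorem clear_denominators {s : Set (Root n)} {z : ℕ → 𝔪.Reg} {i : ℕ}
    (hz : ∀ j < i, z j ∈ Algebra.adjoin K (𝔪.coord '' s)) (hz0 : ∀ j < i, z j ≠ 0)
    {R : 𝔪.RatFun} (hR : R ∈ Algebra.adjoin K (𝔪.ratCoord '' s ∪ 𝔪.invs z i)) :
    ∃ e : ℕ → ℕ, ∃ P ∈ Algebra.adjoin K (𝔪.coord '' s),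
      R * algebraMap _ _ (∏ j ∈ Finset.range i, z j ^ e j) = algebraMap 𝔪.Reg 𝔪.RatFun P := by
  have hQ : ∀ e : ℕ → ℕ, ∏ j ∈ Finset.range i, z j ^ e j ∈ Algebra.adjoin K (𝔪.coord '' s) :=
    fun e => prod_mem fun j hj => pow_mem (hz j (Finset.mem_range.mp hj)) _
  induction hR using Algebra.adjoin_induction with
  | mem x hx =>
    rcases hx with ⟨η, hη, rfl⟩ | ⟨j, hj, rfl⟩
    · exact ⟨0, 𝔪.coord η, Algebra.subset_adjoin ⟨η, hη, rfl⟩, by simp [ratCoord]⟩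
    · refine ⟨fun l => if l = j then 1 else 0, 1, one_mem _, ?_⟩
      have : ∏ l ∈ Finset.range i, z l ^ (if l = j then 1 else 0) = z j := by
        rw [Finset.prod_eq_single j]
        · simp
        · intro l _ hl; simp [hl]
        · intro h; exact absurd (Finset.mem_range.mpr hj) h
      rw [this, map_one]
      refine inv_mul_cancel₀ fun h0 => hz0 j hj ?_
      exact IsFractionRing.injective 𝔪.Reg 𝔪.RatFun (h0.trans (map_zero _).symm)
  | algebraMap c =>
    exact ⟨0, algebraMap K _ c, Subalgebra.algebraMap_mem _ c, by
      simp [← IsScalarTower.algebraMap_apply]⟩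
  | add x y _ _ hx hy =>
    obtain ⟨e, P, hP, h1⟩ := hx
    obtain ⟨e', P', hP', h2⟩ := hy
    refine ⟨e + e', P * (∏ j ∈ Finset.range i, z j ^ e' j) +
      P' * (∏ j ∈ Finset.range i, z j ^ e j),
      add_mem (mul_mem hP (hQ _)) (mul_mem hP' (hQ _)), ?_⟩
    simp only [Pi.add_apply, pow_add, Finset.prod_mul_distrib, map_mul, map_add, ← h1, ← h2]
    ring
  | mul x y _ _ hx hy =>
    obtain ⟨e, P, hP, h1⟩ := hx
    obtain ⟨e', P', hP', h2⟩ := hy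
    refine ⟨e + e', P * P', mul_mem hP hP', ?_⟩
    simp only [Pi.add_apply, pow_add, Finset.prod_mul_distrib, map_mul, ← h1, ← h2]
    ring

variable (𝔪)

/-- The shape `z = y_ξ Q + P` of the next invariant, where `Q` is a product of powers of the
earlier ones and `P` is a polynomial in the coordinates of greater places. -/
def IsTriangular (z : ℕ → 𝔪.Reg) (i : ℕ) (ξ : Root n) : Prop :=
  ∃ e : ℕ → ℕ, ∃ P ∈ Algebra.adjoin K (𝔪.coord '' {η | ξ < η}),
    z i = 𝔪.coord ξ * ∏ j ∈ Finset.range i, z j ^ e j + P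

variable {𝔪}

theorem isTriangular_congr {z z' : ℕ → 𝔪.Reg} {i : ℕ} {ξ : Root n} (h : ∀ j ≤ i, z j = z' j)
    (hz : 𝔪.IsTriangular z i ξ) : 𝔪.IsTriangular z' i ξ := by
  obtain ⟨e, P, hP, h1⟩ := hz
  refine ⟨e, P, hP, ?_⟩
  rw [← h i le_rfl, h1]
  congr 2
  exact Finset.prod_congr rfl fun j hj => by rw [h j (Finset.mem_range.mp hj).le]

theorem isStage_zero : 𝔪.IsStage (Diagram.zeroStep 𝔪.M) (fun _ => 0) 0
    (Empty.elim : Empty → 𝔪.RatFun) Empty.elim 𝔪.coordMatrix where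
  closed := 𝔪.zeroStep_closed
  units := 𝔪.coordMatrix_units
  ne_zero j hj := absurd hj (Nat.not_lt_zero j)
  central j hj := absurd hj (Nat.not_lt_zero j)
  pairs := ⟨fun a => a.elim, fun a => a.elim, fun a => a.elim, fun a => a.elim⟩
  wp a := a.elim
  wq a := a.elim
  coord_mem ξ := by
    rw [← coordMatrix_root]
    exact Algebra.subset_adjoin (Or.inr ⟨(ξ.row, ξ.col), rfl⟩)
  p_mem a := a.elim
  q_mem a := a.elim
  w_mem i j := by
    rw [coordMatrix]
    split_ifs with h
    · exact Algebra.subset_adjoin (Or.inl ⟨_, rfl⟩)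
    · exact zero_mem _
  w_sub_mem η _ := by rw [coordMatrix_root, sub_self]; exact zero_mem _
  z_mem j hj := absurd hj (Nat.not_lt_zero j)
  card_le := by
    rw [Fintype.card_subtype, Fintype.card_empty, zero_add, mul_zero, zero_add]
    exact Finset.card_le_card fun ξ h => by
      simpa [Diagram.empties, zeroStep_eq_none] using h

theorem pderiv_adjoin_eq_zero {ξ : {ξ // ξ ∉ 𝔪.M}} {P : 𝔪.Reg}
    (hP : P ∈ Algebra.adjoin K (𝔪.coord '' Set.Ioi ξ.1)) :
    MvPolynomial.pderiv ξ (𝔪.regEquiv P) = 0 := by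
  induction hP using Algebra.adjoin_induction with
  | mem x hx =>
    obtain ⟨η, hη, rfl⟩ := hx
    by_cases hM : η ∈ 𝔪.M
    · rw [𝔪.coord_eq_zero hM, map_zero, map_zero]
    · rw [𝔪.regEquiv_coord ⟨η, hM⟩]
      refine MvPolynomial.pderiv_X_of_ne ?_
      rintro rfl
      exact lt_irrefl η hη
  | algebraMap c => rw [AlgEquiv.commutes]; exact MvPolynomial.pderiv_C
  | add x y _ _ hx hy => rw [map_add, map_add, hx, hy, add_zero]
  | mul x y _ _ hx hy => rw [map_mul, MvPolynomial.pderiv_mul, hx, hy, zero_mul, mul_zero, add_zero]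

/-- A polynomial `y_ξ Q + P` with `Q ≠ 0` and `Q`, `P` in the greater coordinates is not zero. -/
theorem triangular_ne_zero {ξ : Root n} (hξ : ξ ∉ 𝔪.M) {P Q : 𝔪.Reg} (hQ0 : Q ≠ 0)
    (hP : P ∈ Algebra.adjoin K (𝔪.coord '' Set.Ioi ξ))
    (hQ : Q ∈ Algebra.adjoin K (𝔪.coord '' Set.Ioi ξ)) : 𝔪.coord ξ * Q + P ≠ 0 := by
  intro h
  have h1 := congrArg (fun F => MvPolynomial.pderiv (⟨ξ, hξ⟩ : {ξ // ξ ∉ 𝔪.M}) (𝔪.regEquiv F)) h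
  simp only [map_add, map_mul, map_zero, MvPolynomial.pderiv_mul,
    𝔪.regEquiv_coord ⟨ξ, hξ⟩, pderiv_adjoin_eq_zero (ξ := ⟨ξ, hξ⟩) hP,
    pderiv_adjoin_eq_zero (ξ := ⟨ξ, hξ⟩) hQ, MvPolynomial.pderiv_X_self, one_mul, mul_zero,
    add_zero] at h1
  exact hQ0 (𝔪.regEquiv.injective (h1.trans (map_zero _).symm))

theorem algebraMap_ratFun_ne_zero {F : 𝔪.Reg} (h : F ≠ 0) :
    algebraMap 𝔪.Reg 𝔪.RatFun F ≠ 0 := fun h0 =>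
  h (IsFractionRing.injective 𝔪.Reg 𝔪.RatFun (h0.trans (map_zero _).symm))

section Step

variable {D : Diagram n} {z : ℕ → 𝔪.Reg} {i : ℕ} {ι : Type} [Fintype ι]
    {p q : ι → 𝔪.RatFun} {w : Fin n → Fin n → 𝔪.RatFun} {ξ : Root n}

theorem IsStage.notMem (h : 𝔪.IsStage D z i p q w) (hξ : D ξ = none) : ξ ∉ 𝔪.M :=
  fun hM => h.closed.not_mem (Diagram.rel_root.mpr hξ) ⟨ξ.lt, hM⟩

/-- The next invariant: the generator on the greatest empty place, multiplied by a monomial in the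
earlier invariants that clears its denominators. -/
theorem IsStage.exists_next (h : 𝔪.IsStage D z i p q w) (hξ : D ξ = none) :
    ∃ (x : 𝔪.Reg) (e : ℕ → ℕ), ∃ P ∈ Algebra.adjoin K (𝔪.coord '' Set.Ioi ξ),
      x = 𝔪.coord ξ * ∏ j ∈ Finset.range i, z j ^ e j + P ∧
      algebraMap 𝔪.Reg 𝔪.RatFun x =
        w ξ.row ξ.col * algebraMap _ _ (∏ j ∈ Finset.range i, z j ^ e j) ∧
      x ≠ 0 ∧ ∏ j ∈ Finset.range i, z j ^ e j ≠ 0 := by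
  obtain ⟨e, P, hP, hRP⟩ := clear_denominators (s := Set.Ioi ξ) (i := i)
    (fun j hj => h.z_mem j hj ξ hξ) h.ne_zero (h.w_sub_mem ξ hξ)
  have hQ0 : ∏ j ∈ Finset.range i, z j ^ e j ≠ 0 := Finset.prod_ne_zero_iff.mpr fun j hj =>
    pow_ne_zero _ (h.ne_zero j (Finset.mem_range.mp hj))
  refine ⟨_, e, P, hP, rfl, ?_, triangular_ne_zero (h.notMem hξ) hQ0 hP ?_, hQ0⟩
  · rw [map_add, map_mul, ← hRP, ratCoord]
    ring
  · exact prod_mem fun j hj => pow_mem (h.z_mem j (Finset.mem_range.mp hj) ξ hξ) _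

theorem IsStage.central' (h : 𝔪.IsStage D z i p q w) {j : ℕ} (hj : j < i) (y : 𝔪.RatFun) :
    𝔪.bracket y (algebraMap _ _ (z j)) = 0 := by
  rw [𝔪.bracket_isPoissonBracket.skew, h.central j hj, neg_zero]

theorem IsStage.top_central (h : 𝔪.IsStage D z i p q w) (hξ : D.next = some ξ)
    (y : 𝔪.RatFun) : 𝔪.bracket (w ξ.row ξ.col) y = 0 := by
  have hb := 𝔪.bracket_isPoissonBracket
  refine 𝔪.central_of_coord (fun η => hb.adjoin_right ?_ (h.coord_mem η)) y
  rintro y ((((⟨j, hj, rfl⟩ | ⟨j, hj, rfl⟩) | ⟨a, rfl⟩) | ⟨a, rfl⟩) | ⟨ab, rfl⟩)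
  · exact h.central' hj _
  · exact hb.inv_right (h.central' hj _)
  · exact h.wp a _ _
  · exact h.wq a _ _
  · exact h.units.top_left h.closed (Diagram.isTop_next hξ) hb ab.1 ab.2

theorem IsStage.monomial_central (h : 𝔪.IsStage D z i p q w) (e : ℕ → ℕ) (y : 𝔪.RatFun) :
    𝔪.bracket y (algebraMap _ _ (∏ j ∈ Finset.range i, z j ^ e j)) = 0 := by
  refine 𝔪.bracket_isPoissonBracket.adjoin_right
    (s := (fun j => algebraMap 𝔪.Reg 𝔪.RatFun (z j)) '' Set.Iio i) ?_ ?_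
  · rintro _ ⟨j, hj, rfl⟩; exact h.central' hj y
  · rw [map_prod]
    refine prod_mem fun j hj => ?_
    rw [map_pow]
    refine pow_mem (Algebra.subset_adjoin ?_) _
    exact ⟨j, Finset.mem_range.mp hj, rfl⟩

/-- An element that commutes with all entries of `w` commutes with the reduced entries. -/
theorem bracket_reduced {c : 𝔪.RatFun} {D : Diagram n} {w : Fin n → Fin n → 𝔪.RatFun}
    {k t : Fin n} (hc : ∀ i j, 𝔪.bracket (w i j) c = 0) (i j : Fin n) :
    𝔪.bracket (reduced D.rel k t w i j) c = 0 := by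
  have hb := 𝔪.bracket_isPoissonBracket
  have hc' : ∀ i j, 𝔪.bracket c (w i j) = 0 := fun i j => by rw [hb.skew, hc, neg_zero]
  rw [hb.skew, neg_eq_zero]
  refine hb.adjoin_right (s := (Set.range fun ij : Fin n × Fin n => w ij.1 ij.2) ∪
    {(w k t)⁻¹}) ?_ ?_
  · rintro _ (⟨ij, rfl⟩ | rfl)
    · exact hc' _ _
    · exact hb.inv_right (hc' _ _)
  · refine IsMatrixUnits.reduced_mem (fun i j => Algebra.subset_adjoin ?_)
      (Algebra.subset_adjoin ?_) i j
    · exact Or.inl ⟨(i, j), rfl⟩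
    · exact Or.inr rfl

variable {x : 𝔪.Reg} {e : ℕ → ℕ}

theorem invs_subset_update : 𝔪.invs z i ⊆ 𝔪.invs (Function.update z i x) (i + 1) := by
  rintro _ ⟨j, hj, rfl⟩
  exact ⟨j, Nat.lt_succ_of_lt hj, by
    simp only [Function.update_of_ne (Set.mem_Iio.mp hj).ne]⟩

theorem inv_mem_invs_update :
    (algebraMap 𝔪.Reg 𝔪.RatFun x)⁻¹ ∈ 𝔪.invs (Function.update z i x) (i + 1) :=
  ⟨i, Nat.lt_succ_self i, by simp only [Function.update_self]⟩

theorem inv_eq_of_mul {u : 𝔪.RatFun} {Q : 𝔪.Reg} (hxu : algebraMap 𝔪.Reg 𝔪.RatFun x =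
      u * algebraMap _ _ Q) (hQ : Q ≠ 0) :
    u⁻¹ = (algebraMap 𝔪.Reg 𝔪.RatFun x)⁻¹ * algebraMap _ _ Q := by
  rw [hxu, mul_inv, inv_mul_cancel_right₀ (algebraMap_ratFun_ne_zero hQ)]

/-- The inverse of the pivot is a polynomial in the inverted invariants and in any set of coordinates
that contains the earlier invariants. -/
theorem pivot_inv_mem {u : 𝔪.RatFun} (hxu : algebraMap 𝔪.Reg 𝔪.RatFun x =
      u * algebraMap _ _ (∏ j ∈ Finset.range i, z j ^ e j))
    (hQ : ∏ j ∈ Finset.range i, z j ^ e j ≠ 0) {s : Set (Root n)}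
    (hs : ∀ j < i, z j ∈ Algebra.adjoin K (𝔪.coord '' s)) :
    u⁻¹ ∈ Algebra.adjoin K (𝔪.ratCoord '' s ∪ 𝔪.invs (Function.update z i x) (i + 1)) := by
  rw [inv_eq_of_mul hxu hQ]
  refine mul_mem (Algebra.subset_adjoin (Or.inr inv_mem_invs_update)) ?_
  refine Algebra.adjoin_mono Set.subset_union_left (algebraMap_mem_adjoin ?_)
  exact prod_mem fun j hj => pow_mem (hs j (Finset.mem_range.mp hj)) _

/-- The coordinates are polynomials in the new generators. -/
theorem IsStage.coord_mem_step (h : 𝔪.IsStage D z i p q w) (hξ : D.next = some ξ)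
    (hxu : algebraMap 𝔪.Reg 𝔪.RatFun x =
      w ξ.row ξ.col * algebraMap _ _ (∏ j ∈ Finset.range i, z j ^ e j)) (hx0 : x ≠ 0)
    (hQ0 : ∏ j ∈ Finset.range i, z j ^ e j ≠ 0) (η : Root n) :
    𝔪.ratCoord η ∈ Algebra.adjoin K (𝔪.gens (Function.update z i x) (i + 1)
      (Sum.elim p fun a : D.Pairs ξ => w ξ.row a)
      (Sum.elim q fun a : D.Pairs ξ => (w ξ.row ξ.col)⁻¹ * w a ξ.col)
      (reduced D.rel ξ.row ξ.col w)) := by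
  have ht := Diagram.isTop_next hξ
  have hu0 : w ξ.row ξ.col ≠ 0 := by
    intro h0
    rw [h0, zero_mul] at hxu
    exact algebraMap_ratFun_ne_zero hx0 hxu
  set G := 𝔪.gens (Function.update z i x) (i + 1)
    (Sum.elim p fun a : D.Pairs ξ => w ξ.row a)
    (Sum.elim q fun a : D.Pairs ξ => (w ξ.row ξ.col)⁻¹ * w a ξ.col)
    (reduced D.rel ξ.row ξ.col w) with hG
  have gz : ∀ j < i, algebraMap 𝔪.Reg 𝔪.RatFun (z j) ∈ Algebra.adjoin K G := fun j hj =>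
    Algebra.subset_adjoin (Or.inl (Or.inl (Or.inl (Or.inl
      ⟨j, Nat.lt_succ_of_lt hj, by simp only [Function.update_of_ne hj.ne]⟩))))
  have gx : algebraMap 𝔪.Reg 𝔪.RatFun x ∈ Algebra.adjoin K G :=
    Algebra.subset_adjoin (Or.inl (Or.inl (Or.inl (Or.inl
      ⟨i, Nat.lt_succ_self i, by simp only [Function.update_self]⟩))))
  have gi : 𝔪.invs (Function.update z i x) (i + 1) ⊆ Algebra.adjoin K G := fun y hy =>
    Algebra.subset_adjoin (Or.inl (Or.inl (Or.inl (Or.inr hy))))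
  have gQ : algebraMap 𝔪.Reg 𝔪.RatFun (∏ j ∈ Finset.range i, z j ^ e j) ∈
      Algebra.adjoin K G := by
    rw [map_prod]
    refine prod_mem fun j hj => ?_
    rw [map_pow]
    exact pow_mem (gz j (Finset.mem_range.mp hj)) _
  have gQi : (algebraMap 𝔪.Reg 𝔪.RatFun (∏ j ∈ Finset.range i, z j ^ e j))⁻¹ ∈
      Algebra.adjoin K G := by
    rw [map_prod, ← Finset.prod_inv_distrib]
    refine prod_mem fun j hj => ?_
    rw [map_pow, ← inv_pow]
    exact pow_mem (gi (invs_subset_update ⟨j, Finset.mem_range.mp hj, rfl⟩)) _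
  have gu : w ξ.row ξ.col ∈ Algebra.adjoin K G := by
    rw [← mul_inv_cancel_right₀ (algebraMap_ratFun_ne_zero hQ0) (w ξ.row ξ.col), ← hxu]
    exact mul_mem gx gQi
  have gui : (w ξ.row ξ.col)⁻¹ ∈ Algebra.adjoin K G := by
    rw [inv_eq_of_mul hxu hQ0]
    exact mul_mem (gi inv_mem_invs_update) gQ
  have gw : ∀ i' j', w i' j' ∈ Algebra.adjoin K G := by
    refine h.units.mem_of_reduced h.closed ht hu0 gu gui ?_ ?_ ?_
    · intro a h1 h2
      exact Algebra.subset_adjoin (Or.inl (Or.inl (Or.inr ⟨Sum.inr ⟨a, h1, h2⟩, rfl⟩)))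
    · intro a h1 h2
      rw [← mul_inv_cancel_left₀ hu0 (w a ξ.col)]
      refine mul_mem gu ?_
      exact Algebra.subset_adjoin (Or.inl (Or.inr ⟨Sum.inr ⟨a, h1, h2⟩, rfl⟩))
    · intro i' j'
      exact Algebra.subset_adjoin (Or.inr ⟨(i', j'), rfl⟩)
  refine Algebra.adjoin_le ?_ (h.coord_mem η)
  rintro y ((((⟨j, hj, rfl⟩ | hy) | ⟨a, rfl⟩) | ⟨a, rfl⟩) | ⟨ab, rfl⟩)
  · exact gz j hj
  · exact gi (invs_subset_update hy)
  · exact Algebra.subset_adjoin (Or.inl (Or.inl (Or.inr ⟨Sum.inl a, rfl⟩)))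
  · exact Algebra.subset_adjoin (Or.inl (Or.inr ⟨Sum.inl a, rfl⟩))
  · exact gw _ _
set_option maxHeartbeats 1600000 in
/-- One step of the construction: `x` is the new invariant, the places that get `−` and `+` give new
canonical pairs, and the family `w` is replaced by the reduced one. -/
theorem IsStage.step_aux (h : 𝔪.IsStage D z i p q w) (hξ : D.next = some ξ)
    {P : 𝔪.Reg} (hP : P ∈ Algebra.adjoin K (𝔪.coord '' Set.Ioi ξ))
    (hx : x = 𝔪.coord ξ * ∏ j ∈ Finset.range i, z j ^ e j + P)
    (hxu : algebraMap 𝔪.Reg 𝔪.RatFun x =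
      w ξ.row ξ.col * algebraMap _ _ (∏ j ∈ Finset.range i, z j ^ e j)) (hx0 : x ≠ 0)
    (hQ0 : ∏ j ∈ Finset.range i, z j ^ e j ≠ 0) :
    𝔪.IsStage (D.fill ξ) (Function.update z i x) (i + 1)
      (Sum.elim p fun a : D.Pairs ξ => w ξ.row a)
      (Sum.elim q fun a : D.Pairs ξ => (w ξ.row ξ.col)⁻¹ * w a ξ.col)
      (reduced D.rel ξ.row ξ.col w) := by
  have hb := 𝔪.bracket_isPoissonBracket
  have ht := Diagram.isTop_next hξ
  have hDξ := Diagram.next_mem hξ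
  have hcu := h.top_central hξ
  have hcui : ∀ y, 𝔪.bracket y (w ξ.row ξ.col)⁻¹ = 0 := fun y =>
    hb.inv_right (by rw [hb.skew, hcu, neg_zero])
  have hcui' : ∀ y, 𝔪.bracket (w ξ.row ξ.col)⁻¹ y = 0 := fun y => by
    rw [hb.skew, hcui, neg_zero]
  have hu0 : w ξ.row ξ.col ≠ 0 := by
    intro h0
    rw [h0, zero_mul] at hxu
    exact algebraMap_ratFun_ne_zero hx0 hxu
  have hmono : Algebra.adjoin K (Set.range 𝔪.ratCoord ∪ 𝔪.invs z i) ≤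
      Algebra.adjoin K (Set.range 𝔪.ratCoord ∪ 𝔪.invs (Function.update z i x) (i + 1)) :=
    Algebra.adjoin_mono (Set.union_subset_union_right _ invs_subset_update)
  have huA : (w ξ.row ξ.col)⁻¹ ∈
      Algebra.adjoin K (Set.range 𝔪.ratCoord ∪ 𝔪.invs (Function.update z i x) (i + 1)) := by
    rw [← Set.image_univ]
    refine pivot_inv_mem hxu hQ0 fun j hj => ?_
    rw [Set.image_univ, adjoin_coord]; trivial
  have hcx : ∀ y, 𝔪.bracket (algebraMap 𝔪.Reg 𝔪.RatFun x) y = 0 := fun y => by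
    rw [hxu, hb.mul_left, hb.skew _ y, h.monomial_central, hcu, neg_zero, mul_zero, mul_zero,
      add_zero]
  refine ⟨?_, ?_, ?_, ?_, ?_, ?_, ?_, h.coord_mem_step hξ hxu hx0 hQ0, ?_, ?_, ?_, ?_, ?_, ?_⟩
  · rw [Diagram.rel_fill]; exact stepRel_closed h.closed ht
  · rw [Diagram.rel_fill]; exact h.units.reduced h.closed ht hb hu0
  · intro j hj
    rcases Nat.lt_succ_iff_lt_or_eq.mp hj with hj | rfl
    · rw [Function.update_of_ne hj.ne]; exact h.ne_zero j hj
    · rw [Function.update_self]; exact hx0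
  · intro j hj y
    rcases Nat.lt_succ_iff_lt_or_eq.mp hj with hj | rfl
    · rw [Function.update_of_ne hj.ne]; exact h.central j hj y
    · rw [Function.update_self]; exact hcx y
  · refine h.pairs.sum hb (h.units.canonicalPairs h.closed ht hb hu0) (fun a b => h.wp a _ _)
      (fun a b => h.wq a _ _) (fun a b => ?_) (fun a b => ?_)
    · rw [hb.mul_left, h.wp, hcui', mul_zero, mul_zero, add_zero]
    · rw [hb.mul_left, h.wq, hcui', mul_zero, mul_zero, add_zero]
  · rintro (a | a) i' j'
    · exact bracket_reduced (h.wp a) i' j'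
    · exact h.units.reduced_row h.closed ht hb hu0 a.2.1 a.2.2 i' j'
  · rintro (a | a) i' j'
    · exact bracket_reduced (h.wq a) i' j'
    · simp only [Sum.elim_inr]
      rw [hb.mul_right, hcui, h.units.reduced_col h.closed ht hb hu0 a.2.1 a.2.2, mul_zero,
        mul_zero, add_zero]
  · rintro (a | a)
    · exact hmono (h.p_mem a)
    · exact hmono (h.w_mem _ _)
  · rintro (a | a)
    · exact hmono (h.q_mem a)
    · exact mul_mem huA (hmono (h.w_mem _ _))
  · exact IsMatrixUnits.reduced_mem (fun i' j' => hmono (h.w_mem i' j')) huA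
  · intro η hη
    have hs := Diagram.fill_eq_none.mp hη
    have hDη : D η = none := Diagram.rel_root.mp hs.1
    have h1 := h.w_sub_mem η hDη
    have hm : ∀ {ζ : Root n}, η ≤ ζ →
        Algebra.adjoin K (𝔪.ratCoord '' Set.Ioi ζ ∪ 𝔪.invs z i) ≤
          Algebra.adjoin K (𝔪.ratCoord '' Set.Ioi η ∪
            𝔪.invs (Function.update z i x) (i + 1)) := fun hζ =>
      Algebra.adjoin_mono (Set.union_subset_union (Set.image_mono (Set.Ioi_subset_Ioi hζ))
        invs_subset_update)
    -- The correction made by the reduction and the old correction both involve only coordinates of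
    -- places greater than `η`.
    rw [← sub_add_sub_cancel _ (w η.row η.col)]
    refine add_mem ?_ (hm le_rfl h1)
    refine h.units.reduced_sub_mem h.closed ht hu0 hs ?_ ?_
    · rintro l m ⟨hml, hD⟩ hlm
      have hlt : η < ⟨l, m, hml⟩ := (Root.lt_iff _ _).mpr hlm
      have h2 := hm hlt.le (h.w_sub_mem _ hD)
      rw [← sub_add_cancel (w l m) (𝔪.ratCoord ⟨l, m, hml⟩)]
      exact add_mem h2 (Algebra.subset_adjoin (Or.inl ⟨_, hlt, rfl⟩))
    · exact pivot_inv_mem hxu hQ0 fun j hj => h.z_mem j hj η hDη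
  · intro j hj η hη
    have hDη : D η = none := Diagram.rel_root.mp (Diagram.fill_eq_none.mp hη).1
    rcases Nat.lt_succ_iff_lt_or_eq.mp hj with hj | rfl
    · rw [Function.update_of_ne hj.ne]; exact h.z_mem j hj η hDη
    · have hlt : η < ξ := by
        refine lt_of_le_of_ne (Diagram.le_next hξ hDη) ?_
        rintro rfl
        simp [Diagram.fill] at hη
      rw [Function.update_self, hx]
      refine add_mem (mul_mem (Algebra.subset_adjoin ⟨ξ, hlt, rfl⟩) ?_) ?_
      · exact prod_mem fun j hj => pow_mem (h.z_mem j (Finset.mem_range.mp hj) η hDη) _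
      · exact Algebra.adjoin_mono (Set.image_mono (Set.Ioi_subset_Ioi hlt.le)) hP
  · have h1 := Diagram.card_fill_le hDξ
    have h2 := h.card_le
    rw [Fintype.card_sum]
    omega

theorem IsStage.step (h : 𝔪.IsStage D z i p q w) (hξ : D.next = some ξ) :
    ∃ x : 𝔪.Reg, 𝔪.IsTriangular (Function.update z i x) i ξ ∧
      ∃ (p' q' : ι ⊕ D.Pairs ξ → 𝔪.RatFun) (w' : Fin n → Fin n → 𝔪.RatFun),
        𝔪.IsStage (D.fill ξ) (Function.update z i x) (i + 1) p' q' w' := by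
  obtain ⟨x, e, P, hP, hx, hxu, hx0, hQ0⟩ := h.exists_next (Diagram.next_mem hξ)
  refine ⟨x, ⟨e, P, hP, ?_⟩, _, _, _, h.step_aux hξ hP hx hxu hx0 hQ0⟩
  rw [Function.update_self, hx]
  congr 2
  exact Finset.prod_congr rfl fun j hj => by
    rw [Function.update_of_ne (Finset.mem_range.mp hj).ne]

end Step

/-- As long as the diagram is not complete, the construction can be continued. -/
theorem exists_isStage (i : ℕ) (hi : ∀ j < i, Diagram.crossPlace 𝔪.M j ≠ none) :
    ∃ (z : ℕ → 𝔪.Reg) (ι : Type) (_ : Fintype ι) (p q : ι → 𝔪.RatFun)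
      (w : Fin n → Fin n → 𝔪.RatFun), 𝔪.IsStage (Diagram.after 𝔪.M i) z i p q w ∧
        ∀ j < i, ∃ ξ, Diagram.crossPlace 𝔪.M j = some ξ ∧ 𝔪.IsTriangular z j ξ := by
  induction i with
  | zero => exact ⟨_, Empty, inferInstance, _, _, _, isStage_zero, fun j hj =>
      absurd hj (Nat.not_lt_zero j)⟩
  | succ i ih =>
    obtain ⟨z, ι, _, p, q, w, h, htri⟩ := ih fun j hj => hi j (Nat.lt_succ_of_lt hj)
    obtain ⟨ξ, hξ⟩ := Option.ne_none_iff_exists'.mp (hi i (Nat.lt_succ_self i))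
    have hξ' : (Diagram.after 𝔪.M i).next = some ξ := hξ
    obtain ⟨x, hx, p', q', w', h'⟩ := h.step hξ'
    refine ⟨Function.update z i x, _, inferInstance, p', q', w', ?_, ?_⟩
    · have e : Diagram.after 𝔪.M (i + 1) = (Diagram.after 𝔪.M i).fill ξ := by
        rw [Diagram.after, hξ']
      rw [e]; exact h'
    · intro j hj
      rcases Nat.lt_succ_iff_lt_or_eq.mp hj with hj | rfl
      · obtain ⟨ζ, hζ, h1⟩ := htri j hj
        refine ⟨ζ, hζ, isTriangular_congr (fun l hl => ?_) h1⟩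
        rw [Function.update_of_ne (hl.trans_lt hj).ne]
      · exact ⟨ξ, hξ, hx⟩

end RootIdeal

/-! ### The Poisson algebra `K[Z^±] ⊗ 𝔸_m` -/

/-- A homomorphism that respects the brackets of generators respects the brackets. -/
theorem IsPoissonBracket.map_eq {K A B : Type*} [CommRing K] [CommRing A] [CommRing B]
    [Algebra K A] [Algebra K B] {br : A →ₗ[K] A →ₗ[K] A} {br' : B →ₗ[K] B →ₗ[K] B}
    (h : IsPoissonBracket br) (h' : IsPoissonBracket br') (φ : A →ₐ[K] B) {s : Set A}
    (hs : Algebra.adjoin K s = ⊤) (hφ : ∀ x ∈ s, ∀ y ∈ s, φ (br x y) = br' (φ x) (φ y)) (a b : A) :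
    φ (br a b) = br' (φ a) (φ b) := by
  have step : ∀ a, (∀ y ∈ s, φ (br a y) = br' (φ a) (φ y)) → ∀ b, φ (br a b) = br' (φ a) (φ b) := by
    intro a ha b
    have hb : b ∈ Algebra.adjoin K s := hs ▸ Algebra.mem_top
    induction hb using Algebra.adjoin_induction with
    | mem x hx => exact ha x hx
    | algebraMap c => rw [h.algebraMap_right, AlgHom.commutes, h'.algebraMap_right, map_zero]
    | add x y _ _ hx hy => rw [map_add, map_add, map_add, map_add, hx, hy]
    | mul x y _ _ hx hy =>
      rw [h.mul_right, map_mul, h'.mul_right, map_add, map_mul, map_mul, hx, hy]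
  refine step a (fun y hy => ?_) b
  rw [h.skew, h'.skew, map_neg, step y (fun x hx => hφ y hy x hx)]

variable {K : Type*} [Field K] {s m : ℕ}

theorem bracketPQ_apply (F G : PolyPQ K m) : bracketPQ K m F G = ∑ i : Fin m,
    (MvPolynomial.pderiv (Sum.inl i) F * MvPolynomial.pderiv (Sum.inr i) G -
      MvPolynomial.pderiv (Sum.inr i) F * MvPolynomial.pderiv (Sum.inl i) G) := by
  simp [bracketPQ, LinearMap.sum_apply]

theorem bracketPQ_isPoissonBracket : IsPoissonBracket (bracketPQ K m) where
  skew F G := by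
    rw [bracketPQ_apply, bracketPQ_apply, ← Finset.sum_neg_distrib]
    exact Finset.sum_congr rfl fun i _ => by ring
  mul_right F G H := by
    simp only [bracketPQ_apply, Finset.mul_sum, ← Finset.sum_add_distrib,
      MvPolynomial.pderiv_mul]
    exact Finset.sum_congr rfl fun i _ => by ring

theorem bracketPQ_pairs : IsCanonicalPairs (bracketPQ K m)
    (fun a => MvPolynomial.X (Sum.inl a)) (fun a => MvPolynomial.X (Sum.inr a)) where
  pp a b := by simp [bracketPQ_apply, MvPolynomial.pderiv_X, Pi.single_apply]
  qq a b := by simp [bracketPQ_apply, MvPolynomial.pderiv_X, Pi.single_apply]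
  pq_self a := by simp [bracketPQ_apply, MvPolynomial.pderiv_X, Pi.single_apply]
  pq_ne a b h := by
    simp [bracketPQ_apply, MvPolynomial.pderiv_X, Pi.single_apply, h]

/-- Polynomials in canonical pairs have the bracket of `𝔸_m`. -/
theorem IsCanonicalPairs.aeval_bracketPQ {C : Type*} [CommRing C] [Algebra K C]
    {br : C →ₗ[K] C →ₗ[K] C} (hb : IsPoissonBracket br) {p q : Fin m → C}
    (h : IsCanonicalPairs br p q) (F G : PolyPQ K m) :
    MvPolynomial.aeval (Sum.elim p q) (bracketPQ K m F G) =
      br (MvPolynomial.aeval (Sum.elim p q) F) (MvPolynomial.aeval (Sum.elim p q) G) := by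
  refine bracketPQ_isPoissonBracket.map_eq hb _ MvPolynomial.adjoin_range_X ?_ F G
  have hX := bracketPQ_pairs (K := K) (m := m)
  have hpq : ∀ a b, MvPolynomial.aeval (Sum.elim p q)
      (bracketPQ K m (MvPolynomial.X (Sum.inl a)) (MvPolynomial.X (Sum.inr b))) =
      br (p a) (q b) := by
    intro a b
    by_cases hab : a = b
    · subst hab; rw [hX.pq_self, h.pq_self, map_one]
    · rw [hX.pq_ne a b hab, h.pq_ne a b hab, map_zero]
  rintro _ ⟨a | a, rfl⟩ _ ⟨b | b, rfl⟩ <;> simp only [MvPolynomial.aeval_X, Sum.elim_inl, Sum.elim_inr]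
  · rw [hX.pp, h.pp, map_zero]
  · exact hpq a b
  · rw [bracketPQ_isPoissonBracket.skew, map_neg, hpq, ← hb.skew]
  · rw [hX.qq, h.qq, map_zero]

variable (K s m) in
/-- The generators `Z_i ⊗ 1`, `1 ⊗ p_a`, `1 ⊗ q_a` of `K[Z^±] ⊗ 𝔸_m`. -/
def modelCoord : Fin s ⊕ (Fin m ⊕ Fin m) → Laurent K s ⊗[K] PolyPQ K m :=
  Sum.elim (fun i => Laurent.var K i ⊗ₜ 1) (fun a => 1 ⊗ₜ MvPolynomial.X a)

theorem prod_var_pow (e : Fin s → ℕ) :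
    ∏ i, Laurent.var K i ^ e i = AddMonoidAlgebra.single (fun i => (e i : ℤ)) (1 : K) := by
  have : ∀ t : Finset (Fin s), ∏ i ∈ t, Laurent.var K i ^ e i =
      AddMonoidAlgebra.single (∑ i ∈ t, Pi.single i (e i : ℤ)) (1 : K) := by
    classical
    intro t
    induction t using Finset.induction_on with
    | empty => simp [AddMonoidAlgebra.one_def]
    | insert i t hi ih =>
      rw [Finset.prod_insert hi, Finset.sum_insert hi, ih, Laurent.var, AddMonoidAlgebra.single_pow,
        AddMonoidAlgebra.single_mul_single]
      simp [← Pi.single_smul]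
  rw [this]
  congr 1
  exact Finset.univ_sum_single fun i => (e i : ℤ)

/-- Every element of `K[Z^±] ⊗ 𝔸_m` becomes a polynomial in the generators after multiplication by
a monomial in the `Z_i`. -/
theorem exists_modelCoord_eq (T : Laurent K s ⊗[K] PolyPQ K m) :
    ∃ (e : Fin s → ℕ) (G : MvPolynomial (Fin s ⊕ (Fin m ⊕ Fin m)) K),
      MvPolynomial.aeval (modelCoord K s m) G =
        (∏ i, modelCoord K s m (Sum.inl i) ^ e i) * T := by
  have hadd : ∀ T T' : Laurent K s ⊗[K] PolyPQ K m,
      (∃ (e : Fin s → ℕ) (G : MvPolynomial (Fin s ⊕ (Fin m ⊕ Fin m)) K),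
        MvPolynomial.aeval (modelCoord K s m) G = (∏ i, modelCoord K s m (Sum.inl i) ^ e i) * T) →
      (∃ (e : Fin s → ℕ) (G : MvPolynomial (Fin s ⊕ (Fin m ⊕ Fin m)) K),
        MvPolynomial.aeval (modelCoord K s m) G = (∏ i, modelCoord K s m (Sum.inl i) ^ e i) * T') →
      ∃ (e : Fin s → ℕ) (G : MvPolynomial (Fin s ⊕ (Fin m ⊕ Fin m)) K),
        MvPolynomial.aeval (modelCoord K s m) G =
          (∏ i, modelCoord K s m (Sum.inl i) ^ e i) * (T + T') := by
    rintro T T' ⟨e, G, h⟩ ⟨e', G', h'⟩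
    refine ⟨e + e', (∏ i, MvPolynomial.X (Sum.inl i) ^ e' i) * G +
      (∏ i, MvPolynomial.X (Sum.inl i) ^ e i) * G', ?_⟩
    simp only [map_add, map_mul, map_prod, map_pow, MvPolynomial.aeval_X, h, h', Pi.add_apply,
      pow_add, Finset.prod_mul_distrib]
    ring
  have hzero : ∃ (e : Fin s → ℕ) (G : MvPolynomial (Fin s ⊕ (Fin m ⊕ Fin m)) K),
      MvPolynomial.aeval (modelCoord K s m) G =
        (∏ i, modelCoord K s m (Sum.inl i) ^ e i) * 0 := ⟨0, 0, by simp⟩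
  induction T using TensorProduct.induction_on with
  | zero => exact hzero
  | add T T' h h' => exact hadd _ _ h h'
  | tmul l b =>
    induction l using AddMonoidAlgebra.induction_linear with
    | zero => rw [TensorProduct.zero_tmul]; exact hzero
    | add l l' h h' => rw [TensorProduct.add_tmul]; exact hadd _ _ h h'
    | single f c =>
      refine ⟨fun i => (f i).natAbs, (∏ i, MvPolynomial.X (Sum.inl i) ^ ((f i).natAbs + f i).toNat) *
        MvPolynomial.rename Sum.inr (c • b), ?_⟩
      have hb : ∀ b : PolyPQ K m, MvPolynomial.aeval (modelCoord K s m)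
          (MvPolynomial.rename Sum.inr b) = 1 ⊗ₜ b := by
        intro b
        rw [MvPolynomial.aeval_rename]
        have : MvPolynomial.aeval (modelCoord K s m ∘ Sum.inr) =
            (Algebra.TensorProduct.includeRight : PolyPQ K m →ₐ[K] Laurent K s ⊗[K] PolyPQ K m) := by
          ext a; simp [modelCoord]
        rw [this]; rfl
      have hz : ∀ e : Fin s → ℕ, ∏ i, modelCoord K s m (Sum.inl i) ^ e i =
          AddMonoidAlgebra.single (fun i => (e i : ℤ)) (1 : K) ⊗ₜ 1 := by
        intro e
        rw [← prod_var_pow]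
        have := map_prod (Algebra.TensorProduct.includeLeft :
          Laurent K s →ₐ[K] Laurent K s ⊗[K] PolyPQ K m) (fun i => Laurent.var K i ^ e i)
          Finset.univ
        simp only [map_pow, Algebra.TensorProduct.includeLeft_apply] at this
        exact this.symm
      rw [map_mul, hb, map_prod]
      simp only [map_pow, MvPolynomial.aeval_X]
      rw [hz, hz, Algebra.TensorProduct.tmul_mul_tmul, Algebra.TensorProduct.tmul_mul_tmul,
        AddMonoidAlgebra.single_mul_single, one_mul, one_mul, mul_one, TensorProduct.tmul_smul,
        TensorProduct.smul_tmul', AddMonoidAlgebra.smul_single, smul_eq_mul, mul_one, one_mul]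
      congr 2
      ext i
      simp only [Pi.add_apply]
      omega

section Comparison

variable {C : Type*} [CommRing C] [Algebra K C]

variable (K) in
/-- The homomorphism from `K[Z^±] ⊗ 𝔸_m` given by units `u_i` and elements `p_a`, `q_a`. -/
def fromModel (u : Fin s → Cˣ) (p q : Fin m → C) : Laurent K s ⊗[K] PolyPQ K m →ₐ[K] C :=
  Algebra.TensorProduct.productMap
    (AddMonoidAlgebra.lift K C (Fin s → ℤ)
      ((Units.coeHom C).comp
        { toFun := fun f => ∏ i, u i ^ (Multiplicative.toAdd f i)
          map_one' := by simp
          map_mul' := fun f g => by simp [zpow_add, Finset.prod_mul_distrib] }))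
    (MvPolynomial.aeval (Sum.elim p q))

variable (u : Fin s → Cˣ) (p q : Fin m → C)

theorem fromModel_single (f : Fin s → ℤ) (c : K) (b : PolyPQ K m) :
    fromModel K u p q (AddMonoidAlgebra.single f c ⊗ₜ b) =
      c • ((∏ i, u i ^ f i : Cˣ) : C) * MvPolynomial.aeval (Sum.elim p q) b := by
  rw [fromModel, Algebra.TensorProduct.productMap_apply_tmul, AddMonoidAlgebra.lift_single]
  rfl

theorem fromModel_modelCoord (a : Fin s ⊕ (Fin m ⊕ Fin m)) :
    fromModel K u p q (modelCoord K s m a) =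
      (Sum.elim (fun i => (u i : C)) (Sum.elim p q) : _ → C) a := by
  rcases a with i | a
  · change fromModel K u p q (AddMonoidAlgebra.single (Pi.single i 1) 1 ⊗ₜ 1) = _
    rw [fromModel_single, map_one, mul_one, one_smul, Finset.prod_eq_single i]
    · simp
    · intro j _ hj; simp [hj]
    · simp
  · simp [modelCoord, fromModel]

theorem fromModel_aeval (G : MvPolynomial (Fin s ⊕ (Fin m ⊕ Fin m)) K) :
    fromModel K u p q (MvPolynomial.aeval (modelCoord K s m) G) =
      MvPolynomial.aeval (Sum.elim (fun i => (u i : C)) (Sum.elim p q)) G := by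
  rw [MvPolynomial.comp_aeval_apply]
  congr 2
  ext a
  exact fromModel_modelCoord u p q a

theorem tensorBracket_tmul (l l' : Laurent K s) (b b' : PolyPQ K m) :
    tensorBracket (0 : Laurent K s →ₗ[K] Laurent K s →ₗ[K] Laurent K s) (bracketPQ K m)
      (l ⊗ₜ b) (l' ⊗ₜ b') = (l * l') ⊗ₜ bracketPQ K m b b' := by
  have h1 : ∀ (α : Laurent K s →ₗ[K] Laurent K s →ₗ[K] Laurent K s)
    (β : PolyPQ K m →ₗ[K] PolyPQ K m →ₗ[K] PolyPQ K m),
    LinearMap.BilinMap.tmul α β (l ⊗ₜ b) (l' ⊗ₜ b') = (α l l') ⊗ₜ (β b b') := fun _ _ => rfl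
  rw [tensorBracket, LinearMap.add_apply, LinearMap.add_apply, h1, h1]
  simp

/-- The comparison homomorphism respects the Poisson brackets if the `u_i` are central and the
`p_a`, `q_a` are canonical pairs. -/
theorem fromModel_tensorBracket {br : C →ₗ[K] C →ₗ[K] C} (hb : IsPoissonBracket br)
    (hu : ∀ i x, br x (u i) = 0) (h : IsCanonicalPairs br p q)
    (A B : Laurent K s ⊗[K] PolyPQ K m) :
    fromModel K u p q (tensorBracket 0 (bracketPQ K m) A B) =
      br (fromModel K u p q A) (fromModel K u p q B) := by
  have huinv : ∀ i x, br x ((u i)⁻¹ : Cˣ) = 0 := by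
    intro i x
    have h1 := hb.mul_right x (u i : C) ((u i)⁻¹ : Cˣ)
    rw [Units.mul_inv, hb.one_right, hu, mul_zero, add_zero] at h1
    exact ((u i).isUnit.mul_right_eq_zero).mp h1.symm
  have hpow : ∀ (v : C), (∀ x, br x v = 0) → ∀ (k : ℕ) x, br x (v ^ k) = 0 := by
    intro v hv k x
    induction k with
    | zero => rw [pow_zero, hb.one_right]
    | succ k ih => rw [pow_succ, hb.mul_right, hv, ih, mul_zero, mul_zero, add_zero]
  have hmon : ∀ (f : Fin s → ℤ) x, br x ((∏ i, u i ^ f i : Cˣ) : C) = 0 := by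
    intro f x
    rw [Units.coe_prod]
    refine Finset.prod_induction (fun i => ((u i ^ f i : Cˣ) : C)) (fun v => br x v = 0) ?_
      (hb.one_right x) ?_
    · intro a b ha hb'; rw [hb.mul_right, ha, hb', mul_zero, mul_zero, add_zero]
    · intro i _
      rcases f i with k | k
      · rw [Int.ofNat_eq_natCast, zpow_natCast, Units.val_pow_eq_pow_val]; exact hpow _ (hu i) _ _
      · rw [zpow_negSucc, ← inv_pow, Units.val_pow_eq_pow_val]; exact hpow _ (huinv i) _ _
  induction A using TensorProduct.induction_on with
  | zero => simp
  | add A A' hA hA' => simp only [map_add, LinearMap.add_apply, hA, hA']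
  | tmul l b =>
  induction B using TensorProduct.induction_on with
  | zero => simp
  | add B B' hB hB' => simp only [map_add, hB, hB']
  | tmul l' b' =>
  induction l using AddMonoidAlgebra.induction_linear with
  | zero => simp
  | add l l'' hl hl' => simp only [TensorProduct.add_tmul, map_add, LinearMap.add_apply, hl, hl']
  | single f c =>
  induction l' using AddMonoidAlgebra.induction_linear with
  | zero => simp
  | add l l'' hl hl' => simp only [TensorProduct.add_tmul, map_add, hl, hl']
  | single f' c' =>
  rw [tensorBracket_tmul, AddMonoidAlgebra.single_mul_single]
  simp only [fromModel_single, h.aeval_bracketPQ hb]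
  simp only [zpow_add, Pi.add_apply, Finset.prod_mul_distrib, Units.val_mul]
  have hm0 : ∀ (f : Fin s → ℤ) (c : K) x, br x (c • ((∏ i, u i ^ f i : Cˣ) : C)) = 0 := by
    intro f c x; rw [map_smul, hmon, smul_zero]
  rw [hb.mul_right, hb.mul_left, hm0, hb.skew (c • _), hm0]
  simp only [smul_mul_assoc, mul_smul_comm, mul_zero, neg_zero, add_zero]
  rw [mul_smul]
  simp only [mul_assoc, mul_left_comm]

/-- The generators of `K[Z^±] ⊗ 𝔸_m` are algebraically independent: a nonzero polynomial has a
nonzero value at a point whose coordinates are nonzero. -/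
theorem algebraicIndependent_modelCoord [Infinite K] :
    AlgebraicIndependent K (modelCoord K s m) := by
  rw [algebraicIndependent_iff]
  intro G hG
  by_contra hG0
  have h1 : G * ∏ i : Fin s, MvPolynomial.X (Sum.inl i) ≠ 0 :=
    mul_ne_zero hG0 (Finset.prod_ne_zero_iff.mpr fun i _ => MvPolynomial.X_ne_zero _)
  refine h1 (MvPolynomial.funext fun v => ?_)
  rw [map_mul, map_prod, map_zero]
  by_contra h2
  have h3 : ∀ i, v (Sum.inl i) ≠ 0 := fun i => by
    simpa using Finset.prod_ne_zero_iff.mp (right_ne_zero_of_mul h2) i (Finset.mem_univ i)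
  have h4 := fromModel_aeval (K := K) (fun i => Units.mk0 _ (h3 i)) (fun a : Fin m => v (Sum.inr (Sum.inl a)))
    (fun a => v (Sum.inr (Sum.inr a))) G
  rw [hG, map_zero] at h4
  refine left_ne_zero_of_mul h2 ?_
  rw [h4, MvPolynomial.aeval_eq_eval]
  congr 2
  ext (i | a | a) <;> rfl

end Comparison

namespace RootIdeal

variable {K : Type*} [Field K] {n : ℕ} (𝔪 : RootIdeal K n) {s m : ℕ}

/-! ### Darboux coordinates on a localization of `K[ℒ*]` -/

/-- The localization of `K[ℒ*]` at the multiplicative set generated by the `z_i`. -/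
abbrev Loc (z : Fin s → 𝔪.Reg) : Type _ := Localization (Submonoid.closure (Set.range z))

/-- The Poisson bracket of the localization. -/
def locBracket (z : Fin s → 𝔪.Reg) : 𝔪.Loc z →ₗ[K] 𝔪.Loc z →ₗ[K] 𝔪.Loc z :=
  liePoisson (𝔪.Loc z) (Submonoid.closure (Set.range z))

variable {𝔪}
variable {z : Fin s → 𝔪.Reg}

theorem locBracket_isPoissonBracket : IsPoissonBracket (𝔪.locBracket z) :=
  liePoisson_isPoissonBracket _

/-- The element `z_i` as a unit of the localization. -/
def locUnit (z : Fin s → 𝔪.Reg) (i : Fin s) : (𝔪.Loc z)ˣ :=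
  (IsLocalization.map_units (𝔪.Loc z)
    (⟨z i, Submonoid.subset_closure ⟨i, rfl⟩⟩ : Submonoid.closure (Set.range z))).unit

theorem coe_locUnit (i : Fin s) : (locUnit z i : 𝔪.Loc z) = algebraMap 𝔪.Reg _ (z i) := rfl

/-- The elements `z_i`, `p_a`, `q_a` of the localization as one family. -/
def darbouxCoord (z : Fin s → 𝔪.Reg) (p q : Fin m → 𝔪.Loc z) :
    Fin s ⊕ (Fin m ⊕ Fin m) → 𝔪.Loc z :=
  Sum.elim (fun i => (locUnit z i : 𝔪.Loc z)) (Sum.elim p q)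

/-- Elements `p_a`, `q_a` that, together with the central elements `z_i`, are coordinates in which
the Poisson bracket of the localization is canonical. -/
structure IsDarboux (z : Fin s → 𝔪.Reg) (p q : Fin m → 𝔪.Loc z) : Prop where
  ne_zero : ∀ i, z i ≠ 0
  central : ∀ i x, 𝔪.locBracket z x (locUnit z i) = 0
  pairs : IsCanonicalPairs (𝔪.locBracket z) p q
  exists_eq : ∀ b, ∃ (e : Fin s → ℕ) (G : MvPolynomial (Fin s ⊕ (Fin m ⊕ Fin m)) K),
    MvPolynomial.aeval (darbouxCoord z p q) G = (∏ i, (locUnit z i : 𝔪.Loc z) ^ e i) * b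
  indep : AlgebraicIndependent K (darbouxCoord z p q)

section toRat

/-- The inclusion of the localization in the field of rational functions. -/
def toRat (hz : ∀ i, z i ≠ 0) : 𝔪.Loc z →ₐ[K] 𝔪.RatFun :=
  IsLocalization.liftAlgHom (M := Submonoid.closure (Set.range z))
    (f := IsScalarTower.toAlgHom K 𝔪.Reg 𝔪.RatFun) (by
      rintro ⟨t, ht⟩
      have h0 : t ∈ nonZeroDivisors 𝔪.Reg := by
        refine (Submonoid.closure_le.mpr ?_ : Submonoid.closure (Set.range z) ≤ _) ht
        rintro _ ⟨i, rfl⟩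
        exact mem_nonZeroDivisors_of_ne_zero (hz i)
      exact (IsLocalization.map_units 𝔪.RatFun (⟨t, h0⟩ : nonZeroDivisors 𝔪.Reg)))

variable (hz : ∀ i, z i ≠ 0)

theorem toRat_algebraMap (F : 𝔪.Reg) :
    toRat hz (algebraMap 𝔪.Reg (𝔪.Loc z) F) = algebraMap 𝔪.Reg 𝔪.RatFun F := by
  rw [toRat, IsLocalization.liftAlgHom_apply]
  exact IsLocalization.lift_eq _ F

theorem toRat_injective : Function.Injective (toRat hz) := by
  rw [injective_iff_map_eq_zero]
  intro b hb
  obtain ⟨F, t, h⟩ := IsLocalization.exists_mk'_eq (Submonoid.closure (Set.range z)) b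
  have h1 : b * algebraMap _ (𝔪.Loc z) (t : 𝔪.Reg) = algebraMap _ _ F := by
    rw [← h, IsLocalization.mk'_spec]
  have h2 := congrArg (toRat hz) h1
  rw [map_mul, hb, zero_mul, toRat_algebraMap] at h2
  have h3 : F = 0 := IsFractionRing.injective 𝔪.Reg 𝔪.RatFun (h2.symm.trans (map_zero _).symm)
  rw [h3, map_zero] at h1
  exact ((IsLocalization.map_units (𝔪.Loc z) t).mul_left_eq_zero).mp h1

theorem toRat_bracket (a b : 𝔪.Loc z) :
    toRat hz (𝔪.locBracket z a b) = 𝔪.bracket (toRat hz a) (toRat hz b) :=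
  liePoisson_map _ _ (toRat hz) (toRat_algebraMap hz) a b

theorem canonicalPairs_of_toRat {ι : Type*} {p q : ι → 𝔪.Loc z}
    (h : IsCanonicalPairs 𝔪.bracket (toRat hz ∘ p) (toRat hz ∘ q)) :
    IsCanonicalPairs (𝔪.locBracket z) p q where
  pp a b := toRat_injective hz ((toRat_bracket hz _ _).trans ((h.pp a b).trans (map_zero (toRat hz)).symm))
  qq a b := toRat_injective hz ((toRat_bracket hz _ _).trans ((h.qq a b).trans (map_zero (toRat hz)).symm))
  pq_self a := toRat_injective hz ((toRat_bracket hz _ _).trans ((h.pq_self a).trans (map_one (toRat hz)).symm))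
  pq_ne a b hab := toRat_injective hz ((toRat_bracket hz _ _).trans ((h.pq_ne a b hab).trans (map_zero (toRat hz)).symm))

theorem central_of_toRat (hz : ∀ i, z i ≠ 0) {i : Fin s} (h : ∀ x, 𝔪.bracket (algebraMap _ _ (z i)) x = 0)
    (x : 𝔪.Loc z) : 𝔪.locBracket z x (locUnit z i) = 0 := by
  apply toRat_injective hz
  rw [toRat_bracket, map_zero, coe_locUnit, toRat_algebraMap, 𝔪.bracket_isPoissonBracket.skew,
    h, neg_zero]

theorem toRat_locUnit_inv (i : Fin s) :
    toRat hz ((locUnit z i)⁻¹ : (𝔪.Loc z)ˣ) = (algebraMap 𝔪.Reg 𝔪.RatFun (z i))⁻¹ := by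
  refine eq_inv_of_mul_eq_one_left ?_
  rw [← toRat_algebraMap hz, ← map_mul, ← coe_locUnit, Units.inv_mul, map_one]

end toRat

theorem adjoin_loc : Algebra.adjoin K ((Set.range fun ξ => algebraMap 𝔪.Reg (𝔪.Loc z) (𝔪.coord ξ)) ∪
    Set.range fun i => (((locUnit z i)⁻¹ : (𝔪.Loc z)ˣ) : 𝔪.Loc z)) = ⊤ := by
  rw [eq_top_iff]
  rintro b -
  have hF : ∀ F : 𝔪.Reg, algebraMap 𝔪.Reg (𝔪.Loc z) F ∈ Algebra.adjoin K
      (Set.range fun ξ => algebraMap 𝔪.Reg (𝔪.Loc z) (𝔪.coord ξ)) := by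
    intro F
    have h1 : IsScalarTower.toAlgHom K 𝔪.Reg (𝔪.Loc z) F ∈ (Algebra.adjoin K
        (Set.range 𝔪.coord)).map (IsScalarTower.toAlgHom K 𝔪.Reg (𝔪.Loc z)) :=
      ⟨F, by rw [adjoin_coord]; trivial, rfl⟩
    rw [AlgHom.map_adjoin, ← Set.range_comp] at h1
    exact h1
  obtain ⟨F, t, rfl⟩ := IsLocalization.exists_mk'_eq (Submonoid.closure (Set.range z)) b
  obtain ⟨t, ht⟩ := t
  have key : ∃ c ∈ Algebra.adjoin K ((Set.range fun ξ => algebraMap 𝔪.Reg (𝔪.Loc z) (𝔪.coord ξ)) ∪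
    Set.range fun i => (((locUnit z i)⁻¹ : (𝔪.Loc z)ˣ) : 𝔪.Loc z)), algebraMap _ _ t * c = 1 := by
    induction ht using Submonoid.closure_induction with
    | mem x hx =>
      obtain ⟨i, rfl⟩ := hx
      exact ⟨_, Algebra.subset_adjoin (Or.inr ⟨i, rfl⟩), (locUnit z i).mul_inv⟩
    | one => exact ⟨1, one_mem _, by rw [map_one, one_mul]⟩
    | mul x y _ _ hx hy =>
      obtain ⟨c, hc, h1⟩ := hx
      obtain ⟨d, hd, h2⟩ := hy
      exact ⟨c * d, mul_mem hc hd, by rw [map_mul, mul_mul_mul_comm, h1, h2, one_mul]⟩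
  obtain ⟨c, hc, h1⟩ := key
  have : IsLocalization.mk' (𝔪.Loc z) F ⟨t, ht⟩ = algebraMap _ _ F * c := by
    rw [IsLocalization.mk'_eq_iff_eq_mul, mul_assoc, mul_comm c, h1, mul_one]
  rw [this]
  exact mul_mem (Algebra.adjoin_mono Set.subset_union_left (hF F)) hc

/-- Elements that generate the same algebra as the coordinates, once the `z_i` are inverted, become
polynomials in these elements after multiplication by a monomial in the `z_i`. -/
theorem exists_eq_of_mem {p q : Fin m → 𝔪.Loc z} {b : 𝔪.Loc z}
    (hb : b ∈ Algebra.adjoin K (Set.range (darbouxCoord z p q) ∪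
      Set.range fun i => (((locUnit z i)⁻¹ : (𝔪.Loc z)ˣ) : 𝔪.Loc z))) :
    ∃ (e : Fin s → ℕ) (G : MvPolynomial (Fin s ⊕ (Fin m ⊕ Fin m)) K),
      MvPolynomial.aeval (darbouxCoord z p q) G = (∏ i, (locUnit z i : 𝔪.Loc z) ^ e i) * b := by
  induction hb using Algebra.adjoin_induction with
  | mem x hx =>
    rcases hx with ⟨a, rfl⟩ | ⟨i, rfl⟩
    · exact ⟨0, MvPolynomial.X a, by simp⟩
    · refine ⟨Pi.single i 1, 1, ?_⟩
      rw [map_one, Finset.prod_eq_single i (fun j _ hj => by simp [hj]) (by simp)]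
      simp
  | algebraMap c => exact ⟨0, MvPolynomial.C c, by simp⟩
  | add x y _ _ hx hy =>
    obtain ⟨e, G, h⟩ := hx
    obtain ⟨e', G', h'⟩ := hy
    have hX : ∀ i, MvPolynomial.aeval (darbouxCoord z p q) (MvPolynomial.X (Sum.inl i) :
      MvPolynomial (Fin s ⊕ (Fin m ⊕ Fin m)) K) = (locUnit z i : 𝔪.Loc z) := fun i => by
        rw [MvPolynomial.aeval_X]; rfl
    refine ⟨e + e', (∏ i, MvPolynomial.X (Sum.inl i) ^ e' i) * G +
      (∏ i, MvPolynomial.X (Sum.inl i) ^ e i) * G', ?_⟩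
    simp only [map_add, map_mul, map_prod, map_pow, hX, h, h', Pi.add_apply,
      pow_add, Finset.prod_mul_distrib]
    ring
  | mul x y _ _ hx hy =>
    obtain ⟨e, G, h⟩ := hx
    obtain ⟨e', G', h'⟩ := hy
    refine ⟨e + e', G * G', ?_⟩
    simp only [map_mul, h, h', Pi.add_apply, pow_add, Finset.prod_mul_distrib]
    ring

section Count

theorem isAlgebraic_adjoin_of_coord {ι : Type*} {x : ι → 𝔪.RatFun}
    (hx : ∀ ξ, 𝔪.ratCoord ξ ∈ IntermediateField.adjoin K (Set.range x)) :
    Algebra.IsAlgebraic (Algebra.adjoin K (Set.range x)) 𝔪.RatFun := by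
  rw [← IntermediateField.isAlgebraic_adjoin_iff_top]
  have hF : ∀ F : 𝔪.Reg, algebraMap 𝔪.Reg 𝔪.RatFun F ∈ IntermediateField.adjoin K (Set.range x) := by
    intro F
    have h1 : F ∈ Algebra.adjoin K (𝔪.coord '' Set.univ) := by
      rw [Set.image_univ, adjoin_coord]; trivial
    refine (Algebra.adjoin_le ?_ : _ ≤ (IntermediateField.adjoin K (Set.range x)).toSubalgebra)
      (algebraMap_mem_adjoin h1)
    rintro _ ⟨ξ, -, rfl⟩
    exact hx ξ
  refine ⟨fun f => ?_⟩
  obtain ⟨a, b, -, rfl⟩ := IsFractionRing.div_surjective (A := 𝔪.Reg) f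
  exact isAlgebraic_algebraMap
    (⟨_, div_mem (hF a) (hF b)⟩ : IntermediateField.adjoin K (Set.range x))

theorem coord_mem_field {p q : Fin m → 𝔪.Loc z} (hz : ∀ i, z i ≠ 0)
    (h : ∀ b, ∃ (e : Fin s → ℕ) (G : MvPolynomial (Fin s ⊕ (Fin m ⊕ Fin m)) K),
    MvPolynomial.aeval (darbouxCoord z p q) G = (∏ i, (locUnit z i : 𝔪.Loc z) ^ e i) * b) (ξ : Root n) :
    𝔪.ratCoord ξ ∈ IntermediateField.adjoin K (Set.range (toRat hz ∘ darbouxCoord z p q)) := by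
  obtain ⟨e, G, hG⟩ := h (algebraMap _ _ (𝔪.coord ξ))
  have h1 := congrArg (toRat hz) hG
  rw [map_mul, toRat_algebraMap, map_prod, MvPolynomial.comp_aeval_apply] at h1
  have h2 : ∏ i, toRat hz ((locUnit z i : 𝔪.Loc z) ^ e i) ≠ 0 :=
    Finset.prod_ne_zero_iff.mpr fun i _ => ((locUnit z i).isUnit.pow _).map (toRat hz) |>.ne_zero
  have h3 : 𝔪.ratCoord ξ = MvPolynomial.aeval (toRat hz ∘ darbouxCoord z p q) G /
      ∏ i, toRat hz ((locUnit z i : 𝔪.Loc z) ^ e i) :=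
    eq_div_of_mul_eq h2 ((mul_comm _ _).trans h1.symm)
  rw [h3]
  refine div_mem ?_ (prod_mem fun i _ => ?_)
  · have h4 : MvPolynomial.aeval (toRat hz ∘ darbouxCoord z p q) G ∈
        Algebra.adjoin K (Set.range (toRat hz ∘ darbouxCoord z p q)) := by
      rw [Algebra.adjoin_range_eq_range_aeval]
      exact AlgHom.mem_range_self _ G
    exact IntermediateField.algebra_adjoin_le_adjoin K _ h4
  · rw [map_pow]
    refine pow_mem (IntermediateField.subset_adjoin K _ ?_) _
    exact Set.mem_range_self (f := toRat hz ∘ darbouxCoord z p q) (Sum.inl i)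

/-- Darboux coordinates form a transcendence basis of the field of rational functions. -/
theorem IsDarboux.isTranscendenceBasis {p q : Fin m → 𝔪.Loc z} (h : IsDarboux z p q) :
    IsTranscendenceBasis K (toRat h.ne_zero ∘ darbouxCoord z p q) := by
  have := isAlgebraic_adjoin_of_coord (coord_mem_field h.ne_zero h.exists_eq)
  exact (h.indep.map' (toRat_injective h.ne_zero)).isTranscendenceBasis_iff_isAlgebraic.mpr this

theorem IsDarboux.card_eq {p q : Fin m → 𝔪.Loc z} (h : IsDarboux z p q) :
    s + 2 * m = Fintype.card {ξ // ξ ∉ 𝔪.M} := by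
  have h1 := h.isTranscendenceBasis.lift_cardinalMk_eq_trdeg
  rw [trdeg_ratFun, Cardinal.mk_fintype, Cardinal.lift_natCast, Cardinal.lift_natCast,
    Nat.cast_inj] at h1
  simp only [Fintype.card_sum, Fintype.card_fin] at h1
  omega

/-- If there are few enough generators, their algebraic independence is automatic. -/
theorem algebraicIndependent_of_card {p q : Fin m → 𝔪.Loc z} (hz : ∀ i, z i ≠ 0)
    (h : ∀ b, ∃ (e : Fin s → ℕ) (G : MvPolynomial (Fin s ⊕ (Fin m ⊕ Fin m)) K),
      MvPolynomial.aeval (darbouxCoord z p q) G = (∏ i, (locUnit z i : 𝔪.Loc z) ^ e i) * b)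
    (hc : s + 2 * m ≤ Fintype.card {ξ // ξ ∉ 𝔪.M}) :
    AlgebraicIndependent K (darbouxCoord z p q) := by
  have := isAlgebraic_adjoin_of_coord (coord_mem_field hz h)
  refine AlgebraicIndependent.of_comp (toRat hz) ?_
  have h1 := Algebra.IsAlgebraic.isTranscendenceBasis_of_lift_le_trdeg_of_finite K (toRat hz ∘ darbouxCoord z p q) ?_
  · exact h1.1
  · rw [trdeg_ratFun, Cardinal.mk_fintype, Cardinal.lift_natCast, Cardinal.lift_natCast,
      Nat.cast_le]
    simp only [Fintype.card_sum, Fintype.card_fin]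
    omega

end Count

/-- The construction, carried out until no place is empty, yields Darboux coordinates. -/
theorem exists_isDarboux {D : Diagram n} {z : ℕ → 𝔪.Reg} {r : ℕ} {ι : Type} [Fintype ι]
    {p q : ι → 𝔪.RatFun} {w : Fin n → Fin n → 𝔪.RatFun} (h : 𝔪.IsStage D z r p q w)
    (hD : ∀ ξ, D ξ ≠ none) :
    ∃ (m : ℕ) (P Q : Fin m → 𝔪.Loc fun i : Fin r => z i),
      IsDarboux (fun i : Fin r => z i) P Q := by
  have hz : ∀ i : Fin r, z i ≠ 0 := fun i => h.ne_zero i i.2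
  have hw : ∀ i j, w i j = 0 := fun i j => h.units.zero fun hij => hD _ hij.2
  have hsub : Algebra.adjoin K (Set.range 𝔪.ratCoord ∪ 𝔪.invs z r) ≤
      (toRat hz).range := by
    refine Algebra.adjoin_le ?_
    rintro _ (⟨ξ, rfl⟩ | ⟨j, hj, rfl⟩)
    · exact ⟨_, toRat_algebraMap hz _⟩
    · exact ⟨_, toRat_locUnit_inv hz ⟨j, hj⟩⟩
  choose P hP using fun a => hsub (h.p_mem a)
  choose Q hQ using fun a => hsub (h.q_mem a)
  replace hP : ∀ a, toRat hz (P a) = p a := hP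
  replace hQ : ∀ a, toRat hz (Q a) = q a := hQ
  have hinj := toRat_injective hz
  let σ := (Fintype.equivFin ι).symm
  have hgen : ∀ b, ∃ (e : Fin r → ℕ)
      (G : MvPolynomial (Fin r ⊕ (Fin (Fintype.card ι) ⊕ Fin (Fintype.card ι))) K),
      MvPolynomial.aeval (darbouxCoord (fun i : Fin r => z i) (P ∘ σ) (Q ∘ σ)) G =
        (∏ i, (locUnit (fun i : Fin r => z i) i : 𝔪.Loc _) ^ e i) * b := by
    intro b
    refine exists_eq_of_mem ?_
    have hb : b ∈ Algebra.adjoin K ((Set.range fun ξ => algebraMap 𝔪.Reg (𝔪.Loc _) (𝔪.coord ξ)) ∪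
      Set.range fun i => (((locUnit (fun i : Fin r => z i) i)⁻¹ : (𝔪.Loc _)ˣ) : 𝔪.Loc _)) := by
      rw [adjoin_loc]; trivial
    refine (Algebra.adjoin_le ?_ : _ ≤ Algebra.adjoin K _) hb
    rintro _ (⟨ξ, rfl⟩ | ⟨i, rfl⟩)
    · have h1 := h.coord_mem ξ
      have h2 : Algebra.adjoin K (𝔪.gens z r p q w) ≤ (Algebra.adjoin K
          (Set.range (darbouxCoord (fun i : Fin r => z i) (P ∘ σ) (Q ∘ σ)) ∪ Set.range fun i =>
            (((locUnit (fun i : Fin r => z i) i)⁻¹ : (𝔪.Loc _)ˣ) : 𝔪.Loc _))).map (toRat hz) := by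
        refine Algebra.adjoin_le ?_
        rintro _ ((((⟨j, hj, rfl⟩ | ⟨j, hj, rfl⟩) | ⟨a, rfl⟩) | ⟨a, rfl⟩) | ⟨ij, rfl⟩)
        · exact ⟨_, Algebra.subset_adjoin (Or.inl ⟨Sum.inl ⟨j, hj⟩, rfl⟩), toRat_algebraMap hz _⟩
        · exact ⟨_, Algebra.subset_adjoin (Or.inr ⟨⟨j, hj⟩, rfl⟩), toRat_locUnit_inv hz ⟨j, hj⟩⟩
        · refine ⟨P a, Algebra.subset_adjoin (Or.inl ⟨Sum.inr (Sum.inl (σ.symm a)), ?_⟩), hP a⟩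
          simp [darbouxCoord]
        · refine ⟨Q a, Algebra.subset_adjoin (Or.inl ⟨Sum.inr (Sum.inr (σ.symm a)), ?_⟩), hQ a⟩
          simp [darbouxCoord]
        · have h5 : (fun ij : Fin n × Fin n => w ij.1 ij.2) ij = 0 := hw ij.1 ij.2
          rw [h5]
          exact zero_mem (Subalgebra.map (toRat hz) (Algebra.adjoin K _))
      obtain ⟨c, hc, h3⟩ := h2 h1
      have h4 : c = algebraMap 𝔪.Reg _ (𝔪.coord ξ) :=
        hinj (h3.trans (toRat_algebraMap hz _).symm)
      subst h4
      exact hc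
    · exact Algebra.subset_adjoin (Or.inr ⟨i, rfl⟩)
  refine ⟨Fintype.card ι, P ∘ σ, Q ∘ σ, hz, ?_, ?_, hgen, algebraicIndependent_of_card hz hgen ?_⟩
  · exact fun i => central_of_toRat hz (h.central i i.2)
  · refine canonicalPairs_of_toRat hz ?_
    have h1 : toRat hz ∘ P = p := funext hP
    have h2 : toRat hz ∘ Q = q := funext hQ
    rw [← Function.comp_assoc, ← Function.comp_assoc, h1, h2]
    exact ⟨fun a b => h.pairs.pp _ _, fun a b => h.pairs.qq _ _, fun a => h.pairs.pq_self _,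
      fun a b hab => h.pairs.pq_ne _ _ fun h0 => hab (σ.injective h0)⟩
  · have := h.card_le
    omega

section Decomposition

/-- Darboux coordinates yield an isomorphism with `K[Z^±] ⊗ 𝔸_m`. -/
theorem IsDarboux.exists_equiv {p q : Fin m → 𝔪.Loc z} (h : IsDarboux z p q) :
    ∃ φ : 𝔪.Loc z ≃ₐ[K] Laurent K s ⊗[K] PolyPQ K m,
      (∀ i, φ (algebraMap 𝔪.Reg _ (z i)) = Laurent.var K i ⊗ₜ[K] 1) ∧
      ∀ a b, φ (liePoisson _ (Submonoid.closure (Set.range z)) a b) =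
        tensorBracket 0 (bracketPQ K m) (φ a) (φ b) := by
  let Ψ := fromModel K (locUnit z) p q
  have hmon : ∀ (e : Fin s → ℕ) T, Ψ ((∏ i, modelCoord K s m (Sum.inl i) ^ e i) * T) =
      (∏ i, (locUnit z i : 𝔪.Loc z) ^ e i) * Ψ T := by
    intro e T
    rw [map_mul, map_prod]
    congr 1
    refine Finset.prod_congr rfl fun i _ => ?_
    rw [map_pow, fromModel_modelCoord]
    rfl
  have hu : ∀ e : Fin s → ℕ, IsUnit (∏ i, (locUnit z i : 𝔪.Loc z) ^ e i) := fun e =>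
    IsUnit.prod_univ_iff.mpr fun i => (locUnit z i).isUnit.pow _
  have hvar : ∀ i : Fin s, IsUnit (modelCoord K s m (Sum.inl i)) := by
    intro i
    refine IsUnit.of_mul_eq_one (AddMonoidAlgebra.single (Pi.single i (-1)) 1 ⊗ₜ 1) ?_
    change (AddMonoidAlgebra.single (Pi.single i 1) 1 ⊗ₜ 1) * _ = _
    rw [Algebra.TensorProduct.tmul_mul_tmul, AddMonoidAlgebra.single_mul_single, ← Pi.single_add]
    simp [AddMonoidAlgebra.one_def, Algebra.TensorProduct.one_def]
  have hbij : Function.Bijective Ψ := by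
    constructor
    · rw [injective_iff_map_eq_zero]
      intro T hT
      obtain ⟨e, G, hG⟩ := exists_modelCoord_eq T
      have h1 := congrArg Ψ hG
      rw [hmon, hT, mul_zero] at h1
      have h2 : MvPolynomial.aeval (darbouxCoord z p q) G = 0 :=
        (fromModel_aeval (locUnit z) p q G).symm.trans h1
      rw [(algebraicIndependent_iff.mp h.indep) G h2, map_zero] at hG
      have hv : IsUnit (∏ i : Fin s, modelCoord K s m (Sum.inl i) ^ e i) :=
        IsUnit.prod_univ_iff.mpr fun i => (hvar i).pow _
      exact (hv.mul_right_eq_zero).mp hG.symm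
    · intro b
      obtain ⟨e, G, hG⟩ := h.exists_eq b
      have hv : IsUnit (∏ i : Fin s, modelCoord K s m (Sum.inl i) ^ e i) :=
        IsUnit.prod_univ_iff.mpr fun i => (hvar i).pow _
      obtain ⟨v, hv⟩ := hv
      refine ⟨↑v⁻¹ * MvPolynomial.aeval (modelCoord K s m) G, (hu e).mul_left_cancel ?_⟩
      rw [← hmon, ← hv, ← mul_assoc, Units.mul_inv, one_mul, ← hG]
      exact fromModel_aeval (locUnit z) p q G
  let ψ := AlgEquiv.ofBijective Ψ hbij
  refine ⟨ψ.symm, fun i => ?_, fun a b => ?_⟩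
  · rw [AlgEquiv.symm_apply_eq]
    exact (fromModel_modelCoord (locUnit z) p q (Sum.inl i)).symm
  · rw [AlgEquiv.symm_apply_eq]
    have h1 := fromModel_tensorBracket (locUnit z) p q locBracket_isPoissonBracket h.central h.pairs
      (ψ.symm a) (ψ.symm b)
    refine Eq.trans ?_ h1.symm
    change _ = 𝔪.locBracket z (ψ (ψ.symm a)) (ψ (ψ.symm b))
    rw [AlgEquiv.apply_symm_apply, AlgEquiv.apply_symm_apply]
    rfl

/-- An isomorphism with `K[Z^±] ⊗ 𝔸_m` yields Darboux coordinates. -/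
theorem isDarboux_of_equiv [Infinite K] (φ : 𝔪.Loc z ≃ₐ[K] Laurent K s ⊗[K] PolyPQ K m)
    (h1 : ∀ i, φ (algebraMap 𝔪.Reg _ (z i)) = Laurent.var K i ⊗ₜ[K] 1)
    (h2 : ∀ a b, φ (𝔪.locBracket z a b) = tensorBracket 0 (bracketPQ K m) (φ a) (φ b))
    (p q : Fin m → 𝔪.Loc z) (hp : ∀ a, φ (p a) = 1 ⊗ₜ MvPolynomial.X (Sum.inl a))
    (hq : ∀ a, φ (q a) = 1 ⊗ₜ MvPolynomial.X (Sum.inr a)) : IsDarboux z p q := by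
  have hX := bracketPQ_pairs (K := K) (m := m)
  have hcoord : ∀ a, φ (darbouxCoord z p q a) = modelCoord K s m a := by
    rintro (i | a | a)
    · exact h1 i
    · exact hp a
    · exact hq a
  have hind : AlgebraicIndependent K (darbouxCoord z p q) := by
    refine AlgebraicIndependent.of_comp (φ : 𝔪.Loc z →ₐ[K] Laurent K s ⊗[K] PolyPQ K m) ?_
    have := algebraicIndependent_modelCoord (K := K) (s := s) (m := m)
    rwa [← funext hcoord] at this
  have h3 : ∀ a b l l' {F G H}, φ a = l ⊗ₜ F → φ b = l' ⊗ₜ G → (bracketPQ K m F G = H) →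
      φ (𝔪.locBracket z a b) = (l * l') ⊗ₜ H := by
    intro a b l l' F G H ha hb hH
    rw [h2, ha, hb, tensorBracket_tmul, hH]
  refine ⟨?_, ?_, ?_, ?_, hind⟩
  · intro i hi
    refine hind.ne_zero (Sum.inl i) ?_
    change algebraMap 𝔪.Reg (𝔪.Loc z) (z i) = 0
    rw [hi, map_zero]
  · intro i x
    apply φ.injective
    rw [h2, coe_locUnit, h1, map_zero]
    induction φ x using TensorProduct.induction_on with
    | zero => rw [map_zero, LinearMap.zero_apply]
    | add A B hA hB => rw [map_add, LinearMap.add_apply, hA, hB, add_zero]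
    | tmul l b =>
      rw [tensorBracket_tmul, bracketPQ_isPoissonBracket.one_right, TensorProduct.tmul_zero]
  · constructor
    · intro a b; apply φ.injective
      rw [h3 _ _ _ _ (hp a) (hp b) (hX.pp a b), TensorProduct.tmul_zero, map_zero]
    · intro a b; apply φ.injective
      rw [h3 _ _ _ _ (hq a) (hq b) (hX.qq a b), TensorProduct.tmul_zero, map_zero]
    · intro a; apply φ.injective
      rw [h3 _ _ _ _ (hp a) (hq a) (hX.pq_self a), mul_one, map_one]; rfl
    · intro a b hab; apply φ.injective
      rw [h3 _ _ _ _ (hp a) (hq b) (hX.pq_ne a b hab), TensorProduct.tmul_zero, map_zero]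
  · intro b
    obtain ⟨e, G, hG⟩ := exists_modelCoord_eq (φ b)
    refine ⟨e, G, φ.injective ?_⟩
    have h4 : φ (MvPolynomial.aeval (darbouxCoord z p q) G) =
        MvPolynomial.aeval (modelCoord K s m) G := by
      rw [← funext hcoord]
      exact MvPolynomial.comp_aeval_apply (φ := (φ : 𝔪.Loc z →ₐ[K] Laurent K s ⊗[K] PolyPQ K m)) ..
    rw [h4, hG, map_mul, map_prod]
    congr 1
    refine Finset.prod_congr rfl fun i _ => ?_
    rw [map_pow, ← hcoord]
    rfl

end Decomposition

end RootIdeal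

/-! ### Matrices concentrated in one column -/

section Column

attribute [local instance 100] LieRing.ofAssociativeRing

variable {K : Type*} [Field K] {n : ℕ}

/-- The elements of `𝔫` that are concentrated in the column `k`. -/
def IsColumn (k : Fin n) (X : ut K n) : Prop :=
  ∀ i j, j ≠ k → (X : Matrix (Fin n) (Fin n) K) i j = 0

theorem IsColumn.smul {k : Fin n} {X : ut K n} (h : IsColumn k X) (c : K) : IsColumn k (c • X) := by
  intro i j hj
  change c • (X : Matrix (Fin n) (Fin n) K) i j = 0
  rw [h i j hj, smul_zero]

theorem isColumn_rootVec (ξ : Root n) : IsColumn ξ.col (rootVec K ξ) := by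
  intro i j hj
  exact Matrix.single_apply_of_col_ne _ _ (Ne.symm hj) _

theorem IsColumn.mul_mul {k : Fin n} {X : ut K n} (h : IsColumn k X) {y : Matrix (Fin n) (Fin n) K}
    (hy : ∀ i j, i < j → y i j = 0) :
    (X : Matrix (Fin n) (Fin n) K) * y * (X : Matrix (Fin n) (Fin n) K) = 0 := by
  ext i l
  rw [Matrix.mul_apply]
  refine Finset.sum_eq_zero fun j _ => ?_
  by_cases hjk : k < j
  · rw [Matrix.mul_apply, Finset.sum_eq_zero, zero_mul]
    intro r _
    by_cases hr : r = k
    · rw [hr, hy k j hjk, mul_zero]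
    · rw [h i r hr, zero_mul]
  · by_cases hl : l = k
    · rw [hl, X.2 j k (not_lt.mp hjk), mul_zero]
    · rw [h j l hl, mul_zero]

theorem IsColumn.mul_self {k : Fin n} {X : ut K n} (h : IsColumn k X) :
    (X : Matrix (Fin n) (Fin n) K) * (X : Matrix (Fin n) (Fin n) K) = 0 := by
  have := h.mul_mul (y := 1) fun i j hij => Matrix.one_apply_ne hij.ne
  rwa [mul_one] at this

/-- The group element `1 + X` for `X` concentrated in one column; its inverse is `1 - X`. -/
def IsColumn.unit {k : Fin n} {X : ut K n} (h : IsColumn k X) : UT K n :=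
  ⟨⟨1 + X, 1 - X, by
    have := h.mul_self
    calc _ = 1 - (X : Matrix (Fin n) (Fin n) K) * X := by noncomm_ring
      _ = 1 := by rw [this, sub_zero], by
    have := h.mul_self
    calc _ = 1 - (X : Matrix (Fin n) (Fin n) K) * X := by noncomm_ring
      _ = 1 := by rw [this, sub_zero]⟩, by
    change (1 + (X : Matrix (Fin n) (Fin n) K)) - 1 ∈ ut K n
    rw [add_sub_cancel_left]; exact X.2⟩

theorem IsColumn.mat_unit {k : Fin n} {X : ut K n} (h : IsColumn k X) :
    UT.mat h.unit = 1 + (X : Matrix (Fin n) (Fin n) K) := rfl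

theorem IsColumn.mat_unit_inv {k : Fin n} {X : ut K n} (h : IsColumn k X) :
    UT.mat h.unit⁻¹ = 1 - (X : Matrix (Fin n) (Fin n) K) := rfl

theorem IsColumn.adN_unit {k : Fin n} {X : ut K n} (h : IsColumn k X) (y : ut K n) :
    adN h.unit y = y + ⁅X, y⁆ := by
  apply Subtype.ext
  rw [coe_adN, h.mat_unit, h.mat_unit_inv]
  change _ = (y : Matrix (Fin n) (Fin n) K) + ((⁅X, y⁆ : ut K n) : Matrix (Fin n) (Fin n) K)
  rw [LieSubalgebra.coe_bracket, Ring.lie_def]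
  have h0 := h.mul_mul (lower_of_mem_ut y.2)
  calc _ = (y : Matrix (Fin n) (Fin n) K) + (X * y - y * X) -
        (X : Matrix (Fin n) (Fin n) K) * y * X := by noncomm_ring
    _ = _ := by rw [h0, sub_zero]

/-- Elements concentrated in one column have square zero as derivations. -/
theorem IsColumn.lie_lie {k : Fin n} {X : ut K n} (h : IsColumn k X) (y : ut K n) :
    ⁅X, ⁅X, y⁆⁆ = 0 := by
  apply Subtype.ext
  rw [LieSubalgebra.coe_bracket, LieSubalgebra.coe_bracket, Ring.lie_def, Ring.lie_def]
  have h0 := h.mul_mul (lower_of_mem_ut y.2)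
  have h1 := h.mul_self
  calc _ = (X : Matrix (Fin n) (Fin n) K) * X * y - 2 • ((X : Matrix (Fin n) (Fin n) K) * y * X) +
        (y : Matrix (Fin n) (Fin n) K) * (X * X) := by noncomm_ring
    _ = 0 := by rw [h0, h1]; simp

/-- The elements `1 + X` with `X` concentrated in one column generate `UT(n, K)`: multiplication by
such elements clears the columns from left to right. -/
theorem UT.column_induction {P : UT K n → Prop} (one : P 1)
    (mul : ∀ (k : Fin n) (X : ut K n) (h : IsColumn k X) (g : UT K n), P g → P (h.unit * g))
    (g : UT K n) : P g := by
  have key : ∀ d : ℕ, ∀ g : UT K n,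
      (∀ i j : Fin n, (j : ℕ) + d < n → (UT.mat g - 1) i j = 0) → P g := by
    intro d
    induction d with
    | zero =>
      intro g hg
      have h1 : g = 1 := by
        apply Subtype.ext
        apply Units.ext
        refine sub_eq_zero.mp ?_
        ext i j
        exact hg i j j.2
      rw [h1]; exact one
    | succ d ih =>
      intro g hg
      by_cases hd : d < n
      · let k : Fin n := ⟨n - 1 - d, by omega⟩
        let X : ut K n := ⟨Matrix.of fun i j => if j = k then (UT.mat g - 1) i k else 0, by
          intro i j hij
          rw [Matrix.of_apply]
          split_ifs with h
          · exact UT.sub_one_mem g i k (h ▸ hij)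
          · rfl⟩
        have hXe : ∀ i j, (X : Matrix (Fin n) (Fin n) K) i j =
            if j = k then (UT.mat g - 1) i k else 0 := fun i j => rfl
        have hX : IsColumn k X := fun i j hj => by rw [hXe, if_neg hj]
        -- `X` has its entries in the column `k`, and the row `k` of `g` is that of the unit matrix, since
        -- the columns before `k` are already cleared.
        have hXg : (X : Matrix (Fin n) (Fin n) K) * UT.mat g = X := by
          ext i j
          rw [Matrix.mul_apply, Finset.sum_eq_single k]
          · rcases lt_trichotomy j k with hjk | hjk | hjk
            · have h1 := hg k j (by
                have : (j : ℕ) < n - 1 - d := hjk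
                omega)
              rw [Matrix.sub_apply, Matrix.one_apply_ne hjk.ne', sub_zero] at h1
              rw [h1, mul_zero, hX i j hjk.ne]
            · subst hjk
              have h1 := UT.sub_one_mem g k k le_rfl
              rw [Matrix.sub_apply, Matrix.one_apply_eq, sub_eq_zero] at h1
              change _ * UT.mat g k k = _
              rw [h1, mul_one]
            · have h1 := UT.sub_one_mem g k j hjk.le
              rw [Matrix.sub_apply, Matrix.one_apply_ne hjk.ne, sub_zero] at h1
              rw [h1, mul_zero, hX i j hjk.ne']
          · intro l _ hl; rw [hX i l hl, zero_mul]
          · simp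
        have h2 : P (hX.unit⁻¹ * g) := by
          refine ih _ fun i j hj => ?_
          rw [UT.mat_mul, hX.mat_unit_inv, sub_mul, one_mul, hXg]
          have h3 : (UT.mat g - X - 1) i j = (UT.mat g - 1) i j -
              (X : Matrix (Fin n) (Fin n) K) i j := by
            simp only [Matrix.sub_apply]; ring
          rw [h3, hXe]
          split_ifs with h
          · rw [h, sub_self]
          · rw [sub_zero]
            refine hg i j ?_
            have : (j : ℕ) ≠ n - 1 - d := fun h' => h (Fin.ext h')
            omega
        have h4 := mul k X hX _ h2
        rwa [mul_inv_cancel_left] at h4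
      · exact ih g fun i j hj => absurd hj (by omega)
  exact key n g fun i j hj => absurd hj (by omega)

end Column

/-! ### The flow of an element of square zero -/

section Flow

variable {K : Type*} [Field K] {𝔤 : Type*} [LieRing 𝔤] [LieAlgebra K 𝔤]

variable (K 𝔤) in
/-- The Poisson bracket of `S(𝔤)`. -/
def symBracket : SymmetricAlgebra K 𝔤 →ₗ[K] SymmetricAlgebra K 𝔤 →ₗ[K] SymmetricAlgebra K 𝔤 :=
  liePoisson (SymmetricAlgebra K 𝔤) (IsUnit.submonoid (SymmetricAlgebra K 𝔤))

theorem symBracket_isPoissonBracket : IsPoissonBracket (symBracket K 𝔤) :=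
  liePoisson_isPoissonBracket _

theorem symBracket_ι (x y : 𝔤) :
    symBracket K 𝔤 (SymmetricAlgebra.ι K 𝔤 x) (SymmetricAlgebra.ι K 𝔤 y) =
      SymmetricAlgebra.ι K 𝔤 ⁅x, y⁆ :=
  liePoisson_ι (B := SymmetricAlgebra K 𝔤) (IsUnit.submonoid _) x y

theorem algebraMap_symBracket {C : Type*} [CommRing C] [Algebra K C]
    [Algebra (SymmetricAlgebra K 𝔤) C] [IsScalarTower K (SymmetricAlgebra K 𝔤) C]
    (Z : Submonoid (SymmetricAlgebra K 𝔤)) [IsLocalization Z C] (a b : SymmetricAlgebra K 𝔤) :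
    algebraMap _ C (symBracket K 𝔤 a b) = liePoisson C Z (algebraMap _ C a) (algebraMap _ C b) :=
  liePoisson_map (B := SymmetricAlgebra K 𝔤) (C := C) _ _
    (IsScalarTower.toAlgHom K (SymmetricAlgebra K 𝔤) C) (fun _ => rfl) a b

variable (K) in
/-- The homomorphism `exp(T {x, ·})` in the case `(ad x)² = 0`: the linear function `y` is mapped to
`y + T [x, y]`. -/
def flow (x : 𝔤) : SymmetricAlgebra K 𝔤 →ₐ[K] Polynomial (SymmetricAlgebra K 𝔤) :=
  SymmetricAlgebra.lift
    ((Algebra.ofId (SymmetricAlgebra K 𝔤) (Polynomial _)).toLinearMap.restrictScalars K ∘ₗ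
        SymmetricAlgebra.ι K 𝔤 +
      (Polynomial.monomial 1).restrictScalars K ∘ₗ SymmetricAlgebra.ι K 𝔤 ∘ₗ
        (LieAlgebra.ad K 𝔤 x : 𝔤 →ₗ[K] 𝔤))

theorem flow_ι (x y : 𝔤) : flow K x (SymmetricAlgebra.ι K 𝔤 y) =
    Polynomial.C (SymmetricAlgebra.ι K 𝔤 y) +
      Polynomial.monomial 1 (SymmetricAlgebra.ι K 𝔤 ⁅x, y⁆) := by
  rw [flow, SymmetricAlgebra.lift_ι_apply]
  rfl

theorem coeff_zero_flow (x : 𝔤) (F : SymmetricAlgebra K 𝔤) : (flow K x F).coeff 0 = F := by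
  induction F using SymmetricAlgebra.induction with
  | algebraMap c =>
    rw [AlgHom.commutes, Polynomial.algebraMap_apply, Polynomial.coeff_C_zero]
  | ι y => rw [flow_ι, Polynomial.coeff_add, Polynomial.coeff_C_zero,
      Polynomial.coeff_monomial_of_ne _ (by norm_num), add_zero]
  | mul a b ha hb => rw [map_mul, Polynomial.mul_coeff_zero, ha, hb]
  | add a b ha hb => rw [map_add, Polynomial.coeff_add, ha, hb]

theorem coeff_one_flow (x : 𝔤) (F : SymmetricAlgebra K 𝔤) :
    (flow K x F).coeff 1 = symBracket K 𝔤 (SymmetricAlgebra.ι K 𝔤 x) F := by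
  have hb := symBracket_isPoissonBracket (K := K) (𝔤 := 𝔤)
  induction F using SymmetricAlgebra.induction with
  | algebraMap c =>
    rw [AlgHom.commutes, Polynomial.algebraMap_apply, Polynomial.coeff_C, if_neg one_ne_zero,
      hb.algebraMap_right]
  | ι y => rw [flow_ι, Polynomial.coeff_add, Polynomial.coeff_C, if_neg one_ne_zero,
      Polynomial.coeff_monomial_same, zero_add, symBracket_ι]
  | mul a b ha hb' =>
    rw [map_mul, Polynomial.mul_coeff_one, ha, hb', coeff_zero_flow, coeff_zero_flow,
      hb.mul_right, mul_comm (symBracket K 𝔤 _ a)]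
  | add a b ha hb' => rw [map_add, Polynomial.coeff_add, ha, hb', map_add]

theorem derivative_flow {x : 𝔤} (hx : ∀ y : 𝔤, ⁅x, ⁅x, y⁆⁆ = 0) (F : SymmetricAlgebra K 𝔤) :
    Polynomial.derivative (flow K x F) =
      flow K x (symBracket K 𝔤 (SymmetricAlgebra.ι K 𝔤 x) F) := by
  have hb := symBracket_isPoissonBracket (K := K) (𝔤 := 𝔤)
  induction F using SymmetricAlgebra.induction with
  | algebraMap c =>
    rw [AlgHom.commutes, Polynomial.algebraMap_apply, Polynomial.derivative_C,
      hb.algebraMap_right, map_zero]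
  | ι y => rw [flow_ι, Polynomial.derivative_add, Polynomial.derivative_C, symBracket_ι,
      flow_ι, hx, map_zero, map_zero, Polynomial.derivative_monomial]; simp
  | mul a b ha hb' =>
    rw [map_mul, Polynomial.derivative_mul, ha, hb', hb.mul_right, map_add, map_mul, map_mul,
      add_comm, mul_comm (flow K x (symBracket K 𝔤 _ a))]
  | add a b ha hb' => rw [map_add, Polynomial.derivative_add, ha, hb', map_add, map_add]

/-- An automorphism that maps `y` to `y + c [x, y]` is given by the values of the flow. -/
theorem eval_flow {x : 𝔤} {c : K} (α : SymmetricAlgebra K 𝔤 →ₐ[K] SymmetricAlgebra K 𝔤)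
    (hα : ∀ y, α (SymmetricAlgebra.ι K 𝔤 y) = SymmetricAlgebra.ι K 𝔤 (y + c • ⁅x, y⁆))
    (F : SymmetricAlgebra K 𝔤) :
    α F = Polynomial.eval (algebraMap K (SymmetricAlgebra K 𝔤) c) (flow K x F) := by
  induction F using SymmetricAlgebra.induction with
  | algebraMap c => rw [AlgHom.commutes, AlgHom.commutes, Polynomial.algebraMap_apply,
      Polynomial.eval_C]
  | ι y =>
    rw [hα, flow_ι, Polynomial.eval_add, Polynomial.eval_C, Polynomial.eval_monomial, pow_one,
      map_add, map_smul, mul_comm, ← Algebra.smul_def]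
  | mul a b ha hb => rw [map_mul, map_mul, Polynomial.eval_mul, ha, hb]
  | add a b ha hb => rw [map_add, map_add, Polynomial.eval_add, ha, hb]

/-- If a fraction `a / b` is invariant under the flow at all times, its derivative along the flow
vanishes. -/
theorem symBracket_mul_eq_of_flow [Infinite K] [IsDomain (SymmetricAlgebra K 𝔤)] {x : 𝔤}
    {a b : SymmetricAlgebra K 𝔤}
    (h : ∀ c : K, Polynomial.eval (algebraMap K _ c) (flow K x a) * b =
      a * Polynomial.eval (algebraMap K _ c) (flow K x b)) :
    symBracket K 𝔤 (SymmetricAlgebra.ι K 𝔤 x) a * b =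
      a * symBracket K 𝔤 (SymmetricAlgebra.ι K 𝔤 x) b := by
  -- The identity holds at infinitely many values of `T`, hence for polynomials in `T`; the
  -- coefficient of `T` gives the claim.
  have h2 : flow K x a * Polynomial.C b - Polynomial.C a * flow K x b = 0 := by
    refine Polynomial.eq_zero_of_infinite_isRoot _ ?_
    refine (Set.infinite_range_of_injective
      (FaithfulSMul.algebraMap_injective K (SymmetricAlgebra K 𝔤))).mono ?_
    rintro _ ⟨c, rfl⟩
    change Polynomial.eval _ _ = 0
    rw [Polynomial.eval_sub, Polynomial.eval_mul, Polynomial.eval_mul, Polynomial.eval_C,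
      Polynomial.eval_C, h, sub_self]
  have h3 := congrArg (fun P => Polynomial.coeff P 1) h2
  simp only [Polynomial.coeff_sub, Polynomial.coeff_mul_C, Polynomial.coeff_C_mul, coeff_one_flow,
    Polynomial.coeff_zero] at h3
  exact sub_eq_zero.mp h3

variable [CharZero K]

theorem charZero_symmetricAlgebra : CharZero (SymmetricAlgebra K 𝔤) :=
  charZero_of_injective_algebraMap (FaithfulSMul.algebraMap_injective K (SymmetricAlgebra K 𝔤))

/-- In characteristic zero a function that commutes with `x` is constant along the flow of `x`. -/
theorem flow_of_central {x : 𝔤} (hx : ∀ y : 𝔤, ⁅x, ⁅x, y⁆⁆ = 0) {F : SymmetricAlgebra K 𝔤}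
    (hF : symBracket K 𝔤 (SymmetricAlgebra.ι K 𝔤 x) F = 0) :
    flow K x F = Polynomial.C F := by
  have h1 := derivative_flow hx F
  rw [hF, map_zero] at h1
  have := charZero_symmetricAlgebra (K := K) (𝔤 := 𝔤)
  rw [Polynomial.eq_C_of_derivative_eq_zero h1, coeff_zero_flow]

end Flow

theorem IsPoissonBracket.div_right {K F : Type*} [CommRing K] [Field F] [Algebra K F]
    {br : F →ₗ[K] F →ₗ[K] F} (h : IsPoissonBracket br) {c a b : F} (hb : b ≠ 0)
    (hab : br c a * b = a * br c b) : br c (a / b) = 0 := by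
  have h4 := h.mul_right c b (a / b)
  rw [mul_div_cancel₀ _ hb] at h4
  rw [h4] at hab
  have h5 : b * b * br c (a / b) = 0 := by
    have : (b * br c (a / b) + a / b * br c b) * b =
      b * b * br c (a / b) + a * br c b * (b / b) := by ring
    rw [this, div_self hb, mul_one] at hab
    exact add_eq_right.mp hab
  exact (mul_eq_zero.mp h5).resolve_left (mul_ne_zero hb hb)

namespace RootIdeal

variable {K : Type*} [Field K] {n : ℕ} {𝔪 : RootIdeal K n}

/-! ### Invariants and Poisson central elements -/

theorem lie_lie_mk {k : Fin n} {X : ut K n} (h : IsColumn k X) (y : 𝔪.factor) :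
    ⁅(LieSubmodule.Quotient.mk X : 𝔪.factor), ⁅(LieSubmodule.Quotient.mk X : 𝔪.factor), y⁆⁆ = 0 := by
  obtain ⟨y, rfl⟩ := LieSubmodule.Quotient.surjective_mk' 𝔪.ideal y
  change (LieSubmodule.Quotient.mk ⁅X, ⁅X, y⁆⁆ : 𝔪.factor) = 0
  rw [h.lie_lie]
  rfl

variable [CharZero K]

theorem actReg_ι (g : 𝔪.group) (x : 𝔪.factor) : 𝔪.actReg g (SymmetricAlgebra.ι K 𝔪.factor x) =
    SymmetricAlgebra.ι K 𝔪.factor (𝔪.ad g x) := by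
  change SymmetricAlgebra.lift (SymmetricAlgebra.ι K 𝔪.factor ∘ₗ 𝔪.ad g)
    (SymmetricAlgebra.ι K 𝔪.factor x) = _
  rw [SymmetricAlgebra.lift_ι_apply]; rfl

theorem actReg_mul (g h : 𝔪.group) (F : 𝔪.Reg) :
    𝔪.actReg (g * h) F = 𝔪.actReg g (𝔪.actReg h F) := by
  induction F using SymmetricAlgebra.induction with
  | algebraMap c => simp only [AlgEquiv.commutes]
  | ι y => rw [actReg_ι, actReg_ι, actReg_ι, map_mul]; rfl
  | mul a b ha hb => simp only [map_mul, ha, hb]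
  | add a b ha hb => simp only [map_add, ha, hb]

theorem actReg_one (F : 𝔪.Reg) : 𝔪.actReg 1 F = F := by
  induction F using SymmetricAlgebra.induction with
  | algebraMap c => simp only [AlgEquiv.commutes]
  | ι y => rw [actReg_ι, map_one]; rfl
  | mul a b ha hb => simp only [map_mul, ha, hb]
  | add a b ha hb => simp only [map_add, ha, hb]

variable (𝔪) in
/-- The image in `L` of the group element `1 + X`. -/
def columnElt {k : Fin n} {X : ut K n} (h : IsColumn k X) : 𝔪.group := QuotientGroup.mk h.unit

theorem ad_columnElt {k : Fin n} {X : ut K n} (h : IsColumn k X) (y : 𝔪.factor) :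
    𝔪.ad (𝔪.columnElt h) y = y + ⁅(LieSubmodule.Quotient.mk X : 𝔪.factor), y⁆ := by
  obtain ⟨y, rfl⟩ := LieSubmodule.Quotient.surjective_mk' 𝔪.ideal y
  change (LieSubmodule.Quotient.mk (adN h.unit y) : 𝔪.factor) = _
  rw [h.adN_unit]
  rfl

/-- The group elements `1 + cX` act by the values of the flow. -/
theorem actReg_columnElt {k : Fin n} {X : ut K n} (h : IsColumn k X) (c : K) (F : 𝔪.Reg) :
    𝔪.actReg (𝔪.columnElt (h.smul c)) F =
      Polynomial.eval (algebraMap K 𝔪.Reg c) (flow K (LieSubmodule.Quotient.mk X : 𝔪.factor) F) := by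
  refine eval_flow ((𝔪.actReg (𝔪.columnElt (h.smul c)) : 𝔪.Reg ≃ₐ[K] 𝔪.Reg) : 𝔪.Reg →ₐ[K] 𝔪.Reg)
    (fun y => ?_) F
  refine (actReg_ι _ y).trans ?_
  rw [ad_columnElt]
  have : ⁅(LieSubmodule.Quotient.mk (c • X) : 𝔪.factor), y⁆ =
      c • ⁅(LieSubmodule.Quotient.mk X : 𝔪.factor), y⁆ := by
    rw [← smul_lie]; rfl
  rw [this]

/-- Poisson central functions are invariant. -/
theorem mem_invReg_of_central {F : 𝔪.Reg}
    (hF : ∀ x, symBracket K 𝔪.factor (SymmetricAlgebra.ι K 𝔪.factor x) F = 0) : F ∈ 𝔪.invReg := by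
  intro g
  obtain ⟨g, rfl⟩ := QuotientGroup.mk_surjective g
  induction g using UT.column_induction with
  | one => exact actReg_one F
  | mul k X h g hg =>
    have h1 := actReg_columnElt (𝔪 := 𝔪) h 1 F
    rw [flow_of_central (lie_lie_mk h) (hF _), Polynomial.eval_C] at h1
    rw [QuotientGroup.mk_mul, actReg_mul, hg]
    have e : 𝔪.columnElt (h.smul 1) = QuotientGroup.mk h.unit := by
      rw [columnElt]
      congr 1
      apply Subtype.ext
      apply Units.ext
      change 1 + ((1 : K) • X : ut K n).1 = 1 + X.1
      rw [one_smul]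
    rw [← e, h1]

theorem actRat_algebraMap (g : 𝔪.group) (G : 𝔪.Reg) :
    𝔪.actRat g (algebraMap _ _ G) = algebraMap _ _ (𝔪.actReg g G) :=
  IsFractionRing.algEquivOfAlgEquiv_algebraMap (𝔪.actReg g) G

theorem actReg_mul_eq {a b : 𝔪.Reg} (hb0 : b ≠ 0)
    (hF : algebraMap 𝔪.Reg 𝔪.RatFun a / algebraMap 𝔪.Reg 𝔪.RatFun b ∈ 𝔪.invRat) (g : 𝔪.group) :
    𝔪.actReg g a * b = a * 𝔪.actReg g b := by
  have h2 := hF g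
  have hb' : algebraMap 𝔪.Reg 𝔪.RatFun b ≠ 0 := algebraMap_ratFun_ne_zero hb0
  have hb2 : algebraMap 𝔪.Reg 𝔪.RatFun (𝔪.actReg g b) ≠ 0 :=
    algebraMap_ratFun_ne_zero fun h0 => hb0 ((𝔪.actReg _).injective (h0.trans (map_zero _).symm))
  rw [map_div₀, actRat_algebraMap, actRat_algebraMap, div_eq_div_iff hb2 hb', ← map_mul,
    ← map_mul] at h2
  exact IsFractionRing.injective 𝔪.Reg 𝔪.RatFun h2

/-- Rational invariants are Poisson central. -/
theorem central_of_mem_invRat {F : 𝔪.RatFun} (hF : F ∈ 𝔪.invRat) (x : 𝔪.RatFun) :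
    𝔪.bracket F x = 0 := by
  refine 𝔪.central_of_coord (fun ξ => ?_) x
  have hb := 𝔪.bracket_isPoissonBracket
  obtain ⟨a, b, hb0, rfl⟩ := IsFractionRing.div_surjective (A := 𝔪.Reg) F
  replace hb0 := nonZeroDivisors.ne_zero hb0
  have hξ := isColumn_rootVec (K := K) ξ
  have h1 : symBracket K 𝔪.factor (𝔪.coord ξ) a * b = a * symBracket K 𝔪.factor (𝔪.coord ξ) b := by
    refine symBracket_mul_eq_of_flow fun c => ?_
    have h2 := actReg_mul_eq hb0 hF (𝔪.columnElt (hξ.smul c))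
    rw [actReg_columnElt hξ c a, actReg_columnElt hξ c b] at h2
    exact h2
  have h3 := congrArg (algebraMap 𝔪.Reg 𝔪.RatFun) h1
  rw [map_mul, map_mul, algebraMap_symBracket (nonZeroDivisors 𝔪.Reg),
    algebraMap_symBracket (nonZeroDivisors 𝔪.Reg)] at h3
  rw [hb.skew]
  exact neg_eq_zero.mpr (hb.div_right (algebraMap_ratFun_ne_zero hb0) h3)

theorem algebraMap_mem_invRat {F : 𝔪.Reg} (hF : F ∈ 𝔪.invReg) :
    algebraMap 𝔪.Reg 𝔪.RatFun F ∈ 𝔪.invRat := fun g =>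
  (actRat_algebraMap g F).trans (congrArg _ (hF g))

end RootIdeal

/-! ### Partial derivatives -/

section Pderiv

variable {K σ : Type*} [Field K]

theorem totalDegree_pderiv_lt {i : σ} {G : MvPolynomial σ K} (h : MvPolynomial.pderiv i G ≠ 0) :
    (MvPolynomial.pderiv i G).totalDegree < G.totalDegree := by
  obtain ⟨d, hd, hd'⟩ := Finset.exists_mem_eq_sup _ (MvPolynomial.support_nonempty.mpr h)
    (fun d : σ →₀ ℕ => d.sum fun _ e => e)
  have h1 : (MvPolynomial.pderiv i G).totalDegree = d.sum fun _ e => e := hd'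
  rw [MvPolynomial.mem_support_iff, MvPolynomial.coeff_pderiv] at hd
  have h2 := MvPolynomial.le_totalDegree (MvPolynomial.mem_support_iff.mpr (left_ne_zero_of_mul hd))
  rw [Finsupp.sum_add_index' (fun _ => rfl) (fun _ _ _ => rfl), Finsupp.sum_single_index rfl] at h2
  omega

theorem notMem_vars_of_pderiv_eq_zero [CharZero K] {i : σ} {G : MvPolynomial σ K}
    (h : MvPolynomial.pderiv i G = 0) : i ∉ G.vars := by
  classical
  rw [MvPolynomial.mem_vars_iff_mem_support]
  rintro ⟨d, hd, hi⟩
  have h1 := MvPolynomial.coeff_pderiv (i := i) G (d - Finsupp.single i 1)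
  have h2 : d - Finsupp.single i 1 + Finsupp.single i 1 = d := by
    refine tsub_add_cancel_of_le ?_
    rw [Finsupp.single_le_iff]
    exact Nat.one_le_iff_ne_zero.mpr (Finsupp.mem_support_iff.mp hi)
  rw [h, MvPolynomial.coeff_zero, h2] at h1
  rcases mul_eq_zero.mp h1.symm with h3 | h3
  · exact MvPolynomial.mem_support_iff.mp hd h3
  · exact Nat.cast_add_one_ne_zero _ h3

/-- The chain rule. -/
theorem IsPoissonBracket.aeval_right {B : Type*} [CommRing B] [Algebra K B]
    {br : B →ₗ[K] B →ₗ[K] B} (h : IsPoissonBracket br) [Fintype σ] (c : B) (x : σ → B)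
    (G : MvPolynomial σ K) : br c (MvPolynomial.aeval x G) =
      ∑ i, MvPolynomial.aeval x (MvPolynomial.pderiv i G) * br c (x i) := by
  classical
  induction G using MvPolynomial.induction_on with
  | C a => simp [h.algebraMap_right]
  | add p q hp hq => simp only [map_add, hp, hq, add_mul, Finset.sum_add_distrib]
  | mul_X p j hp =>
    simp only [map_mul, h.mul_right, hp, MvPolynomial.pderiv_mul, map_add, MvPolynomial.aeval_X,
      MvPolynomial.pderiv_X, add_mul, Finset.sum_add_distrib]
    rw [add_comm]
    congr 1
    · rw [Finset.mul_sum]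
      exact Finset.sum_congr rfl fun i _ => by ring
    · rw [Finset.sum_eq_single j]
      · simp
      · intro i _ hi; simp [hi.symm]
      · simp

theorem IsPoissonBracket.mul_eq_of_div_central {F : Type*} [Field F] [Algebra K F]
    {br : F →ₗ[K] F →ₗ[K] F} (h : IsPoissonBracket br) {a b : F} (hb : b ≠ 0)
    (hF : ∀ x, br (a / b) x = 0) (x : F) : br x a * b = a * br x b := by
  have h1 := h.mul_right x b (a / b)
  rw [mul_div_cancel₀ _ hb, h.skew x (a / b), hF, neg_zero, mul_zero, zero_add] at h1
  rw [h1, div_mul_eq_mul_div, div_mul_cancel₀ _ hb]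

end Pderiv

namespace RootIdeal

variable {K : Type*} [Field K] {n : ℕ} {𝔪 : RootIdeal K n} {s m : ℕ} {z : Fin s → 𝔪.Reg}
  {p q : Fin m → 𝔪.Loc z}

/-! ### The field of invariants -/

/-- In Darboux coordinates, `{p_a, ·}` is the partial derivative with respect to `q_a`. -/
theorem IsDarboux.bracket_p (h : IsDarboux z p q) (a : Fin m)
    (G : MvPolynomial (Fin s ⊕ (Fin m ⊕ Fin m)) K) :
    𝔪.locBracket z (p a) (MvPolynomial.aeval (darbouxCoord z p q) G) =
      MvPolynomial.aeval (darbouxCoord z p q)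
        (MvPolynomial.pderiv (Sum.inr (Sum.inr a)) G) := by
  rw [locBracket_isPoissonBracket.aeval_right, Finset.sum_eq_single (Sum.inr (Sum.inr a))]
  · exact (congrArg _ (h.pairs.pq_self a)).trans (mul_one _)
  · rintro (i | b | b) - hb
    · exact (congrArg _ (h.central i _)).trans (mul_zero _)
    · exact (congrArg _ (h.pairs.pp a b)).trans (mul_zero _)
    · exact (congrArg _ (h.pairs.pq_ne a b fun h0 => hb (by rw [h0]))).trans (mul_zero _)
  · simp

/-- In Darboux coordinates, `-{q_a, ·}` is the partial derivative with respect to `p_a`. -/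
theorem IsDarboux.bracket_q (h : IsDarboux z p q) (a : Fin m)
    (G : MvPolynomial (Fin s ⊕ (Fin m ⊕ Fin m)) K) :
    𝔪.locBracket z (q a) (MvPolynomial.aeval (darbouxCoord z p q) G) =
      -MvPolynomial.aeval (darbouxCoord z p q)
        (MvPolynomial.pderiv (Sum.inr (Sum.inl a)) G) := by
  have hb := locBracket_isPoissonBracket (z := z)
  rw [hb.aeval_right, Finset.sum_eq_single (Sum.inr (Sum.inl a))]
  · refine (congrArg _ ((hb.skew _ _).trans (congrArg _ (h.pairs.pq_self a)))).trans ?_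
    rw [mul_neg, mul_one]
  · rintro (i | b | b) - hb'
    · exact (congrArg _ (h.central i _)).trans (mul_zero _)
    · refine (congrArg _ ((hb.skew _ _).trans (congrArg _
        (h.pairs.pq_ne b a fun h0 => hb' (by rw [h0]))))).trans ?_
      rw [neg_zero, mul_zero]
    · exact (congrArg _ (h.pairs.qq a b)).trans (mul_zero _)
  · simp

/-- Polynomials in Darboux coordinates as rational functions. -/
def darbouxHom (h : IsDarboux z p q) :
    MvPolynomial (Fin s ⊕ (Fin m ⊕ Fin m)) K →ₐ[K] 𝔪.RatFun :=
  (toRat h.ne_zero).comp (MvPolynomial.aeval (darbouxCoord z p q))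

theorem darbouxHom_injective (h : IsDarboux z p q) : Function.Injective (darbouxHom h) :=
  (toRat_injective h.ne_zero).comp h.indep

/-- Poisson commuting with the quotient `a / b` of two polynomials implies `∂a · b = a · ∂b` for all
derivatives in the directions of the `p_a` and `q_a`. -/
theorem IsDarboux.pderiv_mul_eq (h : IsDarboux z p q)
    {a b : MvPolynomial (Fin s ⊕ (Fin m ⊕ Fin m)) K} (hb0 : b ≠ 0)
    (hF : ∀ x, 𝔪.bracket (darbouxHom h a / darbouxHom h b) x = 0) (i : Fin m ⊕ Fin m) :
    MvPolynomial.pderiv (Sum.inr i) a * b = a * MvPolynomial.pderiv (Sum.inr i) b := by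
  have hbr := 𝔪.bracket_isPoissonBracket
  have hb' : darbouxHom h b ≠ 0 := fun h0 =>
    hb0 (darbouxHom_injective h (h0.trans (map_zero _).symm))
  have key := hbr.mul_eq_of_div_central hb' hF
  have hp : ∀ c G, 𝔪.bracket (toRat h.ne_zero (p c)) (darbouxHom h G) =
      darbouxHom h (MvPolynomial.pderiv (Sum.inr (Sum.inr c)) G) := fun c G =>
    (toRat_bracket h.ne_zero _ _).symm.trans (congrArg _ (h.bracket_p c G))
  have hq : ∀ c G, 𝔪.bracket (toRat h.ne_zero (q c)) (darbouxHom h G) =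
      -darbouxHom h (MvPolynomial.pderiv (Sum.inr (Sum.inl c)) G) := fun c G =>
    (toRat_bracket h.ne_zero _ _).symm.trans
      ((congrArg _ (h.bracket_q c G)).trans (map_neg (toRat h.ne_zero) _))
  apply darbouxHom_injective h
  refine (map_mul (darbouxHom h) _ _).trans (Eq.trans ?_ (map_mul (darbouxHom h) _ _).symm)
  rcases i with c | c
  · have := key (toRat h.ne_zero (q c))
    rw [hq c a, hq c b] at this
    exact neg_inj.mp ((neg_mul _ _).symm.trans (this.trans (mul_neg _ _)))
  · have := key (toRat h.ne_zero (p c))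
    rw [hp c a, hp c b] at this
    exact this

theorem IsDarboux.exists_div (h : IsDarboux z p q) (F : 𝔪.RatFun) :
    ∃ a b, b ≠ 0 ∧ F = darbouxHom h a / darbouxHom h b := by
  have hθ : ∀ G, darbouxHom h G = MvPolynomial.aeval (toRat h.ne_zero ∘ darbouxCoord z p q) G :=
    fun G => MvPolynomial.comp_aeval_apply (darbouxCoord z p q) (toRat h.ne_zero) G
  have hfield : F ∈ IntermediateField.adjoin K
      (Set.range (toRat h.ne_zero ∘ darbouxCoord z p q)) := by
    have hF : ∀ F : 𝔪.Reg, algebraMap 𝔪.Reg 𝔪.RatFun F ∈ IntermediateField.adjoin K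
        (Set.range (toRat h.ne_zero ∘ darbouxCoord z p q)) := by
      intro F
      have h1 : F ∈ Algebra.adjoin K (𝔪.coord '' Set.univ) := by
        rw [Set.image_univ, adjoin_coord]; trivial
      refine (Algebra.adjoin_le ?_ : _ ≤ (IntermediateField.adjoin K
        (Set.range (toRat h.ne_zero ∘ darbouxCoord z p q))).toSubalgebra)
        (algebraMap_mem_adjoin h1)
      rintro _ ⟨ξ, -, rfl⟩
      exact coord_mem_field h.ne_zero h.exists_eq ξ
    obtain ⟨a, b, -, rfl⟩ := IsFractionRing.div_surjective (A := 𝔪.Reg) F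
    exact div_mem (hF a) (hF b)
  obtain ⟨a, b, hab⟩ := (IntermediateField.mem_adjoin_range_iff K _ F).mp hfield
  rw [← hθ, ← hθ] at hab
  by_cases hb : b = 0
  · refine ⟨0, 1, one_ne_zero, ?_⟩
    rw [hab, hb, map_zero, div_zero, zero_div]
  · exact ⟨a, b, hb, hab⟩

variable [CharZero K]

/-- A central rational function is a rational function of the `z_i`: written as a fraction with
denominator of minimal degree in Darboux coordinates, it has numerator and denominator with
vanishing derivatives in the directions of the `p_a` and `q_a`. -/
theorem IsDarboux.mem_adjoin_of_central (h : IsDarboux z p q) {F : 𝔪.RatFun}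
    (hF : ∀ x, 𝔪.bracket F x = 0) :
    F ∈ IntermediateField.adjoin K (Set.range fun i => algebraMap 𝔪.Reg 𝔪.RatFun (z i)) := by
  classical
  have hex : ∃ d : ℕ, ∃ a b, b ≠ 0 ∧ F = darbouxHom h a / darbouxHom h b ∧ b.totalDegree = d := by
    obtain ⟨a, b, hb, hab⟩ := h.exists_div F
    exact ⟨_, a, b, hb, hab, rfl⟩
  obtain ⟨a, b, hb, hab, hd⟩ := Nat.find_spec hex
  have hmin : ∀ a' b', b' ≠ 0 → F = darbouxHom h a' / darbouxHom h b' →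
      b.totalDegree ≤ b'.totalDegree := fun a' b' h1 h2 =>
    hd ▸ Nat.find_min' hex ⟨a', b', h1, h2, rfl⟩
  have hinj := darbouxHom_injective h
  have hne : ∀ {c}, c ≠ 0 → darbouxHom h c ≠ 0 := fun hc h0 => hc (hinj (h0.trans (map_zero _).symm))
  have hder := fun i => h.pderiv_mul_eq hb (fun x => hab ▸ hF x) i
  -- Otherwise `∂a / ∂b` is an expression of `F` with a denominator of smaller degree.
  have hb1 : ∀ i, MvPolynomial.pderiv (Sum.inr i) b = 0 := by
    intro i
    by_contra h0
    have h1 : F = darbouxHom h (MvPolynomial.pderiv (Sum.inr i) a) /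
        darbouxHom h (MvPolynomial.pderiv (Sum.inr i) b) := by
      rw [hab, div_eq_div_iff (hne hb) (hne h0), ← map_mul, ← map_mul, hder]
    exact absurd (totalDegree_pderiv_lt h0) (not_lt.mpr (hmin _ _ h0 h1))
  have ha1 : ∀ i, MvPolynomial.pderiv (Sum.inr i) a = 0 := by
    intro i
    have h1 := hder i
    rw [hb1, mul_zero] at h1
    exact (mul_eq_zero.mp h1).resolve_right hb
  have hmem : ∀ G : MvPolynomial (Fin s ⊕ (Fin m ⊕ Fin m)) K,
      (∀ i, MvPolynomial.pderiv (Sum.inr i) G = 0) → darbouxHom h G ∈ IntermediateField.adjoin K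
        (Set.range fun i => algebraMap 𝔪.Reg 𝔪.RatFun (z i)) := by
    intro G hG
    obtain ⟨G', rfl⟩ := MvPolynomial.exists_rename_eq_of_vars_subset_range G
      (Sum.inl : Fin s → Fin s ⊕ (Fin m ⊕ Fin m)) Sum.inl_injective (by
        rintro (i | i) hi
        · exact ⟨i, rfl⟩
        · exact absurd hi (notMem_vars_of_pderiv_eq_zero (hG i)))
    have h1 : darbouxHom h (MvPolynomial.rename Sum.inl G') =
        MvPolynomial.aeval (fun i => algebraMap 𝔪.Reg 𝔪.RatFun (z i)) G' := by
      refine (congrArg (toRat h.ne_zero) (MvPolynomial.aeval_rename _ _ _)).trans ?_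
      refine (MvPolynomial.comp_aeval_apply ..).trans ?_
      congr 2
      ext i
      exact toRat_algebraMap h.ne_zero (z i)
    rw [h1]
    refine IntermediateField.algebra_adjoin_le_adjoin K _ ?_
    rw [Algebra.adjoin_range_eq_range_aeval]
    exact AlgHom.mem_range_self _ G'
  rw [hab]
  exact div_mem (hmem a ha1) (hmem b hb1)

/-- The field of invariants is generated by the `z_i`. -/
theorem IsDarboux.invRat_eq (h : IsDarboux z p q) (hz : ∀ i, z i ∈ 𝔪.invReg) :
    𝔪.invRat = IntermediateField.adjoin K (Set.range fun i => algebraMap 𝔪.Reg 𝔪.RatFun (z i)) := by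
  apply le_antisymm
  · exact fun F hF => h.mem_adjoin_of_central (central_of_mem_invRat hF)
  · rw [IntermediateField.adjoin_le_iff]
    rintro _ ⟨i, rfl⟩
    exact algebraMap_mem_invRat (hz i)

/-- The `z_i` of a system of Darboux coordinates are invariants. -/
theorem IsDarboux.mem_invReg (h : IsDarboux z p q) (i : Fin s) : z i ∈ 𝔪.invReg := by
  refine mem_invReg_of_central fun x => IsFractionRing.injective 𝔪.Reg 𝔪.RatFun ?_
  have h1 : 𝔪.bracket (algebraMap _ _ (SymmetricAlgebra.ι K 𝔪.factor x)) (algebraMap _ _ (z i)) = 0 := by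
    rw [← toRat_algebraMap h.ne_zero, ← toRat_algebraMap h.ne_zero (z i), ← toRat_bracket,
      ← coe_locUnit, h.central, map_zero]
  exact ((algebraMap_symBracket (nonZeroDivisors 𝔪.Reg) _ _).trans h1).trans (map_zero _).symm

end RootIdeal

/-! ### Counting symbols -/

namespace Diagram

variable {n : ℕ} {M : Finset (Root n)} {D : Diagram n} {ξ η : Root n}

theorem fill_eq_cross :
    D.fill ξ η = some Mark.cross ↔ η = ξ ∨ D η = some Mark.cross := by
  by_cases h : η = ξ
  · simp [fill, h]
  · rw [fill, if_neg h]
    split_ifs with h1 h2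
    · simp [h, h1.1]
    · simp [h, h2.1]
    · simp [h]

theorem fill_eq_bullet (hξ : D ξ = none) :
    D.fill ξ η = some Mark.bullet ↔ D η = some Mark.bullet := by
  by_cases h : η = ξ
  · simp [fill, h, hξ]
  · rw [fill, if_neg h]
    split_ifs with h1 h2
    · simp [h1.1]
    · simp [h2.1]
    · rfl

theorem count_cross_fill (hξ : D ξ = none) :
    (D.fill ξ).count Mark.cross = D.count Mark.cross + 1 := by
  have : (Finset.univ.filter fun η => D.fill ξ η = some Mark.cross) =
      insert ξ (Finset.univ.filter fun η => D η = some Mark.cross) := by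
    ext η; simp [fill_eq_cross]
  rw [count, this, Finset.card_insert_of_notMem (by simp [hξ]), count]

theorem count_bullet_fill (hξ : D ξ = none) :
    (D.fill ξ).count Mark.bullet = D.count Mark.bullet := by
  simp only [count, fill_eq_bullet hξ]

theorem after_succ_of_next {i : ℕ} (h : (after M i).next = some ξ) :
    after M (i + 1) = (after M i).fill ξ := by
  rw [after, h]

theorem after_succ_of_none {i : ℕ} (h : (after M i).next = none) : after M (i + 1) = after M i := by
  rw [after, h]

theorem after_add_of_none {i : ℕ} (h : (after M i).next = none) (d : ℕ) :
    after M (i + d) = after M i := by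
  induction d with
  | zero => rfl
  | succ d ih => rw [← add_assoc, after_succ_of_none (by rw [ih]; exact h), ih]

theorem card_empties_after (i : ℕ) (h : ∀ j < i, crossPlace M j ≠ none) :
    (after M i).empties.card + i ≤ Fintype.card (Root n) := by
  induction i with
  | zero => exact Finset.card_le_univ _
  | succ i ih =>
    have h1 := ih fun j hj => h j (Nat.lt_succ_of_lt hj)
    obtain ⟨ξ, hξ⟩ := Option.ne_none_iff_exists'.mp (h i (Nat.lt_succ_self i))
    have h2 := card_fill_le (next_mem hξ)
    rw [after_succ_of_next hξ]
    omega

theorem count_cross_after (i : ℕ) (h : ∀ j < i, crossPlace M j ≠ none) :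
    (after M i).count Mark.cross = i := by
  induction i with
  | zero =>
    rw [count, Finset.card_eq_zero, Finset.filter_eq_empty_iff]
    intro η _
    rw [after, zeroStep]
    split_ifs <;> simp
  | succ i ih =>
    obtain ⟨ξ, hξ⟩ := Option.ne_none_iff_exists'.mp (h i (Nat.lt_succ_self i))
    rw [after_succ_of_next hξ, count_cross_fill (next_mem hξ),
      ih fun j hj => h j (Nat.lt_succ_of_lt hj)]

theorem count_bullet_after (i : ℕ) : (after M i).count Mark.bullet = M.card := by
  induction i with
  | zero =>
    rw [count, after]
    congr 1
    ext η
    simp [zeroStep]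
  | succ i ih =>
    rcases h : (after M i).next with _ | ξ
    · rw [after_succ_of_none h, ih]
    · rw [after_succ_of_next h, count_bullet_fill (next_mem h), ih]

/-- The steps run without interruption up to the one with number `s`, the number of symbols `⊗`;
after it the diagram is complete. -/
theorem after_count_cross (M : Finset (Root n)) :
    (∀ j < (final M).count Mark.cross, crossPlace M j ≠ none) ∧
      after M ((final M).count Mark.cross) = final M ∧ ∀ ξ, final M ξ ≠ none := by
  classical
  have hex : ∃ j, crossPlace M j = none := by
    by_contra! h
    have := card_empties_after (Fintype.card (Root n) + 1) fun j _ => h j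
    omega
  have hlt : ∀ j < Nat.find hex, crossPlace M j ≠ none := fun j hj => Nat.find_min hex hj
  have hle := card_empties_after _ hlt
  have hnone : (after M (Nat.find hex)).next = none := Nat.find_spec hex
  have hfin : final M = after M (Nat.find hex) := by
    obtain ⟨d, hd⟩ := Nat.exists_eq_add_of_le
      (show Nat.find hex ≤ Fintype.card (Root n) by omega)
    rw [final, hd, after_add_of_none hnone]
  have hs : (final M).count Mark.cross = Nat.find hex := by
    rw [hfin, count_cross_after _ hlt]
  rw [hs]
  exact ⟨hlt, hfin.symm, hfin ▸ next_eq_none.mp hnone⟩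

theorem sum_count (h : ∀ ξ, D ξ ≠ none) : D.count Mark.bullet + D.count Mark.cross +
    D.count Mark.plus + D.count Mark.minus = Fintype.card (Root n) := by
  have key : ∀ t : Finset (Root n), (t.filter fun ξ => D ξ = some Mark.bullet).card +
      (t.filter fun ξ => D ξ = some Mark.cross).card +
      (t.filter fun ξ => D ξ = some Mark.plus).card +
      (t.filter fun ξ => D ξ = some Mark.minus).card = t.card := by
    classical
    intro t
    induction t using Finset.induction_on with
    | empty => rfl
    | insert ξ t hξ ih =>
      obtain ⟨x, hx⟩ := Option.ne_none_iff_exists'.mp (h ξ)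
      simp only [Finset.filter_insert, hx]
      cases x <;> simp [hξ] <;> omega
  exact key Finset.univ

theorem count_plus_add_minus (M : Finset (Root n)) :
    (final M).count Mark.cross + ((final M).count Mark.plus + (final M).count Mark.minus) =
      Fintype.card {ξ // ξ ∉ M} := by
  have h1 := sum_count (after_count_cross M).2.2
  have h2 : (final M).count Mark.bullet = M.card := count_bullet_after _
  have h3 : Fintype.card {ξ // ξ ∉ M} = Fintype.card (Root n) - M.card := by
    rw [Fintype.card_subtype_compl, Fintype.card_coe]
  have h4 := Finset.card_le_univ M
  omega

end Diagram

namespace RootIdeal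

variable {K : Type*} [Field K] [CharZero K] {n : ℕ} (𝔪 : RootIdeal K n)

/-! ### Existence and first properties of Casimir systems -/

theorem exists_isCasimirSystem : ∃ z : Fin 𝔪.s → 𝔪.Reg, 𝔪.IsCasimirSystem z := by
  obtain ⟨hcross, hafter, hfull⟩ := Diagram.after_count_cross 𝔪.M
  obtain ⟨z, ι, _, p, q, w, hst, htri⟩ := 𝔪.exists_isStage 𝔪.s hcross
  have hD : ∀ ξ, Diagram.after 𝔪.M 𝔪.s ξ ≠ none := fun ξ => by
    rw [s, diagram, hafter]; exact hfull ξ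
  obtain ⟨m, P, Q, h⟩ := exists_isDarboux hst hD
  refine ⟨fun i => z i, h.mem_invReg, fun i => ?_, m, h.exists_equiv⟩
  obtain ⟨ξ, hξ, e, R, hR, hz⟩ := htri i i.2
  refine ⟨ξ, hξ, fun j => e j, R, hR, ?_⟩
  rw [hz]
  congr 2
  have := Finset.prod_map (Finset.Iio i) Fin.valEmbedding fun j => z j ^ e j
  rw [Fin.map_valEmbedding_Iio, Nat.Iio_eq_range] at this
  exact this

variable {𝔪}

theorem IsCasimirSystem.exists_isDarboux {z : Fin 𝔪.s → 𝔪.Reg} (h : 𝔪.IsCasimirSystem z) :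
    ∃ (m : ℕ) (p q : Fin m → 𝔪.Loc z), IsDarboux z p q := by
  obtain ⟨m, φ, h1, h2⟩ := h.decomposition
  exact ⟨m, _, _, isDarboux_of_equiv φ h1 h2 (fun a => φ.symm (1 ⊗ₜ MvPolynomial.X (Sum.inl a)))
    (fun a => φ.symm (1 ⊗ₜ MvPolynomial.X (Sum.inr a))) (fun a => φ.apply_symm_apply _)
    fun a => φ.apply_symm_apply _⟩

theorem IsCasimirSystem.invRat_eq {z : Fin 𝔪.s → 𝔪.Reg} (h : 𝔪.IsCasimirSystem z) :
    𝔪.invRat = IntermediateField.adjoin K (Set.range fun i => algebraMap 𝔪.Reg 𝔪.RatFun (z i)) := by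
  obtain ⟨m, p, q, hd⟩ := h.exists_isDarboux
  exact hd.invRat_eq h.invariant

theorem IsDarboux.two_mul_eq {m : ℕ} {z : Fin 𝔪.s → 𝔪.Reg} {p q : Fin m → 𝔪.Loc z}
    (h : IsDarboux z p q) : 2 * m = 𝔪.diagram.count Mark.plus + 𝔪.diagram.count Mark.minus := by
  have h1 := h.card_eq
  have h2 := Diagram.count_plus_add_minus 𝔪.M
  have h3 : 𝔪.s = (Diagram.final 𝔪.M).count Mark.cross := rfl
  change 2 * m = (Diagram.final 𝔪.M).count Mark.plus + (Diagram.final 𝔪.M).count Mark.minus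
  omega

end RootIdeal

/-! ### The rank of the form `f([x, y])` -/

theorem exists_linearIndependent_mem {K U : Type*} [Field K] [AddCommGroup U] [Module K U]
    (R : Submodule K U) {k : ℕ} (hk : k ≤ Module.finrank K R) :
    ∃ w : Fin k → U, (∀ i, w i ∈ R) ∧ LinearIndependent K w := by
  obtain ⟨w, hw⟩ := exists_linearIndependent_of_le_finrank hk
  exact ⟨fun i => w i, fun i => (w i).2, hw.map' _ (Submodule.ker_subtype _)⟩

theorem exists_dual_family {K W : Type*} [Field K] [AddCommGroup W] [Module K W] [Module.Finite K W]
    {k : ℕ} {w : Fin k → Module.Dual K W} (hw : LinearIndependent K w) :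
    ∃ v : Fin k → W, ∀ i j, w i (v j) = (1 : Matrix (Fin k) (Fin k) K) i j := by
  obtain ⟨g, hg⟩ := (Finsupp.linearCombination K w).exists_leftInverse_of_injective
    (LinearMap.ker_eq_bot.mpr hw)
  refine ⟨fun j => (Module.evalEquiv K W).symm (Finsupp.lapply j ∘ₗ g), fun i j => ?_⟩
  have h2 : g (w i) = Finsupp.single i 1 := by
    have := DFunLike.congr_fun hg (Finsupp.single i 1)
    rwa [LinearMap.comp_apply, Finsupp.linearCombination_single, one_smul] at this
  rw [Module.apply_evalEquiv_symm_apply, LinearMap.comp_apply, h2, Finsupp.lapply_apply,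
    Finsupp.single_apply, Matrix.one_apply]

section Form

variable {K : Type*} [Field K] {𝔤 : Type*} [LieRing 𝔤] [LieAlgebra K 𝔤]

/-- The linear map `x ↦ f([x, ·])`. -/
def formMap (f : Module.Dual K 𝔤) : 𝔤 →ₗ[K] Module.Dual K 𝔤 :=
  (LieModule.toEnd K 𝔤 𝔤 : 𝔤 →ₗ[K] Module.End K 𝔤).compr₂ f

theorem formMap_apply (f : Module.Dual K 𝔤) (x y : 𝔤) : formMap f x y = f ⁅x, y⁆ := rfl

theorem ker_formMap (f : Module.Dual K 𝔤) : LinearMap.ker (formMap f) = stabilizer f := by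
  ext x
  rw [LinearMap.mem_ker, LinearMap.ext_iff]
  rfl

variable [Module.Finite K 𝔤]

theorem finrank_range_add_finrank_stabilizer (f : Module.Dual K 𝔤) :
    Module.finrank K (LinearMap.range (formMap f)) + Module.finrank K (stabilizer f) =
      Module.finrank K 𝔤 := by
  rw [← ker_formMap]
  exact LinearMap.finrank_range_add_finrank_ker _

/-- If the form has rank at least `k`, then its values on suitable vectors form a unit matrix of size
`k`. -/
theorem exists_form_eq_one {f : Module.Dual K 𝔤} {k : ℕ}
    (hk : k ≤ Module.finrank K (LinearMap.range (formMap f))) :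
    ∃ x v : Fin k → 𝔤, (Matrix.of fun i j => f ⁅x i, v j⁆) = 1 := by
  obtain ⟨w, hmem, hw⟩ := exists_linearIndependent_mem _ hk
  obtain ⟨v, hv⟩ := exists_dual_family hw
  choose x hx using hmem
  refine ⟨x, v, ?_⟩
  ext i j
  rw [Matrix.of_apply, ← formMap_apply, hx]
  exact hv i j

/-- A nonzero minor of size `k` bounds the rank of the form from below. -/
theorem le_finrank_range_of_det {f : Module.Dual K 𝔤} {k : ℕ} {x v : Fin k → 𝔤}
    (hd : (Matrix.of fun i j => f ⁅x i, v j⁆).det ≠ 0) :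
    k ≤ Module.finrank K (LinearMap.range (formMap f)) := by
  have hind : LinearIndependent K fun i => (⟨formMap f (x i), LinearMap.mem_range_self _ _⟩ :
      LinearMap.range (formMap f)) := by
    refine LinearIndependent.of_comp (Submodule.subtype _) ?_
    rw [Fintype.linearIndependent_iff]
    intro c hc
    have h1 : Matrix.vecMul c (Matrix.of fun i j => f ⁅x i, v j⁆) = 0 := by
      ext j
      have := DFunLike.congr_fun hc (v j)
      rw [LinearMap.sum_apply] at this
      exact this
    exact fun i => congrFun (Matrix.eq_zero_of_vecMul_eq_zero hd h1) i
  simpa using hind.fintype_card_le_finrank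

end Form

theorem IsCanonicalPairs.eq_zero_of_sum {K B α : Type*} [CommRing K] [CommRing B] [Algebra K B]
    [Fintype α] {br : B →ₗ[K] B →ₗ[K] B} (hb : IsPoissonBracket br) {p q : α → B}
    (h : IsCanonicalPairs br p q) (e : B →ₐ[K] K) {g : α ⊕ α → K}
    (hg : ∀ b, ∑ a, g a * e (br ((Sum.elim p q : _ → B) a) b) = 0) (a : α ⊕ α) : g a = 0 := by
  rcases a with c | c
  · have h2 := hg (q c)
    rw [Finset.sum_eq_single (Sum.inl c)] at h2
    · rwa [Sum.elim_inl, h.pq_self, map_one, mul_one] at h2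
    · rintro (a | a) - ha
      · rw [Sum.elim_inl, h.pq_ne a c fun h0 => ha (by rw [h0]), map_zero, mul_zero]
      · rw [Sum.elim_inr, h.qq, map_zero, mul_zero]
    · simp
  · have h2 := hg (p c)
    rw [Finset.sum_eq_single (Sum.inr c)] at h2
    · rwa [Sum.elim_inr, hb.skew, h.pq_self, map_neg, map_one, mul_neg, mul_one,
        neg_eq_zero] at h2
    · rintro (a | a) - ha
      · rw [Sum.elim_inl, h.pp, map_zero, mul_zero]
      · rw [Sum.elim_inr, hb.skew, h.pq_ne c a fun h0 => ha (by rw [h0]), neg_zero, map_zero,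
          mul_zero]
    · simp

namespace RootIdeal

variable {K : Type*} [Field K] {n : ℕ} {𝔪 : RootIdeal K n}

/-! ### The index -/

theorem eval_eq_aeval (f : Module.Dual K 𝔪.factor) (F : 𝔪.Reg) :
    𝔪.eval f F = MvPolynomial.aeval (fun ξ => f (𝔪.basis ξ)) (𝔪.regEquiv F) := by
  have h : 𝔪.eval f = (MvPolynomial.aeval fun ξ => f (𝔪.basis ξ)).comp
      (𝔪.regEquiv : 𝔪.Reg →ₐ[K] _) := by
    apply SymmetricAlgebra.algHom_ext
    refine 𝔪.basis.ext fun ξ => ?_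
    have h1 : 𝔪.regEquiv (SymmetricAlgebra.ι K 𝔪.factor (𝔪.basis ξ)) = MvPolynomial.X ξ := by
      rw [basis_apply]; exact 𝔪.regEquiv_coord ξ
    change SymmetricAlgebra.lift f (SymmetricAlgebra.ι K 𝔪.factor (𝔪.basis ξ)) =
      MvPolynomial.aeval _ (𝔪.regEquiv (SymmetricAlgebra.ι K 𝔪.factor (𝔪.basis ξ)))
    rw [h1, MvPolynomial.aeval_X, SymmetricAlgebra.lift_ι_apply]
  exact DFunLike.congr_fun h F

/-- A nonzero function has a nonzero value. -/
theorem exists_eval_ne_zero [Infinite K] {F : 𝔪.Reg} (hF : F ≠ 0) : ∃ f, 𝔪.eval f F ≠ 0 := by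
  by_contra! h
  refine hF (𝔪.regEquiv.injective ?_)
  rw [map_zero]
  refine MvPolynomial.funext fun v => ?_
  rw [map_zero, ← h (𝔪.basis.constr K v), eval_eq_aeval, MvPolynomial.aeval_eq_eval]
  congr 2
  ext ξ
  rw [Module.Basis.constr_basis]

theorem finrank_factor : Module.finrank K 𝔪.factor = Fintype.card {ξ // ξ ∉ 𝔪.M} :=
  Module.finrank_eq_card_basis 𝔪.basis

variable {s m : ℕ} {z : Fin s → 𝔪.Reg} {p q : Fin m → 𝔪.Loc z}

/-- The value of a function of the localization at a point where the `z_i` do not vanish. -/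
def locEval (f : Module.Dual K 𝔪.factor) (hf : ∀ i, 𝔪.eval f (z i) ≠ 0) : 𝔪.Loc z →ₐ[K] K :=
  IsLocalization.liftAlgHom (M := Submonoid.closure (Set.range z)) (f := 𝔪.eval f) (by
    rintro ⟨t, ht⟩
    have h : Submonoid.closure (Set.range z) ≤ (nonZeroDivisors K).comap (𝔪.eval f) := by
      refine Submonoid.closure_le.mpr ?_
      rintro _ ⟨i, rfl⟩
      exact mem_nonZeroDivisors_of_ne_zero (hf i)
    exact (nonZeroDivisors.ne_zero (h ht)).isUnit)

section Point

variable (f : Module.Dual K 𝔪.factor) (hf : ∀ i, 𝔪.eval f (z i) ≠ 0)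

theorem locEval_algebraMap (F : 𝔪.Reg) : locEval f hf (algebraMap _ _ F) = 𝔪.eval f F := by
  rw [locEval, IsLocalization.liftAlgHom_apply]
  exact IsLocalization.lift_eq _ F

/-- The linear map `b ↦ {b, ·}(f)` from the localization to the cotangent space at `f`, restricted
to linear functions. -/
def locForm : 𝔪.Loc z →ₗ[K] Module.Dual K 𝔪.factor :=
  ((𝔪.locBracket z).compl₂ ((IsScalarTower.toAlgHom K 𝔪.Reg (𝔪.Loc z)).toLinearMap ∘ₗ
    SymmetricAlgebra.ι K 𝔪.factor)).compr₂ (locEval f hf).toLinearMap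

theorem locForm_apply (b : 𝔪.Loc z) (y : 𝔪.factor) : locForm f hf b y =
    locEval f hf (𝔪.locBracket z b (algebraMap _ _ (SymmetricAlgebra.ι K 𝔪.factor y))) := rfl

theorem locForm_mul (a b : 𝔪.Loc z) : locForm f hf (a * b) =
    locEval f hf a • locForm f hf b + locEval f hf b • locForm f hf a := by
  ext y
  rw [locForm_apply, locBracket_isPoissonBracket.mul_left, map_add, map_mul, map_mul]
  rfl

theorem locForm_ι (x : 𝔪.factor) :
    locForm f hf (algebraMap _ _ (SymmetricAlgebra.ι K 𝔪.factor x)) = formMap f x := by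
  ext y
  rw [locForm_apply, locBracket, liePoisson_ι, locEval_algebraMap, formMap_apply, eval,
    SymmetricAlgebra.lift_ι_apply]

theorem locForm_one : locForm f hf 1 = 0 := by
  have h := locForm_mul f hf 1 1
  rw [mul_one, map_one (locEval f hf), one_smul] at h
  exact left_eq_add.mp h

theorem locForm_algebraMap (c : K) : locForm f hf (algebraMap K _ c) = 0 := by
  rw [Algebra.algebraMap_eq_smul_one, map_smul, locForm_one, smul_zero]

variable {f hf}

theorem IsDarboux.locForm_locUnit (h : IsDarboux z p q) (i : Fin s) :
    locForm f hf (locUnit z i) = 0 := by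
  ext y
  rw [locForm_apply, locBracket_isPoissonBracket.skew, h.central, neg_zero, map_zero]
  rfl

/-- The cotangent vectors `{b, ·}(f)` all come from linear functions. -/
theorem IsDarboux.locForm_mem_range (h : IsDarboux z p q) (b : 𝔪.Loc z) :
    locForm f hf b ∈ LinearMap.range (formMap f) := by
  have hb : b ∈ Algebra.adjoin K ((Set.range fun ξ => algebraMap 𝔪.Reg (𝔪.Loc z) (𝔪.coord ξ)) ∪
      Set.range fun i => (((locUnit z i)⁻¹ : (𝔪.Loc z)ˣ) : 𝔪.Loc z)) := by
    rw [adjoin_loc]; trivial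
  induction hb using Algebra.adjoin_induction with
  | mem x hx =>
    rcases hx with ⟨ξ, rfl⟩ | ⟨i, rfl⟩
    · exact ⟨𝔪.y ξ, (locForm_ι f hf _).symm⟩
    · have h1 := locForm_mul f hf (locUnit z i : 𝔪.Loc z) ((locUnit z i)⁻¹ : (𝔪.Loc z)ˣ)
      rw [Units.mul_inv, locForm_one, h.locForm_locUnit, smul_zero, add_zero] at h1
      have h2 : locEval f hf (locUnit z i) ≠ 0 := by
        rw [coe_locUnit, locEval_algebraMap]; exact hf i
      have h3 := (smul_eq_zero.mp h1.symm).resolve_left h2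
      change locForm f hf ((locUnit z i)⁻¹ : (𝔪.Loc z)ˣ) ∈ _
      rw [h3]
      exact zero_mem _
  | algebraMap c => rw [locForm_algebraMap]; exact zero_mem _
  | add x y _ _ hx hy => rw [map_add]; exact add_mem hx hy
  | mul x y _ _ hx hy =>
    rw [locForm_mul]
    exact add_mem (Submodule.smul_mem _ _ hy) (Submodule.smul_mem _ _ hx)

/-- Only the `p_a` and `q_a` contribute to `{b, ·}(f)`, since the `z_i` are central. -/
theorem IsDarboux.locForm_mem_span (h : IsDarboux z p q) (b : 𝔪.Loc z) : locForm f hf b ∈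
    Submodule.span K (Set.range fun a => locForm f hf ((Sum.elim p q : _ → 𝔪.Loc z) a)) := by
  have hG : ∀ G : MvPolynomial (Fin s ⊕ (Fin m ⊕ Fin m)) K, locForm f hf (MvPolynomial.aeval (darbouxCoord z p q) G) ∈
      Submodule.span K (Set.range fun a => locForm f hf ((Sum.elim p q : _ → 𝔪.Loc z) a)) := by
    intro G
    induction G using MvPolynomial.induction_on with
    | C c =>
      rw [MvPolynomial.aeval_C, locForm_algebraMap]
      exact zero_mem _
    | add G H hG hH => rw [map_add, map_add]; exact add_mem hG hH
    | mul_X G a hG =>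
      rw [map_mul, locForm_mul, MvPolynomial.aeval_X]
      refine add_mem (Submodule.smul_mem _ _ ?_) (Submodule.smul_mem _ _ hG)
      rcases a with i | a
      · exact (h.locForm_locUnit (f := f) (hf := hf) i).symm ▸ zero_mem _
      · exact Submodule.subset_span (Set.mem_range_self a)
  obtain ⟨e, G, he⟩ := h.exists_eq b
  have h1 := hG G
  have h0 : ∀ a b : 𝔪.Loc z, locForm f hf a = 0 → locForm f hf b = 0 → locForm f hf (a * b) = 0 := by
    intro a b ha hb
    rw [locForm_mul, ha, hb, smul_zero, smul_zero, add_zero]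
  have h2 : locForm f hf (∏ i, (locUnit z i : 𝔪.Loc z) ^ e i) = 0 := by
    refine Finset.prod_induction _ (fun a => locForm f hf a = 0) h0 (locForm_one f hf) fun i _ => ?_
    induction e i with
    | zero => rw [pow_zero, locForm_one]
    | succ k ih => rw [pow_succ]; exact h0 _ _ ih (h.locForm_locUnit i)
  have h3 : locEval f hf (∏ i, (locUnit z i : 𝔪.Loc z) ^ e i) ≠ 0 := by
    rw [map_prod]
    refine Finset.prod_ne_zero_iff.mpr fun i _ => ?_
    rw [map_pow, coe_locUnit, locEval_algebraMap]
    exact pow_ne_zero _ (hf i)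
  rw [he, locForm_mul, h2, smul_zero, add_zero] at h1
  exact (Submodule.smul_mem_iff _ h3).mp h1

theorem IsDarboux.linearIndependent_locForm (h : IsDarboux z p q) :
    LinearIndependent K fun a => locForm f hf ((Sum.elim p q : _ → 𝔪.Loc z) a) := by
  rw [Fintype.linearIndependent_iff]
  intro g hg
  have h0 : ∑ a, g a • (locEval f hf).toLinearMap ∘ₗ
      𝔪.locBracket z ((Sum.elim p q : _ → 𝔪.Loc z) a) = 0 := by
    refine leibniz_ext (Submonoid.closure (Set.range z)) (locEval f hf) ?_ ?_ ?_
    · intro a b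
      simp only [LinearMap.sum_apply, LinearMap.smul_apply, LinearMap.comp_apply,
        locBracket_isPoissonBracket.mul_right, AlgHom.toLinearMap_apply, map_add, map_mul,
        Finset.mul_sum, smul_eq_mul, ← Finset.sum_add_distrib]
      exact Finset.sum_congr rfl fun _ _ => by ring
    · intro a b; simp
    · intro v
      have := DFunLike.congr_fun hg v
      rw [LinearMap.sum_apply] at this
      rw [LinearMap.sum_apply]
      exact this
  refine h.pairs.eq_zero_of_sum locBracket_isPoissonBracket (locEval f hf) fun b => ?_
  have := DFunLike.congr_fun h0 b
  rw [LinearMap.sum_apply] at this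
  exact this

/-- The form `f([x, y])` has rank `2m` at the points where the `z_i` do not vanish. -/
theorem IsDarboux.finrank_range (h : IsDarboux z p q) (hf : ∀ i, 𝔪.eval f (z i) ≠ 0) :
    Module.finrank K (LinearMap.range (formMap f)) = 2 * m := by
  have h1 : LinearMap.range (formMap f) =
      Submodule.span K (Set.range fun a => locForm f hf ((Sum.elim p q : _ → 𝔪.Loc z) a)) := by
    apply le_antisymm
    · rintro _ ⟨x, rfl⟩
      rw [← locForm_ι f hf]
      exact h.locForm_mem_span _
    · rw [Submodule.span_le]
      rintro _ ⟨a, rfl⟩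
      exact h.locForm_mem_range _
  rw [h1, finrank_span_eq_card h.linearIndependent_locForm, Fintype.card_sum, Fintype.card_fin]
  omega

end Point

variable [Infinite K]

/-- Some point lies outside the zeros of all `z_i` and of a given nonzero function. -/
theorem IsDarboux.exists_regular (h : IsDarboux z p q) {F : 𝔪.Reg} (hF : F ≠ 0) :
    ∃ f, (∀ i, 𝔪.eval f (z i) ≠ 0) ∧ 𝔪.eval f F ≠ 0 := by
  obtain ⟨f, hf⟩ := exists_eval_ne_zero (mul_ne_zero (Finset.prod_ne_zero_iff.mpr fun i
    (_ : i ∈ Finset.univ) => h.ne_zero i) hF)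
  rw [map_mul, map_prod] at hf
  exact ⟨f, fun i => Finset.prod_ne_zero_iff.mp (left_ne_zero_of_mul hf) i (Finset.mem_univ i),
    right_ne_zero_of_mul hf⟩

/-- The rank of the form `f([x, y])` is at most `2m` at all points, since it is lower
semicontinuous: a minor that does not vanish at one point does not vanish at some point where the
`z_i` do not vanish either. -/
theorem IsDarboux.finrank_range_le (h : IsDarboux z p q) (f : Module.Dual K 𝔪.factor) :
    Module.finrank K (LinearMap.range (formMap f)) ≤ 2 * m := by
  by_contra! hlt
  obtain ⟨x, v, hv⟩ := exists_form_eq_one (Nat.succ_le_of_lt hlt)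
  have hΔ : ∀ f', 𝔪.eval f' (Matrix.of fun i j => SymmetricAlgebra.ι K 𝔪.factor ⁅x i, v j⁆).det =
      (Matrix.of fun i j => f' ⁅x i, v j⁆).det := by
    intro f'
    rw [AlgHom.map_det]
    congr 1
    ext i j
    exact SymmetricAlgebra.lift_ι_apply f' _
  have hΔ0 : (Matrix.of fun i j => SymmetricAlgebra.ι K 𝔪.factor ⁅x i, v j⁆).det ≠ 0 := by
    intro h0
    have h1 := hΔ f
    rw [h0, map_zero, hv, Matrix.det_one] at h1
    exact zero_ne_one h1
  obtain ⟨f', hf', hd⟩ := h.exists_regular hΔ0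
  rw [hΔ] at hd
  have := le_finrank_range_of_det hd
  rw [h.finrank_range hf'] at this
  omega

/-- The index of `ℒ` is the number of the `z_i`. -/
theorem IsDarboux.lieIndex_eq (h : IsDarboux z p q) : lieIndex K 𝔪.factor = s := by
  have hrank : ∀ f : Module.Dual K 𝔪.factor, Module.finrank K (LinearMap.range (formMap f)) +
      Module.finrank K (stabilizer f) = s + 2 * m := by
    intro f
    rw [h.card_eq, ← finrank_factor]
    exact finrank_range_add_finrank_stabilizer f
  obtain ⟨f, hf, -⟩ := h.exists_regular one_ne_zero
  apply le_antisymm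
  · refine Nat.sInf_le ⟨f, ?_⟩
    have h1 := hrank f
    rw [h.finrank_range hf] at h1
    change Module.finrank K (stabilizer f) = s
    omega
  · refine le_csInf ⟨_, f, rfl⟩ ?_
    rintro _ ⟨f', rfl⟩
    have h1 := hrank f'
    have h2 := h.finrank_range_le f'
    change s ≤ Module.finrank K (stabilizer f')
    omega

end RootIdeal

/-! ### Algebraic relations on orbits -/

/-- If no `k + 1` elements are algebraically independent, the transcendence degree is at most `k`. -/
theorem trdeg_le_of_forall_not {K A : Type*} [Field K] [CommRing A] [Algebra K A] {k : ℕ}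
    (h : ∀ x : Fin (k + 1) → A, ¬AlgebraicIndependent K x) : Algebra.trdeg K A ≤ k := by
  refine ciSup_le' fun t => ?_
  by_contra! hlt
  have h1 : ((k + 1 : ℕ) : Cardinal) ≤ Cardinal.mk t.1 := by
    rw [Nat.cast_succ, ← Cardinal.succ_natCast]
    exact Order.succ_le_of_lt hlt
  have h2 : Cardinal.lift.{_, 0} (Cardinal.mk (Fin (k + 1))) ≤ Cardinal.lift.{0, _} (Cardinal.mk t.1) := by
    simpa using h1
  obtain ⟨e⟩ := Cardinal.lift_mk_le'.mp h2
  exact h (fun i => e i) (t.2.comp e e.injective)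

/-- A nonzero polynomial over `K[X]` is the product of a power of `X` and a polynomial that does not
vanish at `X = 0`. -/
theorem exists_eq_X_pow_mul {K σ : Type*} [Field K] [Finite σ]
    {r : MvPolynomial σ (Polynomial K)} (hr : r ≠ 0) :
    ∃ (e : ℕ) (r' : MvPolynomial σ (Polynomial K)), r = MvPolynomial.C Polynomial.X ^ e * r' ∧
      MvPolynomial.map (Polynomial.evalRingHom 0) r' ≠ 0 := by
  have hfin : FiniteMultiplicity (MvPolynomial.C Polynomial.X : MvPolynomial σ (Polynomial K)) r := by
    refine FiniteMultiplicity.of_not_isUnit (fun h => ?_) hr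
    have := h.map (MvPolynomial.constantCoeff (σ := σ) (R := Polynomial K))
    rw [MvPolynomial.constantCoeff_C] at this
    exact Polynomial.not_isUnit_X this
  obtain ⟨r', h1, h2⟩ := hfin.exists_eq_pow_mul_and_not_dvd
  refine ⟨_, r', h1, fun h0 => h2 ?_⟩
  rw [MvPolynomial.C_dvd_iff_dvd_coeff]
  intro α
  have := congrArg (MvPolynomial.coeff α) h0
  rw [MvPolynomial.coeff_map, MvPolynomial.coeff_zero] at this
  rw [Polynomial.X_dvd_iff, Polynomial.coeff_zero_eq_eval_zero]
  exact this

/-- An algebraic relation between the `h_i` with coefficients in `A₀` specializes to a relation with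
constant coefficients along a family of curves `E_g` on which the elements of `A₀` do not depend on
`g`: the coefficients of the relation are divided by the largest possible power of the parameter of
the curves, and the parameter is set to zero. -/
theorem exists_specialized_relation {K S σ ι : Type*} [Field K] [CommRing S] [Algebra K S] [Finite σ]
    {A₀ : Subalgebra K S} {R : MvPolynomial σ A₀} {h : σ → S} (hR : MvPolynomial.aeval h R = 0)
    (E : ι → S →ₐ[K] Polynomial K) (g₀ : ι) (hE : ∀ g, ∀ c ∈ A₀, E g c = E g₀ c) {α : σ →₀ ℕ}
    (hα : E g₀ ((MvPolynomial.coeff α R : A₀) : S) ≠ 0) :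
    ∃ R' : MvPolynomial σ K, R' ≠ 0 ∧ ∀ g, (E g (MvPolynomial.aeval h R')).eval 0 = 0 := by
  -- The coefficients of `R` along the curve; by assumption they are the same for all `g`.
  let ψ : A₀ →+* Polynomial K := (E g₀ : S →+* Polynomial K).comp A₀.val.toRingHom
  have hr : MvPolynomial.map ψ R ≠ 0 := by
    intro h0
    have := congrArg (MvPolynomial.coeff α) h0
    rw [MvPolynomial.coeff_map] at this
    exact hα this
  obtain ⟨e, r', h1, h2⟩ := exists_eq_X_pow_mul hr
  refine ⟨_, h2, fun g => ?_⟩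
  have hψ : ψ = (E g : S →+* Polynomial K).comp (algebraMap A₀ S) := by
    ext1 c
    exact (hE g c c.2).symm
  have h3 : MvPolynomial.eval (fun i => E g (h i)) (MvPolynomial.map ψ R) = 0 := by
    rw [MvPolynomial.eval_map, hψ]
    have := MvPolynomial.eval₂_comp_left (E g : S →+* Polynomial K) (algebraMap A₀ S) h R
    rw [← MvPolynomial.aeval_def, hR, map_zero] at this
    exact this.symm
  rw [h1, map_mul, map_pow, MvPolynomial.eval_C] at h3
  have h4 := (mul_eq_zero.mp h3).resolve_left (pow_ne_zero _ Polynomial.X_ne_zero)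
  have h5 := congrArg (Polynomial.evalRingHom 0) h4
  rw [MvPolynomial.eval, MvPolynomial.coe_eval₂Hom, MvPolynomial.eval₂_comp_left, RingHom.comp_id,
    ← MvPolynomial.eval_map, map_zero] at h5
  rw [MvPolynomial.comp_aeval_apply]
  have h6 := MvPolynomial.comp_aeval_apply (fun i => E g (h i)) (Polynomial.aeval (R := K) (0 : K))
    (MvPolynomial.map (Polynomial.evalRingHom 0) r')
  rw [Polynomial.coe_aeval_eq_eval] at h6
  refine h6.trans ?_
  rw [MvPolynomial.aeval_eq_eval]
  exact h5

/-- Canonical pairs stay algebraically independent under a homomorphism whose kernel is a Poisson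
ideal: a relation of minimal degree would have vanishing partial derivatives. -/
theorem IsCanonicalPairs.algebraicIndependent_of_hom {K B A : Type*} [Field K] [CharZero K] [CommRing B]
    [CommRing A] [Nontrivial A] [Algebra K B] [Algebra K A] {br : B →ₗ[K] B →ₗ[K] B}
    (hb : IsPoissonBracket br) {m : ℕ} {p q : Fin m → B} (h : IsCanonicalPairs br p q) (ρ : B →ₐ[K] A)
    (hρ : ∀ b c, ρ c = 0 → ρ (br b c) = 0) :
    AlgebraicIndependent K (ρ ∘ (Sum.elim p q : Fin m ⊕ Fin m → B)) := by
  rw [algebraicIndependent_iff]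
  have key : ∀ (d : ℕ) (G : PolyPQ K m), G.totalDegree ≤ d →
      ρ (MvPolynomial.aeval (Sum.elim p q) G) = 0 → G = 0 := by
    intro d
    induction d using Nat.strong_induction_on with
    | _ d ih =>
    intro G hd hG
    have hp : ∀ F, ρ (MvPolynomial.aeval (Sum.elim p q) (bracketPQ K m F G)) = 0 := by
      intro F
      rw [h.aeval_bracketPQ hb]
      exact hρ _ _ hG
    have hder : ∀ i, ρ (MvPolynomial.aeval (Sum.elim p q) (MvPolynomial.pderiv i G)) = 0 := by
      rintro (a | a)
      · have h1 : bracketPQ K m (MvPolynomial.X (Sum.inr a)) G =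
            -MvPolynomial.pderiv (Sum.inl a) G := by
          rw [bracketPQ_apply, Finset.sum_eq_single a]
          · simp
          · intro b _ hba; simp [MvPolynomial.pderiv_X, hba.symm]
          · simp
        have h2 := hp (MvPolynomial.X (Sum.inr a))
        rwa [h1, map_neg, map_neg, neg_eq_zero] at h2
      · have h1 : bracketPQ K m (MvPolynomial.X (Sum.inl a)) G =
            MvPolynomial.pderiv (Sum.inr a) G := by
          rw [bracketPQ_apply, Finset.sum_eq_single a]
          · simp
          · intro b _ hba; simp [MvPolynomial.pderiv_X, hba.symm]
          · simp
        have h2 := hp (MvPolynomial.X (Sum.inl a))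
        rwa [h1] at h2
    have hzero : ∀ i, MvPolynomial.pderiv i G = 0 := by
      intro i
      by_contra h0
      exact h0 (ih _ ((totalDegree_pderiv_lt h0).trans_le hd) _ le_rfl (hder i))
    have hvars : G.vars = ∅ :=
      Finset.eq_empty_of_forall_notMem fun i => notMem_vars_of_pderiv_eq_zero (hzero i)
    obtain ⟨c, rfl⟩ : ∃ c, G = MvPolynomial.C c :=
      ⟨_, (MvPolynomial.vars_eq_empty_iff_eq_C.mp hvars)⟩
    rw [MvPolynomial.aeval_C, AlgHom.commutes, ← map_zero (algebraMap K A)] at hG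
    rw [(algebraMap K A).injective hG, map_zero]
  intro G hG
  refine key _ G le_rfl ?_
  rw [MvPolynomial.comp_aeval_apply]
  exact hG

section Line

variable {K V : Type*} [Field K] [AddCommGroup V] [Module K V]

/-- The restriction of polynomial functions to the line `a + T b`. -/
def lineHom (a b : Module.Dual K V) : SymmetricAlgebra K V →ₐ[K] Polynomial K :=
  SymmetricAlgebra.lift
    ((Polynomial.monomial 0) ∘ₗ a + (Polynomial.monomial 1) ∘ₗ b)

theorem lineHom_ι (a b : Module.Dual K V) (v : V) : lineHom a b (SymmetricAlgebra.ι K V v) =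
    Polynomial.monomial 0 (a v) + Polynomial.monomial 1 (b v) := by
  rw [lineHom, SymmetricAlgebra.lift_ι_apply]
  rfl

theorem eval_lineHom (a b : Module.Dual K V) (t : K) (F : SymmetricAlgebra K V) :
    (lineHom a b F).eval t = SymmetricAlgebra.lift (a + t • b) F := by
  induction F using SymmetricAlgebra.induction with
  | algebraMap c => rw [AlgHom.commutes, AlgHom.commutes, Polynomial.algebraMap_apply,
      Polynomial.eval_C]
  | ι v =>
    rw [lineHom_ι, SymmetricAlgebra.lift_ι_apply]
    simp [mul_comm]
  | mul x y hx hy => rw [map_mul, map_mul, Polynomial.eval_mul, hx, hy]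
  | add x y hx hy => rw [map_add, map_add, Polynomial.eval_add, hx, hy]

theorem lineHom_comp (a b : Module.Dual K V) (φ : V →ₗ[K] V)
    (α : SymmetricAlgebra K V →ₐ[K] SymmetricAlgebra K V)
    (hα : ∀ v, α (SymmetricAlgebra.ι K V v) = SymmetricAlgebra.ι K V (φ v))
    (F : SymmetricAlgebra K V) : lineHom (a ∘ₗ φ) (b ∘ₗ φ) F = lineHom a b (α F) := by
  induction F using SymmetricAlgebra.induction with
  | algebraMap c => simp only [AlgHom.commutes]
  | ι v => rw [hα, lineHom_ι, lineHom_ι]; rfl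
  | mul x y hx hy => simp only [map_mul, hx, hy]
  | add x y hx hy => simp only [map_add, hx, hy]

end Line

/-! ### The dimension of the orbits -/

/-- If the kernel of a homomorphism on a localization of `S(𝔤)` is stable, inside `S(𝔤)`, under the
brackets with linear functions, then it is a Poisson ideal. -/
theorem map_liePoisson_eq_zero {K 𝔤 B C : Type*} [Field K] [LieRing 𝔤] [LieAlgebra K 𝔤]
    [CommRing B] [Algebra K B] [Algebra (SymmetricAlgebra K 𝔤) B]
    [IsScalarTower K (SymmetricAlgebra K 𝔤) B] [CommRing C] [Algebra K C]
    (Z : Submonoid (SymmetricAlgebra K 𝔤)) [IsLocalization Z B] (ρ : B →ₐ[K] C)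
    (hρ : ∀ F, ρ (algebraMap _ B F) = 0 → ∀ x,
      ρ (algebraMap _ B (symBracket K 𝔤 (SymmetricAlgebra.ι K 𝔤 x) F)) = 0)
    {c : B} (hc : ρ c = 0) (b : B) : ρ (liePoisson B Z b c) = 0 := by
  have hb := liePoisson_isPoissonBracket (B := B) Z
  obtain ⟨F, t, hF⟩ := IsLocalization.exists_mk'_eq Z c
  have h1 : c * algebraMap _ B (t : SymmetricAlgebra K 𝔤) = algebraMap _ B F := by
    rw [← hF, IsLocalization.mk'_spec]
  have hu : IsUnit (ρ (algebraMap _ B (t : SymmetricAlgebra K 𝔤))) :=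
    (IsLocalization.map_units B t).map _
  have key : ∀ x, ρ (liePoisson B Z c (algebraMap _ _ (SymmetricAlgebra.ι K 𝔤 x))) = 0 := by
    intro x
    have h3 := hρ F (by rw [← h1, map_mul, hc, zero_mul]) x
    rw [algebraMap_symBracket Z, ← h1, hb.mul_right, map_add, map_mul, map_mul, hc, zero_mul,
      zero_add] at h3
    rw [hb.skew, map_neg, hu.mul_right_eq_zero.mp h3, neg_zero]
  have h4 := leibniz_ext Z ρ (f := ρ.toLinearMap ∘ₗ liePoisson B Z c) (g := 0)
    (fun a b => by
      rw [LinearMap.comp_apply, hb.mul_right]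
      simp only [AlgHom.toLinearMap_apply, map_add, map_mul, LinearMap.comp_apply])
    (fun a b => by simp) (fun v => key v)
  rw [hb.skew, map_neg, neg_eq_zero]
  exact DFunLike.congr_fun h4 b

namespace RootIdeal

variable {K : Type*} [Field K] [CharZero K] {n : ℕ} {𝔪 : RootIdeal K n}
variable {s m : ℕ} {z : Fin s → 𝔪.Reg} {p q : Fin m → 𝔪.Loc z}


theorem coad_eq (g : 𝔪.group) (f : Module.Dual K 𝔪.factor) : 𝔪.coad g f = f ∘ₗ 𝔪.ad g⁻¹ := rfl

theorem lineHom_coad (g : 𝔪.group) (a b : Module.Dual K 𝔪.factor) (F : 𝔪.Reg) :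
    lineHom (𝔪.coad g a) (𝔪.coad g b) F = lineHom a b (𝔪.actReg g⁻¹ F) := by
  rw [coad_eq, coad_eq]
  exact lineHom_comp a b (𝔪.ad g⁻¹) ((𝔪.actReg g⁻¹ : 𝔪.Reg ≃ₐ[K] 𝔪.Reg) : 𝔪.Reg →ₐ[K] 𝔪.Reg)
    (actReg_ι g⁻¹) F

/-- More functions than the transcendence degree of `K(ℒ*)` are algebraically dependent. -/
theorem card_le_of_algebraicIndependent {ι : Type} [Fintype ι] {x : ι → 𝔪.Reg}
    (hx : AlgebraicIndependent K x) : Fintype.card ι ≤ Fintype.card {ξ // ξ ∉ 𝔪.M} := by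
  have h1 := (hx.map' (f := IsScalarTower.toAlgHom K 𝔪.Reg 𝔪.RatFun)
    (IsFractionRing.injective 𝔪.Reg 𝔪.RatFun)).lift_cardinalMk_le_trdeg
  rw [trdeg_ratFun, Cardinal.mk_fintype, Cardinal.lift_natCast, Cardinal.lift_natCast,
    Nat.cast_le] at h1
  exact h1

theorem IsDarboux.algebraicIndependent_z (h : IsDarboux z p q) : AlgebraicIndependent K z := by
  have h1 := h.indep.comp Sum.inl Sum.inl_injective
  exact AlgebraicIndependent.of_comp (IsScalarTower.toAlgHom K 𝔪.Reg (𝔪.Loc z)) h1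

/-- Any `2m + 1` functions satisfy a nontrivial relation on a given orbit. -/
theorem IsDarboux.exists_relation (h : IsDarboux z p q) (f : Module.Dual K 𝔪.factor)
    (x : Fin (2 * m + 1) → 𝔪.Reg) : ∃ R : MvPolynomial (Fin (2 * m + 1)) K,
      R ≠ 0 ∧ MvPolynomial.aeval x R ∈ 𝔪.vanishing (𝔪.orbit f) := by
  -- Together with the `z_i` these are `s + 2m + 1` functions on a space of dimension `s + 2m`, so there
  -- is a relation over the algebra of the invariants `z_i`.
  have h1 : ¬AlgebraicIndependent (Algebra.adjoin K (Set.range z)) x := by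
    intro h0
    have h2 := card_le_of_algebraicIndependent
      (AlgebraicIndependent.sumElim_iff.mpr ⟨h.algebraicIndependent_z, h0⟩)
    rw [← h.card_eq, Fintype.card_sum, Fintype.card_fin, Fintype.card_fin] at h2
    omega
  rw [algebraicIndependent_iff] at h1
  push Not at h1
  obtain ⟨R, hR, hR0⟩ := h1
  obtain ⟨α, hα⟩ := MvPolynomial.ne_zero_iff.mp hR0
  have hα' : ((MvPolynomial.coeff α R : Algebra.adjoin K (Set.range z)) : 𝔪.Reg) ≠ 0 :=
    fun h0 => hα (Subtype.ext h0)
  obtain ⟨f₁, hf₁⟩ := exists_eval_ne_zero hα'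
  have hinv : Algebra.adjoin K (Set.range z) ≤ 𝔪.invReg := by
    refine Algebra.adjoin_le ?_
    rintro _ ⟨i, rfl⟩
    exact h.mem_invReg i
  -- The line from `f` to a point where a coefficient of the relation does not vanish, moved by the
  -- group: the invariant coefficients take the same values on all these lines.
  obtain ⟨R', hR'0, hR'⟩ := exists_specialized_relation hR
    (fun g : 𝔪.group => lineHom (𝔪.coad g f) (𝔪.coad g (f₁ - f))) 1
    (fun g c hc => by
      rw [lineHom_coad, lineHom_coad, hinv hc, hinv hc]) (α := α) (by
      rw [lineHom_coad, hinv (Subtype.prop _)]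
      intro h0
      refine hf₁ ?_
      have h2 := congrArg (Polynomial.eval 1) h0
      rw [eval_lineHom, one_smul, add_sub_cancel, Polynomial.eval_zero] at h2
      exact h2)
  refine ⟨R', hR'0, ?_⟩
  rintro _ ⟨g, rfl⟩
  have h2 := hR' g
  rw [eval_lineHom, zero_smul, add_zero] at h2
  exact h2

theorem IsDarboux.dim_orbit_le (h : IsDarboux z p q) (f : Module.Dual K 𝔪.factor) :
    𝔪.dim (𝔪.orbit f) ≤ ((2 * m : ℕ) : Cardinal) := by
  refine trdeg_le_of_forall_not fun x hx => ?_
  choose y hy using fun i => Ideal.Quotient.mk_surjective (x i)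
  obtain ⟨R, hR0, hR⟩ := h.exists_relation f y
  refine hR0 (algebraicIndependent_iff.mp hx R ?_)
  have h1 : x = fun i => Ideal.Quotient.mkₐ K (𝔪.vanishing (𝔪.orbit f)) (y i) :=
    funext fun i => (hy i).symm
  rw [h1, ← MvPolynomial.comp_aeval_apply]
  exact Ideal.Quotient.eq_zero_iff_mem.mpr hR

/-- The ideal of an orbit is stable under the bracket with linear functions. -/
theorem symBracket_mem_vanishing (f : Module.Dual K 𝔪.factor) {F : 𝔪.Reg}
    (hF : F ∈ 𝔪.vanishing (𝔪.orbit f)) (x : 𝔪.factor) :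
    symBracket K 𝔪.factor (SymmetricAlgebra.ι K 𝔪.factor x) F ∈ 𝔪.vanishing (𝔪.orbit f) := by
  have hroot : ∀ ξ : Root n, symBracket K 𝔪.factor (SymmetricAlgebra.ι K 𝔪.factor (𝔪.y ξ)) F ∈
      𝔪.vanishing (𝔪.orbit f) := by
    rintro ξ _ ⟨g, rfl⟩
    have hξ := isColumn_rootVec (K := K) ξ
    -- `F` vanishes along the curves that the elements `1 + c y_ξ` trace in the orbit; the bracket is
    -- the derivative of `F` along them.
    have h1 : Polynomial.map (𝔪.eval (𝔪.coad g f) : 𝔪.Reg →+* K) (flow K (𝔪.y ξ) F) = 0 := by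
      refine Polynomial.funext fun c => ?_
      rw [Polynomial.eval_zero]
      have h2 := hF (𝔪.coad ((𝔪.columnElt (hξ.smul c))⁻¹ * g) f) ⟨_, rfl⟩
      rw [map_mul, Module.End.mul_apply, ← eval_actReg, actReg_columnElt hξ c F] at h2
      have h3 := Polynomial.eval_map_apply (𝔪.eval (𝔪.coad g f) : 𝔪.Reg →+* K)
        (p := flow K (𝔪.y ξ) F) (algebraMap K 𝔪.Reg c)
      have h4 : (𝔪.eval (𝔪.coad g f) : 𝔪.Reg →+* K) (algebraMap K 𝔪.Reg c) = c :=
        (𝔪.eval (𝔪.coad g f)).commutes c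
      rw [h4] at h3
      exact h3.trans h2
    have h2 := congrArg (fun P => Polynomial.coeff P 1) h1
    simp only [Polynomial.coeff_map, coeff_one_flow, Polynomial.coeff_zero] at h2
    exact h2
  have hx : x ∈ Submodule.span K (Set.range 𝔪.basis) := by
    rw [𝔪.basis.span_eq]; trivial
  induction hx using Submodule.span_induction with
  | mem x hx =>
    obtain ⟨ξ, rfl⟩ := hx
    rw [basis_apply]
    exact hroot ξ
  | zero => rw [map_zero, map_zero, LinearMap.zero_apply]; exact zero_mem _
  | add x y _ _ hx hy => rw [map_add, map_add, LinearMap.add_apply]; exact add_mem hx hy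
  | smul c x _ hx =>
    rw [map_smul, map_smul, LinearMap.smul_apply, Algebra.smul_def]
    exact Ideal.mul_mem_left _ _ hx

section Restriction

variable (f : Module.Dual K 𝔪.factor)

/-- Invariants are constant on the orbit. -/
theorem mk_invariant {F : 𝔪.Reg} (hF : F ∈ 𝔪.invReg) :
    Ideal.Quotient.mkₐ K (𝔪.vanishing (𝔪.orbit f)) F = algebraMap K _ (𝔪.eval f F) := by
  rw [← AlgHom.commutes (Ideal.Quotient.mkₐ K (𝔪.vanishing (𝔪.orbit f)))]
  refine Ideal.Quotient.eq.mpr ?_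
  rintro _ ⟨g, rfl⟩
  rw [map_sub, AlgHom.commutes, sub_eq_zero]
  have h1 := eval_actReg 𝔪 g⁻¹ F f
  rw [hF, inv_inv] at h1
  exact h1.symm

/-- The restriction of functions to the orbit of a point where the `z_i` do not vanish. -/
def restrict (h : IsDarboux z p q) (hf : ∀ i, 𝔪.eval f (z i) ≠ 0) :
    𝔪.Loc z →ₐ[K] 𝔪.Reg ⧸ 𝔪.vanishing (𝔪.orbit f) :=
  IsLocalization.liftAlgHom (M := Submonoid.closure (Set.range z))
    (f := Ideal.Quotient.mkₐ K (𝔪.vanishing (𝔪.orbit f))) (by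
    rintro ⟨t, ht⟩
    have h : Submonoid.closure (Set.range z) ≤ (IsUnit.submonoid _).comap
        (Ideal.Quotient.mkₐ K (𝔪.vanishing (𝔪.orbit f))) := by
      refine Submonoid.closure_le.mpr ?_
      rintro _ ⟨i, rfl⟩
      change IsUnit (Ideal.Quotient.mkₐ K (𝔪.vanishing (𝔪.orbit f)) (z i))
      rw [mk_invariant f (h.mem_invReg i)]
      exact (hf i).isUnit.map (algebraMap K _)
    exact h ht)

variable {f} (h : IsDarboux z p q) (hf : ∀ i, 𝔪.eval f (z i) ≠ 0)

theorem restrict_algebraMap (F : 𝔪.Reg) : restrict f h hf (algebraMap _ _ F) =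
    Ideal.Quotient.mkₐ K (𝔪.vanishing (𝔪.orbit f)) F := by
  rw [restrict, IsLocalization.liftAlgHom_apply]
  exact IsLocalization.lift_eq _ F

/-- The functions that vanish on the orbit form a Poisson ideal. -/
theorem restrict_bracket {c : 𝔪.Loc z} (hc : restrict f h hf c = 0) (b : 𝔪.Loc z) :
    restrict f h hf (𝔪.locBracket z b c) = 0 :=
  map_liePoisson_eq_zero (Submonoid.closure (Set.range z)) (restrict f h hf)
    (fun F hF x => (restrict_algebraMap h hf _).trans (Ideal.Quotient.eq_zero_iff_mem.mpr
      (symBracket_mem_vanishing f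
        (Ideal.Quotient.eq_zero_iff_mem.mp ((restrict_algebraMap h hf F).symm.trans hF)) x))) hc b

include h hf in
/-- The orbits of the points where the `z_i` do not vanish have dimension at least `2m`. -/
theorem IsDarboux.le_dim_orbit : ((2 * m : ℕ) : Cardinal) ≤ 𝔪.dim (𝔪.orbit f) := by
  have : Nontrivial (𝔪.Reg ⧸ 𝔪.vanishing (𝔪.orbit f)) := by
    refine Ideal.Quotient.nontrivial_iff.mpr fun h0 => ?_
    have h1 : (1 : 𝔪.Reg) ∈ 𝔪.vanishing (𝔪.orbit f) := by rw [h0]; trivial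
    have h2 := h1 _ ⟨1, rfl⟩
    rw [map_one] at h2
    exact one_ne_zero h2
  have h1 := (h.pairs.algebraicIndependent_of_hom locBracket_isPoissonBracket (restrict f h hf)
    fun b c hc => restrict_bracket h hf hc b).lift_cardinalMk_le_trdeg
  rw [Cardinal.mk_fintype, Cardinal.lift_natCast, Fintype.card_sum, Fintype.card_fin,
    ← two_mul] at h1
  change _ ≤ Algebra.trdeg K (𝔪.Reg ⧸ 𝔪.vanishing (𝔪.orbit f))
  simpa using h1

end Restriction

theorem IsDarboux.isGreatest_dim (h : IsDarboux z p q) :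
    IsGreatest (Set.range fun f : Module.Dual K 𝔪.factor => 𝔪.dim (𝔪.orbit f))
      ((2 * m : ℕ) : Cardinal) := by
  obtain ⟨f, hf, -⟩ := h.exists_regular one_ne_zero
  refine ⟨⟨f, le_antisymm (h.dim_orbit_le f) (h.le_dim_orbit hf)⟩, ?_⟩
  rintro _ ⟨f', rfl⟩
  exact h.dim_orbit_le f'

end RootIdeal

end UTFactor

end

theorem theorem2 (K : Type*) [Field K] [CharZero K] (n : ℕ) (𝔪 : UTFactor.RootIdeal K n) :
    ((∃ z : Fin 𝔪.s → 𝔪.Reg, 𝔪.IsCasimirSystem z) ∧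
      ∀ z : Fin 𝔪.s → 𝔪.Reg, 𝔪.IsCasimirSystem z →
        𝔪.invRat =
          IntermediateField.adjoin K (Set.range fun i => algebraMap 𝔪.Reg 𝔪.RatFun (z i))) ∧
    IsGreatest (Set.range fun f : Module.Dual K 𝔪.factor => 𝔪.dim (𝔪.orbit f))
      ((𝔪.diagram.count UTFactor.Mark.plus + 𝔪.diagram.count UTFactor.Mark.minus : ℕ) : Cardinal) ∧
    UTFactor.lieIndex K 𝔪.factor = 𝔪.diagram.count UTFactor.Mark.cross := by
  obtain ⟨z, hz⟩ := 𝔪.exists_isCasimirSystem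
  obtain ⟨m, p, q, h⟩ := hz.exists_isDarboux
  refine ⟨⟨⟨z, hz⟩, fun z hz => hz.invRat_eq⟩, ?_, h.lieIndex_eq⟩
  rw [← h.two_mul_eq]
  exact h.isGreatest_dim
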